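/- Let $d\ge 2$ and let $\Gamma\subset\mathbb R^d$ be a smooth, compact, connected, embedded hypersurface without boundary. Let $i\ge 1$ be an integer and let $m(u)=(1-u^2)^i\tilde m(u)$, where $\tilde m\in C^\infty([-1,1])$, $\tilde m>0$ and $m$ is even. Let $n,A,\tau\in C^\infty([-1,1])$ with $A^2\tau>0$ on $(-1,1)$, $n\neq 0$ a.e., $n'\ne 0$ on $[-1,1]$ and $\inf_{(-1,1)}\frac{n^2}{A^2\tau\sqrt{1-u^2}}>0$. Put $$a(u)=\frac{1}{A^2\tau}\Big(\frac{n^2}{n'}\Big)^2\frac{1}{1-u^2},\quad \mathsf a(u)=\frac{1}{A^2\tau}\Big(\frac{n^2}{n'}\Big)^2\frac1{\sqrt{1-u^2}},\quad \mathsf m(u)=\frac{m(u)}{\sqrt{1-u^2}},\quad \sigma=\int_{-1}^1\sqrt{1-u^2}\,du,$$ and assume $a(u)m(u)=1$ on $(-1,1)$. Let $$\mathcal Cf=\int_{-1}^1\big(f+\tfrac{n}{n'}\partial_uf\big)\,du,\qquad (f,g)_{\mathcal E}=\int_\Gamma\int_{-1}^1\big(\mathsf a\,\partial_uf\,\partial_ug+\mathsf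 m\,\nabla_\Gamma f\cdot\nabla_\Gamma g\big)\,du\,d\mathcal H^{d-1},$$ and let $H$ be the completion of $\{f\in C^\infty(\Gamma\times[-1,1]):\sqrt{\mathsf a}\,\partial_uf\in L^2,\ \mathcal Cf\in H^1(\Gamma)\}$ with respect to the inner product $(f,g)_{\mathcal E}+(\mathcal Cf,\mathcal Cg)_{H^1(\Gamma)}$. Then for every $\kappa\in H^1(\Gamma)$ there is exactly one pair $(\mathsf f,\mathsf V)\in H\times H^1(\Gamma)^*$ such that $\mathcal C\mathsf f=\sigma\kappa$ and $(\mathsf f,\varphi)_{\mathcal E}=\langle \mathsf V,\mathcal C\varphi\rangle$ for all $\varphi\in H$. The operator $\mathcal G_\Gamma:H^1(\Gamma)\to H^1(\Gamma)^*$, $\kappa\mapsto\mathsf V$, has the form $$\mathcal G_\Gamma=\sigma\eta\sqrt{-\Delta_\Gamma}+\sigma\,\mathcal R(\sqrt{-\Delta_\Gamma}),\qquad \eta=\Big(\big(\tfrac{n(1)}{n'(1)}\big)^2+\big(\tfrac{n(-1)}{n'(-1)}\big)^2\Big)^{-1},$$ with a function $\mathcal R:\mathbb R\to\mathbb R$ satisfying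 $|\mathcal R(\sqrt\lambda)|\le C\lambda^{\frac12-\frac1{2i+1}}$ for all $\lambda>0$. Here, for any orthonormal basis $(e_k)$ of $\{h\in L^2(\Gamma):\int_\Gamma h=0\}$ composed of eigenfunctions of $-\Delta_\Gamma$ with eigenvalues $\lambda_k$, functions of $\sqrt{-\Delta_\Gamma}$ are understood as $\langle\phi(\sqrt{-\Delta_\Gamma})h,\psi\rangle=\sum_k\phi(\sqrt{\lambda_k})(h,e_k)_{L^2}(\psi,e_k)_{L^2}$ for $h,\psi\in H^1(\Gamma)$. The remainder $\mathcal R(\sqrt{-\Delta_\Gamma})$ has order at most $\frac{2i-1}{2i+1}<1$: with $\|g\|_{\dot H^s}^2=\sum_k\lambda_k^s g_k^2$ it is bounded from $\dot H^s$ to $\dot H^{s-\frac{2i-1}{2i+1}}$ for all $s\in\mathbb R$. In particular, for linear degeneracy $i=1$ it has order at most $\frac13$ and its eigenvalue symbol is $O(\lambda^{1/6})$. If, in addition, $n$ is affine, then $\mathcal R(\sqrt{-\Delta_\Gamma})$ extends to a bounded linear operator on $L^2(\Gamma)$, and $(\mathcal R(\sqrt{-\Delta_\Gamma})e_k,e_k)_{L^2(\Gamma)}$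 decays to zero faster than any power of $\lambda_k$ as $\lambda_k\to\infty$. -/

import Mathlib

open MeasureTheory Set Filter Topology
open scoped ContDiff NNReal ENNReal InnerProductSpace

noncomputable section

/-! ## Coefficient functions -/

/-- The closed interval `[-1, 1]` in which the order parameter `u` varies. -/
abbrev phaseInterval : Set ℝ := Icc (-1) 1

/-- Derivative on `[-1, 1]` (one-sided at the end points). -/
def dPhase (n : ℝ → ℝ) (u : ℝ) : ℝ := derivWithin n phaseInterval u

/-- The quotient `c = n / n'`. -/
def quotC (n : ℝ → ℝ) (u : ℝ) : ℝ := n u / dPhase n u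

/-- The function `a(u) = (1 / (A² τ)) (n² / n')² / (1 - u²)`. -/
def coeffA (n A τ : ℝ → ℝ) (u : ℝ) : ℝ :=
  1 / (A u ^ 2 * τ u) * (n u ^ 2 / dPhase n u) ^ 2 * (1 / (1 - u ^ 2))

/-- The weight `𝖺(u) = (1 / (A² τ)) (n² / n')² / √(1 - u²)`. -/
def weightA (n A τ : ℝ → ℝ) (u : ℝ) : ℝ :=
  1 / (A u ^ 2 * τ u) * (n u ^ 2 / dPhase n u) ^ 2 * (1 / √(1 - u ^ 2))

/-- The weight `𝗆(u) = m(u) / √(1 - u²)`. -/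
def weightM (m : ℝ → ℝ) (u : ℝ) : ℝ := m u / √(1 - u ^ 2)

/-- The constant `σ = ∫_{-1}^{1} √(1 - u²) du`. -/
def sigmaConst : ℝ := ∫ u in (-1 : ℝ)..1, √(1 - u ^ 2)

/-- The constant `η = ((n(1)/n'(1))² + (n(-1)/n'(-1))²)⁻¹`. -/
def etaConst (n : ℝ → ℝ) : ℝ := (quotC n 1 ^ 2 + quotC n (-1) ^ 2)⁻¹

/-- Standing hypotheses on the mobility `m` (degenerate of order `i ≥ 1` at `±1`), the coupling
function `n`, the bulk modulus `A` and the relaxation time `τ`. -/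
structure CoefficientHypotheses (i : ℕ) (m n A τ : ℝ → ℝ) : Prop where
  one_le : 1 ≤ i
  mobility : ∃ mt : ℝ → ℝ, ContDiffOn ℝ ∞ mt phaseInterval ∧
    (∀ u ∈ phaseInterval, 0 < mt u) ∧
    ∀ u ∈ phaseInterval, m u = (1 - u ^ 2) ^ i * mt u
  smooth_n : ContDiffOn ℝ ∞ n phaseInterval
  smooth_A : ContDiffOn ℝ ∞ A phaseInterval
  smooth_τ : ContDiffOn ℝ ∞ τ phaseInterval
  ae_ne_zero : ∀ᵐ u ∂(volume.restrict phaseInterval), n u ≠ 0 ∧ dPhase n u ≠ 0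
  pos : ∀ u ∈ Ioo (-1 : ℝ) 1, 0 < A u ^ 2 * τ u
  inf_pos : ∃ ι : ℝ, 0 < ι ∧
    ∀ u ∈ Ioo (-1 : ℝ) 1, ι ≤ n u ^ 2 / (A u ^ 2 * τ u * √(1 - u ^ 2))
  deriv_ne_zero : ∀ u ∈ phaseInterval, dPhase n u ≠ 0
  proportional : ∃ a₀ : ℝ, 0 < a₀ ∧ ∀ u ∈ Ioo (-1 : ℝ) 1, coeffA n A τ u = a₀ / m u
  even : ∀ u ∈ phaseInterval, m (-u) = m u

/-- `n` is an affine function on `[-1, 1]`. -/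
def IsAffineCoupling (n : ℝ → ℝ) : Prop :=
  ∃ β₀ β₁ : ℝ, ∀ u ∈ phaseInterval, n u = β₀ + β₁ * (u + 1)

/-! ## Hypersurfaces -/

/-- Euclidean space `ℝᵈ`. -/
abbrev Eucl (d : ℕ) : Type := EuclideanSpace ℝ (Fin d)

/-- Smooth, closed (compact, without boundary), connected, embedded hypersurface of `ℝᵈ`:
locally the zero set of a smooth function with nonvanishing differential. -/
structure IsClosedHypersurface {d : ℕ} (Γ : Set (Eucl d)) : Prop where
  compact : IsCompact Γ
  connected : IsConnected Γ
  locally_level : ∀ x ∈ Γ, ∃ (U : Set (Eucl d)) (φ : Eucl d → ℝ), IsOpen U ∧ x ∈ U ∧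
    ContDiffOn ℝ ∞ φ U ∧ (∀ y ∈ U, fderiv ℝ φ y ≠ 0) ∧ Γ ∩ U = {y ∈ U | φ y = 0}

/-- The surface measure on `Γ`: the `(d-1)`-dimensional Hausdorff measure restricted to `Γ`. -/
def surfaceMeasure {d : ℕ} (Γ : Set (Eucl d)) : Measure (Eucl d) :=
  (Measure.euclideanHausdorffMeasure (d - 1)).restrict Γ

/-- The tangent space `T_x Γ`, spanned by the velocities at `x` of curves in `Γ` through `x`. -/
def tangentSpaceAt {d : ℕ} (Γ : Set (Eucl d)) (x : Eucl d) : Submodule ℝ (Eucl d) :=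
  Submodule.span ℝ {v | ∃ γ : ℝ → Eucl d, γ 0 = x ∧ (∀ t, γ t ∈ Γ) ∧ HasDerivAt γ v 0}

/-- The tangential gradient `∇_Γ h (x)`: the orthogonal projection onto `T_x Γ` of the gradient
of (an extension to `ℝᵈ` of) `h`. -/
def surfaceGradient {d : ℕ} (Γ : Set (Eucl d)) (h : Eucl d → ℝ) (x : Eucl d) : Eucl d :=
  (tangentSpaceAt Γ x).starProjection (gradient h x)

/-- `L²(Γ)`. -/
abbrev L2Surf {d : ℕ} (Γ : Set (Eucl d)) : Type := Lp ℝ 2 (surfaceMeasure Γ)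

/-- Square integrable vector fields on `Γ`. -/
abbrev L2SurfVec {d : ℕ} (Γ : Set (Eucl d)) : Type := Lp (Eucl d) 2 (surfaceMeasure Γ)

/-- `H¹(Γ)` as a closed subspace of `L²(Γ) × L²(Γ; ℝᵈ)`: the closure of the set of the pairs
`(h, ∇_Γ h)` with `h ∈ C^∞(Γ)`, i.e. the completion of `C^∞(Γ)` in the `H¹`-norm.
Smooth functions on the compact submanifold `Γ` are the restrictions of smooth functions
on `ℝᵈ`. -/
def sobolevSubmodule {d : ℕ} (Γ : Set (Eucl d)) :
    Submodule ℝ (WithLp 2 (L2Surf Γ × L2SurfVec Γ)) :=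
  (Submodule.span ℝ {w | ∃ h : Eucl d → ℝ, ContDiff ℝ ∞ h ∧
    w.fst =ᵐ[surfaceMeasure Γ] h ∧
    w.snd =ᵐ[surfaceMeasure Γ] surfaceGradient Γ h}).topologicalClosure

/-- The Hilbert space `H¹(Γ)`, with inner product `(h, k)_{L²} + (∇_Γ h, ∇_Γ k)_{L²}`. -/
abbrev H1Surf {d : ℕ} (Γ : Set (Eucl d)) : Type := ↥(sobolevSubmodule Γ)

/-- The dual space `H¹(Γ)*`. -/
abbrev H1SurfDual {d : ℕ} (Γ : Set (Eucl d)) : Type := H1Surf Γ →L[ℝ] ℝ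

/-- The inclusion `H¹(Γ) → L²(Γ)`. -/
def H1Surf.toL2 {d : ℕ} {Γ : Set (Eucl d)} (h : H1Surf Γ) : L2Surf Γ := h.1.fst

/-- The weak gradient `∇_Γ : H¹(Γ) → L²(Γ; ℝᵈ)`. -/
def H1Surf.grad {d : ℕ} {Γ : Set (Eucl d)} (h : H1Surf Γ) : L2SurfVec Γ := h.1.snd

/-! ## The constrained elliptic problem -/

/-- The product measure on `Γ × [-1, 1]`. -/
def bulkMeasure {d : ℕ} (Γ : Set (Eucl d)) : Measure (Eucl d × ℝ) :=
  (surfaceMeasure Γ).prod (volume.restrict phaseInterval)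

/-- `∂_u f`. -/
def partialU {d : ℕ} (f : Eucl d × ℝ → ℝ) (p : Eucl d × ℝ) : ℝ :=
  deriv (fun v => f (p.1, v)) p.2

/-- `𝒞f (x) = ∫_{-1}^{1} (f(x,u) + (n/n')(u) ∂_u f(x,u)) du`. -/
def constraintMap {d : ℕ} (n : ℝ → ℝ) (f : Eucl d × ℝ → ℝ) (x : Eucl d) : ℝ :=
  ∫ u in (-1 : ℝ)..1, (f (x, u) + quotC n u * partialU f (x, u))

/-- The Hilbert space in which the triples `(√𝖺 ∂_u f, √𝗆 ∇_Γ f, 𝒞f)` live. -/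
abbrev EnergyAmbient {d : ℕ} (Γ : Set (Eucl d)) : Type :=
  WithLp 2 (Lp ℝ 2 (bulkMeasure Γ) × WithLp 2 (Lp (Eucl d) 2 (bulkMeasure Γ) × H1Surf Γ))

/-- The energy space `H` is the completion of
`Ĥ = {f ∈ C^∞(Γ × [-1,1]) : √𝖺 ∂_u f ∈ L², 𝒞f ∈ H¹(Γ)}` with respect to the inner product
`(f, g)_H = ∫∫ (𝖺 ∂_u f ∂_u g + 𝗆 ∇_Γ f · ∇_Γ g) + (𝒞f, 𝒞g)_{H¹(Γ)}`.
The map `f ↦ (√𝖺 ∂_u f, √𝗆 ∇_Γ f, 𝒞f)` is an isometry from `Ĥ` into a Hilbert space, so the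
completion is realised as the closure of its image. -/
def energySubmodule {d : ℕ} (Γ : Set (Eucl d)) (m n A τ : ℝ → ℝ) :
    Submodule ℝ (EnergyAmbient Γ) :=
  (Submodule.span ℝ {w | ∃ f : Eucl d × ℝ → ℝ, ContDiff ℝ ∞ f ∧
    (w.fst =ᵐ[bulkMeasure Γ] fun p => √(weightA n A τ p.2) * partialU f p) ∧
    (w.snd.fst =ᵐ[bulkMeasure Γ]
      fun p => √(weightM m p.2) • surfaceGradient Γ (fun x => f (x, p.2)) p.1) ∧
    (H1Surf.toL2 w.snd.snd =ᵐ[surfaceMeasure Γ] constraintMap n f)}).topologicalClosure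

/-- The energy space `H`. -/
abbrev EnergySpace {d : ℕ} (Γ : Set (Eucl d)) (m n A τ : ℝ → ℝ) : Type :=
  ↥(energySubmodule Γ m n A τ)

/-- The extension to `H` of the form `(f, g)_ℰ = ∫∫ (𝖺 ∂_u f ∂_u g + 𝗆 ∇_Γ f · ∇_Γ g)`. -/
def energyForm {d : ℕ} {Γ : Set (Eucl d)} {m n A τ : ℝ → ℝ}
    (f g : EnergySpace Γ m n A τ) : ℝ :=
  ⟪f.1.fst, g.1.fst⟫_ℝ + ⟪f.1.snd.fst, g.1.snd.fst⟫_ℝ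

/-- The extension `𝒞 : H → H¹(Γ)` of the constraint map. -/
def energyConstraint {d : ℕ} {Γ : Set (Eucl d)} {m n A τ : ℝ → ℝ}
    (f : EnergySpace Γ m n A τ) : H1Surf Γ := f.1.snd.snd

/-- `(f, V) ∈ H × H¹(Γ)*` solves the constrained elliptic problem with datum `κ ∈ H¹(Γ)`:
`(f, φ)_ℰ = ⟨V, 𝒞φ⟩` for all `φ ∈ H`, and `𝒞f = σ κ`. -/
def IsConstrainedSolution {d : ℕ} (Γ : Set (Eucl d)) (m n A τ : ℝ → ℝ) (κ : H1Surf Γ)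
    (p : EnergySpace Γ m n A τ × H1SurfDual Γ) : Prop :=
  (∀ φ : EnergySpace Γ m n A τ, energyForm p.1 φ = p.2 (energyConstraint φ)) ∧
    energyConstraint p.1 = sigmaConst • κ

open Classical in
/-- The propagation operator `𝒢_Γ : H¹(Γ) → H¹(Γ)*`, `κ ↦ V`, where `(f, V)` is the solution
of the constrained elliptic problem with datum `κ`. -/
def propagationOperator {d : ℕ} (Γ : Set (Eucl d)) (m n A τ : ℝ → ℝ) (κ : H1Surf Γ) :
    H1SurfDual Γ :=
  if h : ∃ p, IsConstrainedSolution Γ m n A τ κ p then h.choose.2 else 0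

/-! ## Spectral calculus of the Laplace–Beltrami operator -/

/-- `(e_k)` is an orthonormal basis of `{h ∈ L²(Γ) : ∫_Γ h = 0}` composed of (weak)
eigenfunctions of `-Δ_Γ`, with eigenvalues `lam k`. -/
structure IsLaplaceEigenbasis {d : ℕ} (Γ : Set (Eucl d)) (e : ℕ → H1Surf Γ)
    (lam : ℕ → ℝ) : Prop where
  orthonormal : Orthonormal ℝ fun k => (e k).toL2
  mean_zero : ∀ k, ∫ x, (e k).toL2 x ∂(surfaceMeasure Γ) = 0
  complete : ∀ h : L2Surf Γ, ∫ x, h x ∂(surfaceMeasure Γ) = 0 →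
    (∀ k, ⟪(e k).toL2, h⟫_ℝ = 0) → h = 0
  eigen : ∀ k, ∀ ψ : H1Surf Γ, ⟪(e k).grad, ψ.grad⟫_ℝ = lam k * ⟪(e k).toL2, ψ.toL2⟫_ℝ

/-- `T = φ(√(-Δ_Γ))` as an operator `H¹(Γ) → H¹(Γ)*`, in the sense of the functional calculus:
`⟨T h, ψ⟩ = ∑_k φ(√λ_k) (h, e_k) (ψ, e_k)`. -/
def IsFunctionOfSqrtLaplacian {d : ℕ} {Γ : Set (Eucl d)} (e : ℕ → H1Surf Γ) (lam : ℕ → ℝ)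
    (φ : ℝ → ℝ) (T : H1Surf Γ →L[ℝ] H1SurfDual Γ) : Prop :=
  ∀ h ψ : H1Surf Γ,
    HasSum (fun k => φ (√(lam k)) * ⟪(e k).toL2, h.toL2⟫_ℝ * ⟪(e k).toL2, ψ.toL2⟫_ℝ) (T h ψ)

/-- `T` has order at most `r` with respect to `√(-Δ_Γ)`: on the scale of homogeneous Sobolev
spaces, `‖g‖²_{Ḣˢ} = ∑_k λ_kˢ g_k²`, it is bounded from `Ḣˢ` to `Ḣ^{s-r}` for every real `s`. -/
def HasOrderAtMost {d : ℕ} {Γ : Set (Eucl d)} (e : ℕ → H1Surf Γ) (lam : ℕ → ℝ)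
    (r : ℝ) (T : H1Surf Γ →L[ℝ] H1SurfDual Γ) : Prop :=
  ∀ s : ℝ, ∃ C : ℝ≥0, ∀ h : H1Surf Γ,
    ∑' k, ENNReal.ofReal (lam k ^ (s - r) * (T h (e k)) ^ 2) ≤
      C * ∑' k, ENNReal.ofReal (lam k ^ s * ⟪(e k).toL2, h.toL2⟫_ℝ ^ 2)

end

/-!
The constrained elliptic problem separates. If `h` is an eigenfunction of `-Δ_Γ` with eigenvalue
`μ²`, `μ > 0`, its solution is a multiple of `w(u) h(x)`, where, with `𝗆` the mobility weight and
`c = n / n'`, the profile `w` solves the transversal problem `w' = 𝗆 z`, `z' = μ² 𝗆 w - (1 - c')`,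
`z(±1) = c(±1)` (`IsProfile`). Here `a m = 1` is used in the form `𝖺 = 1 / 𝗆`: the flux `𝖺 w'` is
`z`. Hence `𝒢_Γ h = σ h / ℓ(μ)`, where `ℓ(μ) = ∫ (w + c w')` is the value of the constraint on the
profile (`propagationOperator_eigen`), and the theorem reduces to the asymptotics of `1 / ℓ(μ)`
(`exists_transversal_symbol`).

In the variable `s = ∫_{-1}^u 𝗆` the transversal problem has constant coefficients, with length
`S = ∫_{-1}^1 𝗆`. The two combinations `z ± μ w` solve first order equations, so that up to
exponentially small terms `μ ℓ(μ)` is `c(1)² + c(-1)²`, plus an error controlled by the mass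
`∫ exp(-μ |s(u) - s(r)|) du` of the exponential kernel (`IsProfile.abs_constraint_sub_le`). As `𝗆`
vanishes at most like `(1 - u²)^{i - 1/2}`, the variable `s` separates points of distance `t` at least
like `t^{i + 1/2}`, which makes this mass `O(μ^{-2/(2i+1)})` (`exists_kernel_bound`). This is the
power in the bound for the remainder. The error carries the factor `1 - c'`, which vanishes if `n` is
affine; only the exponentially small terms are left then.

On the functional analytic side, `H` is the closure of a set of triples `(√𝖺 ∂_u f, √𝗆 ∇_Γ f, 𝒞f)`.
The constraint map on `H` is onto, with right inverse `h ↦ h / 2` (constant in `u`), and the energy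
form is the inner product of `H` minus that of the constraints, so orthogonal projection onto the
kernel of the constraint solves the problem (`existsUnique_constrained`). Profiles are not smooth up
to `u = ±1`, and `separated_mem_of_hasDerivAt` approximates them by smooth functions. The weak
gradient on the closure `H¹(Γ)` is treated as an independent component, without showing that it is
determined by the function: the operator is symmetric, it vanishes on elements with zero gradient,
and also on elements with zero `L²` component, since those behave like eigenvectors for every `μ` and
`1 / ℓ(μ) = o(μ²)` (`propagationOperator_of_toL2_eq_zero`). It is therefore diagonal in any eigenbasis
(`propagationOperator_hasSum`).
-/

/-! ### Finiteness of the surface measure -/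

/-- Implicit function theorem and Lipschitz images: a regular level set is locally the Lipschitz
image of a ball of the kernel of the differential, a space of dimension `d - 1`. -/
lemma levelSet_hausdorff_finiteAt {d : ℕ} (hd : 2 ≤ d) {φ : Eucl d → ℝ} {x : Eucl d}
    (hφ : HasStrictFDerivAt φ (fderiv ℝ φ x) x) (hne : fderiv ℝ φ x ≠ 0) :
    ∃ t ∈ 𝓝 x, (Measure.euclideanHausdorffMeasure (d - 1) : Measure (Eucl d))
      (t ∩ {y | φ y = φ x}) < ⊤ := by
  set L := fderiv ℝ φ x
  have hr : L.range = ⊤ := by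
    apply LinearMap.range_eq_top.2
    apply LinearMap.surjective
    intro h
    apply hne
    ext v
    exact congrArg (fun f : Eucl d →ₗ[ℝ] ℝ => f v) h
  have hdim : Module.finrank ℝ L.ker = d - 1 := by
    have h1 := LinearMap.finrank_range_add_finrank_ker (L : Eucl d →ₗ[ℝ] ℝ)
    have h2 : Module.finrank ℝ (LinearMap.range (L : Eucl d →ₗ[ℝ] ℝ)) = 1 := by
      have : LinearMap.range (L : Eucl d →ₗ[ℝ] ℝ) = ⊤ := hr
      rw [this]; simp
    have h3 : Module.finrank ℝ (Eucl d) = d := by simp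
    change Module.finrank ℝ (LinearMap.ker (L : Eucl d →ₗ[ℝ] ℝ)) = d - 1
    omega
  set g := hφ.implicitFunction φ L hr (φ x)
  obtain ⟨K, s, hs, hLip⟩ := (hφ.to_implicitFunction hr).exists_lipschitzOnWith
  obtain ⟨r, hr0, hrs⟩ := Metric.mem_nhds_iff.1 hs
  set Ψ := hφ.implicitToOpenPartialHomeomorph φ L hr
  have hΨc : Tendsto (fun y => (Ψ y).2) (𝓝 x) (𝓝 0) := by
    have h1 : ContinuousAt Ψ x :=
      Ψ.continuousAt (hφ.mem_implicitToOpenPartialHomeomorph_source hr)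
    have h2 : Ψ x = (φ x, 0) := hφ.implicitToOpenPartialHomeomorph_self hr
    have h3 := h1.snd
    rw [ContinuousAt, h2] at h3
    exact h3
  have ev := (hφ.eq_implicitFunction hr).and (hΨc (Metric.ball_mem_nhds 0 hr0))
  refine ⟨_, ev, ?_⟩
  have hsub : ({y | hφ.implicitFunction φ L hr (φ y) (Ψ y).2 = y ∧
      y ∈ (fun y => (Ψ y).2) ⁻¹' Metric.ball 0 r} ∩ {y | φ y = φ x}) ⊆ g '' Metric.ball 0 r := by
    rintro y ⟨⟨h1, h2⟩, h3⟩
    refine ⟨(Ψ y).2, h2, ?_⟩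
    have h3' : φ y = φ x := h3
    rw [h3'] at h1
    exact h1
  refine (measure_mono hsub).trans_lt ?_
  rw [Measure.euclideanHausdorffMeasure_def, Measure.smul_apply]
  have hfin : μH[((d - 1 : ℕ) : ℝ)] (Metric.ball (0 : L.ker) r) < ⊤ := by
    have : (μH[(Module.finrank ℝ L.ker : ℝ)] : Measure L.ker).IsAddHaarMeasure :=
      isAddHaarMeasure_hausdorffMeasure
    rw [← hdim]
    exact (Metric.isBounded_ball).measure_lt_top
  have hle := (hLip.mono hrs).hausdorffMeasure_image_le (d := ((d - 1 : ℕ) : ℝ)) (by positivity)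
  refine ENNReal.mul_lt_top ENNReal.coe_lt_top ?_
  refine hle.trans_lt (ENNReal.mul_lt_top ?_ hfin)
  exact ENNReal.rpow_lt_top_of_nonneg (by positivity) ENNReal.coe_ne_top

lemma IsClosedHypersurface.isFiniteMeasure {d : ℕ} (hd : 2 ≤ d) {Γ : Set (Eucl d)}
    (hΓ : IsClosedHypersurface Γ) : IsFiniteMeasure (surfaceMeasure Γ) := by
  refine ⟨?_⟩
  rw [surfaceMeasure, Measure.restrict_apply_univ]
  refine hΓ.compact.measure_lt_top_of_nhdsWithin fun x hx => ?_
  obtain ⟨U, φ, hU, hxU, hφ, hne, hΓU⟩ := hΓ.locally_level x hx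
  have h0 : φ x = 0 := by
    have : x ∈ Γ ∩ U := ⟨hx, hxU⟩
    rw [hΓU] at this
    exact this.2
  have hst : HasStrictFDerivAt φ (fderiv ℝ φ x) x :=
    (hφ.contDiffAt (hU.mem_nhds hxU)).hasStrictFDerivAt (by simp)
  obtain ⟨t, ht, hfin⟩ := levelSet_hausdorff_finiteAt hd hst (hne x hxU)
  refine ⟨Γ ∩ (t ∩ U), ?_, (measure_mono ?_).trans_lt hfin⟩
  · exact inter_mem_nhdsWithin _ (inter_mem ht (hU.mem_nhds hxU))
  · rintro y ⟨hy, hyt, hyU⟩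
    have : y ∈ Γ ∩ U := ⟨hy, hyU⟩
    rw [hΓU] at this
    exact ⟨hyt, this.2.trans h0.symm⟩

/-! ### Diagonal operators along orthonormal families -/

section Diagonal

variable {E : Type*} [NormedAddCommGroup E] [InnerProductSpace ℝ E]
  {v : ℕ → E} {b : ℕ → ℝ} {B : ℝ}

lemma Orthonormal.summable_diagonal (hv : Orthonormal ℝ v) (hb : ∀ k, |b k| ≤ B) (h ψ : E) :
    Summable (fun k => b k * ⟪v k, h⟫_ℝ * ⟪v k, ψ⟫_ℝ) ∧
      |∑' k, b k * ⟪v k, h⟫_ℝ * ⟪v k, ψ⟫_ℝ| ≤ B * ‖h‖ * ‖ψ‖ := by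
  have hB : 0 ≤ B := (abs_nonneg _).trans (hb 0)
  have h2 : ∀ x : E, Summable (fun k => |⟪v k, x⟫_ℝ| ^ (2 : ℝ)) := fun x => by
    simpa using hv.inner_products_summable x
  have hn : ∀ x : E, (∑' k, |⟪v k, x⟫_ℝ| ^ (2 : ℝ)) ^ (1 / (2 : ℝ)) ≤ ‖x‖ := fun x => by
    have := hv.tsum_inner_products_le x
    rw [← Real.sqrt_eq_rpow]
    refine Real.sqrt_le_iff.2 ⟨norm_nonneg _, by simpa using this⟩
  obtain ⟨hs, hle⟩ := Real.summable_and_inner_le_Lp_mul_Lq_tsum_of_nonneg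
    Real.HolderConjugate.two_two (fun k => abs_nonneg (⟪v k, h⟫_ℝ))
    (fun k => abs_nonneg (⟪v k, ψ⟫_ℝ)) (h2 h) (h2 ψ)
  have hs' : Summable (fun k => B * (|⟪v k, h⟫_ℝ| * |⟪v k, ψ⟫_ℝ|)) := hs.mul_left B
  have hbd : ∀ k, ‖b k * ⟪v k, h⟫_ℝ * ⟪v k, ψ⟫_ℝ‖ ≤ B * (|⟪v k, h⟫_ℝ| * |⟪v k, ψ⟫_ℝ|) := by
    intro k
    rw [Real.norm_eq_abs, abs_mul, abs_mul, mul_assoc]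
    exact mul_le_mul_of_nonneg_right (hb k) (by positivity)
  refine ⟨Summable.of_norm_bounded hs' hbd, ?_⟩
  refine (tsum_of_norm_bounded hs'.hasSum hbd).trans ?_
  rw [tsum_mul_left, mul_assoc]
  refine mul_le_mul_of_nonneg_left (hle.trans ?_) hB
  exact mul_le_mul (hn h) (hn ψ) (by positivity) (norm_nonneg _)

/-- A bounded sequence defines a bounded diagonal operator along an orthonormal family. -/
lemma Orthonormal.exists_diagonal [CompleteSpace E] (hv : Orthonormal ℝ v) (hb : ∀ k, |b k| ≤ B) :
    ∃ T : E →L[ℝ] E, ∀ h ψ, HasSum (fun k => b k * ⟪v k, h⟫_ℝ * ⟪v k, ψ⟫_ℝ) ⟪T h, ψ⟫_ℝ := by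
  have S := fun h ψ => (hv.summable_diagonal hb h ψ).1
  let β : E →ₗ[ℝ] E →ₗ[ℝ] ℝ := LinearMap.mk₂ ℝ (fun h ψ => ∑' k, b k * ⟪v k, h⟫_ℝ * ⟪v k, ψ⟫_ℝ)
    (fun h h' ψ => by
      rw [← (S h ψ).tsum_add (S h' ψ)]
      exact tsum_congr fun k => by rw [inner_add_right]; ring)
    (fun c h ψ => by
      rw [smul_eq_mul, ← tsum_mul_left]
      exact tsum_congr fun k => by rw [inner_smul_right]; ring)
    (fun h ψ ψ' => by
      rw [← (S h ψ).tsum_add (S h ψ')]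
      exact tsum_congr fun k => by rw [inner_add_right]; ring)
    (fun c h ψ => by
      rw [smul_eq_mul, ← tsum_mul_left]
      exact tsum_congr fun k => by rw [inner_smul_right]; ring)
  let βc : E →L[ℝ] E →L[ℝ] ℝ := β.mkContinuous₂ B fun h ψ => (hv.summable_diagonal hb h ψ).2
  refine ⟨InnerProductSpace.continuousLinearMapOfBilin βc, fun h ψ => ?_⟩
  rw [InnerProductSpace.continuousLinearMapOfBilin_apply]
  exact (S h ψ).hasSum

/-- A functional that vanishes on the orthogonal complement of an orthonormal family is
determined by its values on the family. -/
lemma Orthonormal.hasSum_functional [CompleteSpace E] (hv : Orthonormal ℝ v) (V : E →L[ℝ] ℝ)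
    (hV : ∀ x, (∀ k, ⟪v k, x⟫_ℝ = 0) → V x = 0) (ψ : E) :
    HasSum (fun k => V (v k) * ⟪v k, ψ⟫_ℝ) (V ψ) := by
  obtain ⟨T, hT⟩ := hv.exists_diagonal (b := fun _ => 1) (B := 1) (by simp)
  have h1 : V (ψ - T ψ) = 0 := by
    refine hV _ fun j => ?_
    have h2 := hT ψ (v j)
    have h3 : HasSum (fun k => 1 * ⟪v k, ψ⟫_ℝ * ⟪v k, v j⟫_ℝ) (1 * ⟪v j, ψ⟫_ℝ * ⟪v j, v j⟫_ℝ) :=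
      hasSum_single j fun k hk => by rw [hv.2 hk, mul_zero]
    have h4 := h2.unique h3
    rw [real_inner_self_eq_norm_sq, hv.1 j] at h4
    rw [inner_sub_right, real_inner_comm (T ψ), h4]
    ring
  have h5 : V ψ = V (T ψ) := by rw [map_sub] at h1; linarith
  set g := (InnerProductSpace.toDual ℝ E).symm V
  have hg : ∀ x, V x = ⟪g, x⟫_ℝ := fun x => (InnerProductSpace.toDual_symm_apply).symm
  rw [h5, hg, real_inner_comm]
  convert! hT ψ g using 2 with k
  rw [hg, real_inner_comm g]
  ring

end Diagonal

/-! ### The transversal boundary value problem -/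

/-- The arc length `s(u) = ∫_{-1}^u M` of the weight `M`; in this variable the transversal operator
has constant coefficients. -/
noncomputable def arcVar (M : ℝ → ℝ) (u : ℝ) : ℝ := ∫ t in (-1 : ℝ)..u, M t

/-- `(w, z)` solves the transversal problem at frequency `μ`: in the variable `s = arcVar M` it is
`z = dw/ds`, `-dz/ds + μ² w = (dual of the constraint)`, where `c' = 1 - g`. It is written as a
first order system, with flux data `z = c` at both end points. -/
structure IsProfile (M g c : ℝ → ℝ) (μ : ℝ) (w z : ℝ → ℝ) : Prop where
  deriv_w : ∀ u, HasDerivAt w (M u * z u) u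
  deriv_z : ∀ u, HasDerivAt z (μ ^ 2 * M u * w u - g u) u
  left : z (-1) = c (-1)
  right : z 1 = c 1

/-- The constraint functional `∫ (w + c w')` of a function with `w' = M z`. -/
noncomputable def profileConstraint (M c w z : ℝ → ℝ) : ℝ :=
  ∫ u in (-1 : ℝ)..1, (w u + c u * (M u * z u))

section Transversal

variable {M g c : ℝ → ℝ} {μ : ℝ} {w z : ℝ → ℝ}

lemma arcVar_left : arcVar M (-1) = 0 := intervalIntegral.integral_same

lemma hasDerivAt_arcVar (hM : Continuous M) (u : ℝ) : HasDerivAt (arcVar M) (M u) u :=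
  intervalIntegral.integral_hasDerivAt_right (hM.intervalIntegrable _ _)
    (hM.stronglyMeasurableAtFilter _ _) hM.continuousAt

lemma continuous_arcVar (hM : Continuous M) : Continuous (arcVar M) :=
  continuous_iff_continuousAt.2 fun u => (hasDerivAt_arcVar hM u).continuousAt

lemma IsProfile.continuous_w (h : IsProfile M g c μ w z) : Continuous w :=
  continuous_iff_continuousAt.2 fun u => (h.deriv_w u).continuousAt

lemma IsProfile.continuous_z (h : IsProfile M g c μ w z) : Continuous z :=
  continuous_iff_continuousAt.2 fun u => (h.deriv_z u).continuousAt

/-- In the variables `z ± μ w` the system decouples; the two free constants are fixed by the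
boundary data because `e^{μ S} ≠ e^{-μ S}`. -/
lemma exists_isProfile (hM : Continuous M) (hg : Continuous g) (c : ℝ → ℝ) (hμ : 0 < μ)
    (hS : 0 < arcVar M 1) : ∃ w z, IsProfile M g c μ w z := by
  set s := arcVar M with hs
  have hsd : ∀ u, HasDerivAt s (M u) u := hasDerivAt_arcVar hM
  have hsc : Continuous s := continuous_arcVar hM
  -- the solution of `y' = k M y - g` with initial value `a`
  let Y : ℝ → ℝ → ℝ → ℝ := fun k a u =>
    Real.exp (k * s u) * (a - ∫ r in (-1 : ℝ)..u, g r * Real.exp (-(k * s r)))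
  have hY : ∀ k a u, HasDerivAt (Y k a) (k * M u * Y k a u - g u) u := by
    intro k a u
    have hcont : Continuous fun r => g r * Real.exp (-(k * s r)) := by fun_prop
    have h1 : HasDerivAt (fun u => ∫ r in (-1 : ℝ)..u, g r * Real.exp (-(k * s r)))
        (g u * Real.exp (-(k * s u))) u :=
      intervalIntegral.integral_hasDerivAt_right (hcont.intervalIntegrable _ _)
        (hcont.stronglyMeasurableAtFilter _ _) hcont.continuousAt
    have h2 := (((hsd u).const_mul k).exp).mul (h1.const_sub a)
    refine h2.congr_deriv ?_
    have h3 : Real.exp (k * s u) * Real.exp (-(k * s u)) = 1 := by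
      rw [← Real.exp_add]; simp
    simp only [Y]
    linear_combination (-g u) * h3
  have hY0 : ∀ k a, Y k a (-1) = a := fun k a => by simp [Y, hs, arcVar_left]
  have hY1 : ∀ k a, Y k a 1 = Real.exp (k * s 1) * a + Y k 0 1 := fun k a => by
    simp only [Y]; ring
  set E := Real.exp (μ * s 1) with hE
  set F := Real.exp (-μ * s 1) with hF
  have hEF : E - F ≠ 0 := by
    have : F < E := Real.exp_lt_exp.2 (by nlinarith [mul_pos hμ hS])
    linarith
  set ρ := 2 * c 1 - Y μ 0 1 - Y (-μ) 0 1 with hρ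
  set a := (ρ - F * (2 * c (-1))) / (E - F) with ha
  have hab : E * a + F * (2 * c (-1) - a) = ρ := by
    have : a * (E - F) = ρ - F * (2 * c (-1)) := div_mul_cancel₀ _ hEF
    linarith
  refine ⟨fun u => (Y μ a u - Y (-μ) (2 * c (-1) - a) u) / (2 * μ),
    fun u => (Y μ a u + Y (-μ) (2 * c (-1) - a) u) / 2, ?_, ?_, ?_, ?_⟩
  · intro u
    refine (((hY μ a u).sub (hY (-μ) (2 * c (-1) - a) u)).div_const (2 * μ)).congr_deriv ?_
    field_simp
    ring
  · intro u
    refine (((hY μ a u).add (hY (-μ) (2 * c (-1) - a) u)).div_const 2).congr_deriv ?_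
    field_simp
    ring
  · simp only [hY0]; ring
  · simp only [hY1 μ a, hY1 (-μ) (2 * c (-1) - a)]
    rw [← hE, ← hF]
    linarith

/-- The profile represents the constraint functional through the transversal energy form: indeed
`((c - z) Φ)'` is the difference of the integrands, and `c - z` vanishes at the end points. -/
lemma IsProfile.weak_form (h : IsProfile M g c μ w z) (hM : Continuous M)
    (hc : ∀ u, HasDerivAt c (1 - g u) u) {Φ Φ' : ℝ → ℝ} (hΦ : ∀ u, HasDerivAt Φ (Φ' u) u)
    (hΦ' : Continuous Φ') :
    ∫ u in (-1 : ℝ)..1, (z u * Φ' u + μ ^ 2 * (M u * w u * Φ u)) =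
      ∫ u in (-1 : ℝ)..1, (Φ u + c u * Φ' u) := by
  have cw := h.continuous_w
  have cz := h.continuous_z
  have cc : Continuous c := continuous_iff_continuousAt.2 fun u => (hc u).continuousAt
  have cΦ : Continuous Φ := continuous_iff_continuousAt.2 fun u => (hΦ u).continuousAt
  have hd : ∀ u ∈ uIcc (-1 : ℝ) 1, HasDerivAt (fun u => (c u - z u) * Φ u)
      ((Φ u + c u * Φ' u) - (z u * Φ' u + μ ^ 2 * (M u * w u * Φ u))) u := fun u _ => by
    refine (((hc u).sub (h.deriv_z u)).mul (hΦ u)).congr_deriv ?_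
    simp only [Pi.sub_apply]
    ring
  have hi := intervalIntegral.integral_eq_sub_of_hasDerivAt hd
    (Continuous.intervalIntegrable (by fun_prop) _ _)
  rw [h.left, h.right, intervalIntegral.integral_sub
    (Continuous.intervalIntegrable (by fun_prop) _ _)
    (Continuous.intervalIntegrable (by fun_prop) _ _)] at hi
  linarith

lemma IsProfile.energy_eq (h : IsProfile M g c μ w z) (hM : Continuous M)
    (hc : ∀ u, HasDerivAt c (1 - g u) u) :
    ∫ u in (-1 : ℝ)..1, (M u * z u ^ 2 + μ ^ 2 * (M u * w u ^ 2)) = profileConstraint M c w z := by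
  have cw := h.continuous_w
  have cz := h.continuous_z
  rw [profileConstraint, ← h.weak_form hM hc h.deriv_w (by fun_prop)]
  refine intervalIntegral.integral_congr fun u _ => ?_
  ring

/-- Testing the weak form with constants bounds the constraint value from below. -/
lemma IsProfile.four_le (h : IsProfile M g c μ w z) (hM : Continuous M)
    (hM0 : ∀ u ∈ Icc (-1 : ℝ) 1, 0 ≤ M u)
    (hc : ∀ u, HasDerivAt c (1 - g u) u) (hμ : 0 < μ) (hS : 0 < arcVar M 1) :
    4 ≤ μ ^ 2 * arcVar M 1 * profileConstraint M c w z := by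
  have cw := h.continuous_w
  have cz := h.continuous_z
  have h1 := h.weak_form hM hc (Φ := fun _ => 1) (Φ' := fun _ => 0)
    (fun u => hasDerivAt_const u 1) continuous_const
  have h1' : μ ^ 2 * ∫ u in (-1 : ℝ)..1, M u * w u = 2 := by
    have h2 : ∫ u in (-1 : ℝ)..1, (z u * 0 + μ ^ 2 * (M u * w u * 1)) =
        μ ^ 2 * ∫ u in (-1 : ℝ)..1, M u * w u := by
      rw [← intervalIntegral.integral_const_mul]
      exact intervalIntegral.integral_congr fun u _ => by ring
    rw [← h2, h1]
    simp
    norm_num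
  set t := 2 / (μ ^ 2 * arcVar M 1) with ht
  have key : 0 ≤ ∫ u in (-1 : ℝ)..1,
      ((M u * z u ^ 2 + μ ^ 2 * (M u * w u ^ 2)) - 2 * t * μ ^ 2 * (M u * w u)
        + t ^ 2 * μ ^ 2 * M u) := by
    refine intervalIntegral.integral_nonneg (by norm_num) fun u hu => ?_
    have : (M u * z u ^ 2 + μ ^ 2 * (M u * w u ^ 2)) - 2 * t * μ ^ 2 * (M u * w u)
        + t ^ 2 * μ ^ 2 * M u = M u * (z u ^ 2 + μ ^ 2 * (w u - t) ^ 2) := by ring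
    rw [this]
    have := hM0 u hu
    positivity
  have ci : ∀ {f : ℝ → ℝ}, Continuous f → IntervalIntegrable f volume (-1) 1 :=
    fun hf => hf.intervalIntegrable _ _
  rw [intervalIntegral.integral_add (ci (by fun_prop)) (ci (by fun_prop)),
    intervalIntegral.integral_sub (ci (by fun_prop)) (ci (by fun_prop)),
    intervalIntegral.integral_const_mul, intervalIntegral.integral_const_mul,
    h.energy_eq hM hc] at key
  change 0 ≤ _ - _ + t ^ 2 * μ ^ 2 * arcVar M 1 at key
  have ht' : t * (μ ^ 2 * arcVar M 1) = 2 := by rw [ht]; field_simp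
  have hpos : 0 < μ ^ 2 * arcVar M 1 := by positivity
  nlinarith [mul_le_mul_of_nonneg_left key hpos.le]

lemma IsProfile.constraint_eq_boundary (h : IsProfile M g c μ w z) (hM : Continuous M)
    (hg : Continuous g) (hc : ∀ u, HasDerivAt c (1 - g u) u) :
    profileConstraint M c w z = c 1 * w 1 - c (-1) * w (-1) + ∫ u in (-1 : ℝ)..1, g u * w u := by
  have cw := h.continuous_w
  have cz := h.continuous_z
  have cc : Continuous c := continuous_iff_continuousAt.2 fun u => (hc u).continuousAt
  have hd : ∀ u ∈ uIcc (-1 : ℝ) 1, HasDerivAt (fun u => c u * w u)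
      ((w u + c u * (M u * z u)) - g u * w u) u := fun u _ => by
    refine ((hc u).mul (h.deriv_w u)).congr_deriv ?_
    ring
  have hi := intervalIntegral.integral_eq_sub_of_hasDerivAt hd
    (Continuous.intervalIntegrable (by fun_prop) _ _)
  rw [intervalIntegral.integral_sub (Continuous.intervalIntegrable (by fun_prop) _ _)
    (Continuous.intervalIntegrable (by fun_prop) _ _)] at hi
  rw [profileConstraint]
  linarith

/-- Duhamel's formula for `y' = k M y - g`, integrated from `a` in the direction in which the
exponential decays. -/
lemma abs_le_of_firstOrder (hM : Continuous M) (hg : Continuous g) {y : ℝ → ℝ} {k G ε a b : ℝ}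
    (hy : ∀ u, HasDerivAt y (k * M u * y u - g u) u) (ha : a ∈ Icc (-1 : ℝ) 1)
    (hb : b ∈ Icc (-1 : ℝ) 1)
    (hk : ∀ r ∈ uIcc a b, k * (arcVar M r - arcVar M a) = μ * |arcVar M r - arcVar M a|)
    (hG : ∀ r ∈ Icc (-1 : ℝ) 1, |g r| ≤ G)
    (hε : ∫ r in (-1 : ℝ)..1, Real.exp (-(μ * |arcVar M r - arcVar M a|)) ≤ ε) :
    |y a| ≤ Real.exp (-(μ * |arcVar M b - arcVar M a|)) * |y b| + G * ε := by
  set s := arcVar M with hs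
  have hsc : Continuous s := continuous_arcVar hM
  have hG0 : 0 ≤ G := (abs_nonneg _).trans (hG a ha)
  have hd : ∀ u ∈ uIcc a b, HasDerivAt (fun u => y u * Real.exp (-(k * (s u - s a))))
      (-(g u * Real.exp (-(k * (s u - s a))))) u := fun u _ => by
    refine ((hy u).mul
      ((((hasDerivAt_arcVar hM u).sub_const (s a)).const_mul k).neg.exp)).congr_deriv ?_
    simp only [Pi.neg_apply]
    ring
  have hi := intervalIntegral.integral_eq_sub_of_hasDerivAt hd
    (Continuous.intervalIntegrable (by fun_prop) _ _)
  rw [intervalIntegral.integral_neg] at hi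
  simp only [sub_self, mul_zero, neg_zero, Real.exp_zero, mul_one] at hi
  have hya : y a = Real.exp (-(μ * |s b - s a|)) * y b +
      ∫ u in a..b, g u * Real.exp (-(k * (s u - s a))) := by
    rw [hk b right_mem_uIcc] at hi
    linarith
  have hsub : uIoc a b ⊆ Ioc (-1) 1 := by
    rw [uIoc]
    exact Ioc_subset_Ioc (le_min ha.1 hb.1) (max_le ha.2 hb.2)
  have hce : Continuous fun r => G * Real.exp (-(μ * |s r - s a|)) := by fun_prop
  have hint : |∫ u in a..b, g u * Real.exp (-(k * (s u - s a)))| ≤ G * ε := by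
    rw [← Real.norm_eq_abs]
    refine intervalIntegral.norm_integral_le_integral_norm_uIoc.trans ?_
    calc ∫ u in uIoc a b, ‖g u * Real.exp (-(k * (s u - s a)))‖
        ≤ ∫ u in uIoc a b, G * Real.exp (-(μ * |s u - s a|)) := by
          refine setIntegral_mono_on ?_ ?_ measurableSet_uIoc fun r hr => ?_
          · exact (Continuous.integrableOn_uIoc (by fun_prop))
          · exact hce.integrableOn_uIoc
          · rw [hk r (uIoc_subset_uIcc hr), norm_mul, Real.norm_eq_abs, Real.norm_eq_abs,
              Real.abs_exp]
            exact mul_le_mul_of_nonneg_right (hG r (Ioc_subset_Icc_self (hsub hr)))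
              (Real.exp_pos _).le
      _ ≤ ∫ u in Ioc (-1 : ℝ) 1, G * Real.exp (-(μ * |s u - s a|)) := by
          refine setIntegral_mono_set ?_ ?_ hsub.eventuallyLE
          · exact hce.integrableOn_Ioc
          · exact ae_of_all _ fun r => by positivity
      _ = G * ∫ r in (-1 : ℝ)..1, Real.exp (-(μ * |s r - s a|)) := by
          rw [← intervalIntegral.integral_of_le (by norm_num), intervalIntegral.integral_const_mul]
      _ ≤ G * ε := mul_le_mul_of_nonneg_left hε hG0
  rw [hya]
  refine (abs_add_le _ _).trans (add_le_add ?_ hint)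
  rw [abs_mul, Real.abs_exp]

lemma arcVar_mono (hM : Continuous M) (hM0 : ∀ u ∈ Icc (-1 : ℝ) 1, 0 ≤ M u) {a b : ℝ}
    (ha : -1 ≤ a) (hab : a ≤ b) (hb : b ≤ 1) : arcVar M a ≤ arcVar M b := by
  have h1 : arcVar M b - arcVar M a = ∫ t in a..b, M t :=
    intervalIntegral.integral_interval_sub_left (hM.intervalIntegrable _ _)
      (hM.intervalIntegrable _ _)
  have h2 : 0 ≤ ∫ t in a..b, M t :=
    intervalIntegral.integral_nonneg hab fun t ht => hM0 t ⟨ha.trans ht.1, ht.2.trans hb⟩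
  linarith

/-- Up to the factor `μ`, the constraint value is `c(1)² + c(-1)²` with an error that is controlled
by the reflection coefficient `q = e^{-μ S}` and by `G ε`, where `ε` is the mass of the exponential
kernel. -/
lemma IsProfile.abs_constraint_sub_le (h : IsProfile M g c μ w z) (hM : Continuous M)
    (hM0 : ∀ u ∈ Icc (-1 : ℝ) 1, 0 ≤ M u) (hg : Continuous g)
    (hc : ∀ u, HasDerivAt c (1 - g u) u) {G ε K : ℝ}
    (hG : ∀ r ∈ Icc (-1 : ℝ) 1, |g r| ≤ G)
    (hε : ∀ a ∈ Icc (-1 : ℝ) 1,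
      ∫ r in (-1 : ℝ)..1, Real.exp (-(μ * |arcVar M r - arcVar M a|)) ≤ ε) (hε2 : ε ≤ 2)
    (hq : Real.exp (-(μ * arcVar M 1)) ≤ 1 / 2) (hK : K = |c 1| + |c (-1)|) :
    |μ * profileConstraint M c w z - (c 1 ^ 2 + c (-1) ^ 2)| ≤
      (K * (4 * K + 8 * G) + K + (4 * K + 8 * G) / 2 + 2 * G) *
        (Real.exp (-(μ * arcVar M 1)) + G * ε) := by
  have cw := h.continuous_w
  have cz := h.continuous_z
  have m1 : (-1 : ℝ) ∈ Icc (-1 : ℝ) 1 := by norm_num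
  have p1 : (1 : ℝ) ∈ Icc (-1 : ℝ) 1 := by norm_num
  set s := arcVar M with hs
  set q := Real.exp (-(μ * s 1)) with hqdef
  have hsm1 : s (-1) = 0 := arcVar_left
  have hS0 : 0 ≤ s 1 := by
    rw [← hsm1]; exact arcVar_mono hM hM0 le_rfl (by norm_num) le_rfl
  have hG0 : 0 ≤ G := (abs_nonneg _).trans (hG 1 p1)
  have hε0 : 0 ≤ ε := (intervalIntegral.integral_nonneg (by norm_num)
    fun r _ => (Real.exp_pos _).le).trans (hε 1 p1)
  set P : ℝ → ℝ := fun u => z u + μ * w u with hP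
  set N : ℝ → ℝ := fun u => z u - μ * w u with hN
  have hPd : ∀ u, HasDerivAt P (μ * M u * P u - g u) u := fun u => by
    refine ((h.deriv_z u).add ((h.deriv_w u).const_mul μ)).congr_deriv ?_
    simp only [hP]; ring
  have hNd : ∀ u, HasDerivAt N ((-μ) * M u * N u - g u) u := fun u => by
    refine ((h.deriv_z u).sub ((h.deriv_w u).const_mul μ)).congr_deriv ?_
    simp only [hN]; ring
  have cP : Continuous P := by fun_prop
  have cN : Continuous N := by fun_prop
  have bP : ∀ a ∈ Icc (-1 : ℝ) 1, |P a| ≤ Real.exp (-(μ * |s 1 - s a|)) * |P 1| + G * ε := by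
    intro a ha
    refine abs_le_of_firstOrder hM hg hPd ha p1 (fun r hr => ?_) hG (hε a ha)
    rw [uIcc_of_le ha.2] at hr
    rw [abs_of_nonneg (sub_nonneg.2 (arcVar_mono hM hM0 ha.1 hr.1 hr.2))]
  have bN : ∀ a ∈ Icc (-1 : ℝ) 1,
      |N a| ≤ Real.exp (-(μ * |s (-1) - s a|)) * |N (-1)| + G * ε := by
    intro a ha
    refine abs_le_of_firstOrder hM hg hNd ha m1 (fun r hr => ?_) hG (hε a ha)
    rw [uIcc_of_ge ha.1] at hr
    rw [abs_of_nonpos (sub_nonpos.2 (arcVar_mono hM hM0 hr.1 hr.2 ha.2))]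
    ring
  have e1 : |P (-1)| ≤ q * |P 1| + G * ε := by
    have := bP (-1) m1
    rwa [hsm1, sub_zero, abs_of_nonneg hS0] at this
  have e2 : |N 1| ≤ q * |N (-1)| + G * ε := by
    have := bN 1 p1
    rwa [hsm1, zero_sub, abs_neg, abs_of_nonneg hS0] at this
  have s1 : P 1 + N 1 = 2 * c 1 := by simp only [hP, hN]; rw [← h.right]; ring
  have s2 : P (-1) + N (-1) = 2 * c (-1) := by simp only [hP, hN]; rw [← h.left]; ring
  have t1 : |P 1| ≤ 2 * |c 1| + |N 1| := by
    have : P 1 = 2 * c 1 - N 1 := by linarith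
    rw [this]
    refine (abs_sub _ _).trans ?_
    rw [abs_mul, abs_two]
  have t2 : |N (-1)| ≤ 2 * |c (-1)| + |P (-1)| := by
    have : N (-1) = 2 * c (-1) - P (-1) := by linarith
    rw [this]
    refine (abs_sub _ _).trans ?_
    rw [abs_mul, abs_two]
  have hq0 : 0 < q := Real.exp_pos _
  set δ := G * ε with hδ
  have hδ0 : 0 ≤ δ := mul_nonneg hG0 hε0
  have hδ2 : δ ≤ 2 * G := by nlinarith
  set X := 4 * K + 8 * G with hX
  have hXb : |P 1| + |N (-1)| ≤ X := by
    have u1 : q * |P 1| ≤ 1 / 2 * |P 1| := mul_le_mul_of_nonneg_right hq (abs_nonneg _)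
    have u2 : q * |N (-1)| ≤ 1 / 2 * |N (-1)| := mul_le_mul_of_nonneg_right hq (abs_nonneg _)
    linarith
  have hK0 : 0 ≤ K := by rw [hK]; positivity
  have hX0 : 0 ≤ X := by positivity
  -- the bulk term
  have hbulk : |∫ u in (-1 : ℝ)..1, g u * (P u - N u)| ≤ G * (ε * X + 4 * δ) := by
    rw [← Real.norm_eq_abs]
    refine (intervalIntegral.norm_integral_le_integral_norm (by norm_num)).trans ?_
    have hsc : Continuous s := continuous_arcVar hM
    calc ∫ u in (-1 : ℝ)..1, ‖g u * (P u - N u)‖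
        ≤ ∫ u in (-1 : ℝ)..1, (G * |P 1| * Real.exp (-(μ * |s u - s 1|)) +
            G * |N (-1)| * Real.exp (-(μ * |s u - s (-1)|)) + G * (2 * δ)) := by
          refine intervalIntegral.integral_mono_on (by norm_num)
            (Continuous.intervalIntegrable (by fun_prop) _ _)
            (Continuous.intervalIntegrable (by fun_prop) _ _) fun u hu => ?_
          rw [norm_mul, Real.norm_eq_abs, Real.norm_eq_abs]
          have v1 := bP u hu
          have v2 := bN u hu
          rw [abs_sub_comm (s 1)] at v1
          rw [abs_sub_comm (s (-1))] at v2
          have v3 : |P u - N u| ≤ |P u| + |N u| := abs_sub _ _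
          calc |g u| * |P u - N u| ≤ G * (|P u| + |N u|) :=
                mul_le_mul (hG u hu) v3 (abs_nonneg _) hG0
            _ ≤ G * ((Real.exp (-(μ * |s u - s 1|)) * |P 1| + δ) +
                (Real.exp (-(μ * |s u - s (-1)|)) * |N (-1)| + δ)) :=
                mul_le_mul_of_nonneg_left (add_le_add v1 v2) hG0
            _ = _ := by ring
      _ = G * |P 1| * (∫ u in (-1 : ℝ)..1, Real.exp (-(μ * |s u - s 1|))) +
            G * |N (-1)| * (∫ u in (-1 : ℝ)..1, Real.exp (-(μ * |s u - s (-1)|))) +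
            G * (4 * δ) := by
          rw [intervalIntegral.integral_add (Continuous.intervalIntegrable (by fun_prop) _ _)
            (Continuous.intervalIntegrable (by fun_prop) _ _),
            intervalIntegral.integral_add (Continuous.intervalIntegrable (by fun_prop) _ _)
            (Continuous.intervalIntegrable (by fun_prop) _ _),
            intervalIntegral.integral_const_mul, intervalIntegral.integral_const_mul,
            intervalIntegral.integral_const, smul_eq_mul]
          ring
      _ ≤ G * |P 1| * ε + G * |N (-1)| * ε + G * (4 * δ) := by
          have w1 := mul_le_mul_of_nonneg_left (hε 1 p1) (mul_nonneg hG0 (abs_nonneg (P 1)))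
          have w2 := mul_le_mul_of_nonneg_left (hε (-1) m1) (mul_nonneg hG0 (abs_nonneg (N (-1))))
          linarith
      _ ≤ G * (ε * X + 4 * δ) := by
          have := mul_le_mul_of_nonneg_left hXb (mul_nonneg hG0 hε0)
          linarith
  have hform : μ * profileConstraint M c w z - (c 1 ^ 2 + c (-1) ^ 2) =
      -(c 1 * N 1) - c (-1) * P (-1) + 1 / 2 * ∫ u in (-1 : ℝ)..1, g u * (P u - N u) := by
    have i1 : ∫ u in (-1 : ℝ)..1, g u * (P u - N u) =
        2 * μ * ∫ u in (-1 : ℝ)..1, g u * w u := by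
      rw [← intervalIntegral.integral_const_mul]
      exact intervalIntegral.integral_congr fun u _ => by simp only [hP, hN]; ring
    rw [h.constraint_eq_boundary hM hg hc, i1]
    simp only [hP, hN]
    rw [h.left, h.right]
    ring
  rw [hform]
  have a1 : |c 1 * N 1| ≤ |c 1| * (q * X + δ) := by
    rw [abs_mul]
    refine mul_le_mul_of_nonneg_left (e2.trans ?_) (abs_nonneg _)
    nlinarith [abs_nonneg (P 1)]
  have a2 : |c (-1) * P (-1)| ≤ |c (-1)| * (q * X + δ) := by
    rw [abs_mul]
    refine mul_le_mul_of_nonneg_left (e1.trans ?_) (abs_nonneg _)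
    nlinarith [abs_nonneg (N (-1))]
  have a3 : |-(c 1 * N 1) - c (-1) * P (-1) + 1 / 2 * ∫ u in (-1 : ℝ)..1, g u * (P u - N u)| ≤
      |c 1 * N 1| + |c (-1) * P (-1)| + 1 / 2 * |∫ u in (-1 : ℝ)..1, g u * (P u - N u)| := by
    refine (abs_add_le _ _).trans (add_le_add ((abs_sub _ _).trans ?_) ?_)
    · rw [abs_neg]
    · rw [abs_mul, abs_of_pos (by norm_num : (0 : ℝ) < 1 / 2)]
  have a4 : G * (ε * X + 4 * δ) = δ * X + 4 * G * δ := by rw [hδ]; ring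
  have hKX : 0 ≤ K * X := mul_nonneg hK0 hX0
  have a5 : |c 1| * (q * X + δ) + |c (-1)| * (q * X + δ) = K * (q * X + δ) := by rw [hK]; ring
  nlinarith [mul_nonneg hKX hδ0, mul_nonneg hK0 hq0.le, mul_nonneg hX0 hq0.le,
    mul_nonneg hG0 hq0.le]

end Transversal

/-! ### Mass of the exponential kernel -/

section Kernel

variable {M g c : ℝ → ℝ}

/-- A degeneracy of order `i - 1/2` at the end points makes the arc length grow at least like the
power `i + 1/2` of the distance. -/
lemma arcVar_sub_ge (hM : Continuous M) {i : ℕ} (hi : 1 ≤ i) {κ : ℝ} (hκ : 0 < κ)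
    (hlow : ∀ u ∈ Icc (-1 : ℝ) 1, κ * ((1 - u ^ 2) ^ (i - 1) * √(1 - u ^ 2)) ≤ M u) {a b : ℝ}
    (ha : -1 ≤ a) (hab : a ≤ b) (hb : b ≤ 1) :
    2 * κ * ((b - a) / 4) ^ ((i : ℝ) + 1 / 2) ≤ arcVar M b - arcVar M a := by
  have h1 : arcVar M b - arcVar M a = ∫ t in a..b, M t :=
    intervalIntegral.integral_interval_sub_left (hM.intervalIntegrable _ _)
      (hM.intervalIntegrable _ _)
  rw [h1]
  set l := (b - a) / 4 with hl
  have hl0 : 0 ≤ l := by rw [hl]; linarith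
  have hM0 : ∀ u ∈ Icc (-1 : ℝ) 1, 0 ≤ M u := fun u hu => by
    refine le_trans ?_ (hlow u hu)
    have : 0 ≤ 1 - u ^ 2 := by nlinarith [hu.1, hu.2]
    positivity
  -- on the middle half of `[a, b]` the distance to the end points is at least `l`
  have h2 : ∫ t in (a + l)..(b - l), M t ≤ ∫ t in a..b, M t := by
    refine intervalIntegral.integral_mono_interval (by linarith) (by linarith) (by linarith) ?_
      (hM.intervalIntegrable _ _)
    rw [EventuallyLE, ae_restrict_iff' measurableSet_Ioc]
    exact ae_of_all _ fun t ht => hM0 t ⟨by linarith [ht.1], by linarith [ht.2]⟩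
  have h3 : ∫ t in (a + l)..(b - l), κ * (l ^ (i - 1) * √l) ≤ ∫ t in (a + l)..(b - l), M t := by
    refine intervalIntegral.integral_mono_on (by linarith) (by simp)
      (hM.intervalIntegrable _ _) fun t ht => ?_
    refine le_trans ?_ (hlow t ⟨by linarith [ht.1], by linarith [ht.2]⟩)
    have h4 : l ≤ 1 - t ^ 2 := by
      have u1 : l ≤ 1 - t := by linarith [ht.2]
      have u2 : l ≤ 1 + t := by linarith [ht.1]
      rcases le_total 0 t with ht0 | ht0
      · nlinarith
      · nlinarith
    have h5 : l ^ (i - 1) ≤ (1 - t ^ 2) ^ (i - 1) := pow_le_pow_left₀ hl0 h4 _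
    have h6 : √l ≤ √(1 - t ^ 2) := Real.sqrt_le_sqrt h4
    exact mul_le_mul_of_nonneg_left
      (mul_le_mul h5 h6 (Real.sqrt_nonneg _) (pow_nonneg (hl0.trans h4) _)) hκ.le
  refine le_trans (le_of_eq ?_) (h3.trans h2)
  rw [intervalIntegral.integral_const, smul_eq_mul]
  have h7 : l ^ ((i : ℝ) + 1 / 2) = l ^ i * √l := by
    rw [Real.rpow_add_of_nonneg hl0 (by positivity) (by positivity), Real.rpow_natCast,
      Real.sqrt_eq_rpow]
  have h8 : l ^ i = l * l ^ (i - 1) := by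
    rw [← pow_succ', Nat.sub_add_cancel hi]
  rw [h7, h8]
  have : b - l - (a + l) = 2 * l := by rw [hl]; ring
  rw [this]
  ring

lemma integral_comp_abs_sub_le {F : ℝ → ℝ} (hF : Continuous F) (hF0 : ∀ x, 0 ≤ F x)
    (hFi : IntegrableOn F (Ioi 0)) {a : ℝ} (ha : a ∈ Icc (-1 : ℝ) 1) :
    ∫ r in (-1 : ℝ)..1, F |r - a| ≤ 2 * ∫ x in Ioi 0, F x := by
  have hi : ∀ x y, IntervalIntegrable (fun r => F |r - a|) volume x y :=
    fun x y => Continuous.intervalIntegrable (by fun_prop) _ _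
  rw [← intervalIntegral.integral_add_adjacent_intervals (hi (-1) a) (hi a 1)]
  have h1 : ∫ r in (-1 : ℝ)..a, F |r - a| = ∫ x in (0 : ℝ)..(a + 1), F x := by
    have : ∫ r in (-1 : ℝ)..a, F |r - a| = ∫ r in (-1 : ℝ)..a, F (a - r) :=
      intervalIntegral.integral_congr fun r hr => by
        rw [uIcc_of_le ha.1] at hr
        rw [abs_of_nonpos (by linarith [hr.2]), neg_sub]
    rw [this, intervalIntegral.integral_comp_sub_left]
    simp
  have h2 : ∫ r in a..1, F |r - a| = ∫ x in (0 : ℝ)..(1 - a), F x := by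
    have : ∫ r in a..1, F |r - a| = ∫ r in a..1, F (r - a) :=
      intervalIntegral.integral_congr fun r hr => by
        rw [uIcc_of_le ha.2] at hr
        rw [abs_of_nonneg (by linarith [hr.1])]
    rw [this, intervalIntegral.integral_comp_sub_right]
    simp
  have h3 : ∀ y, 0 ≤ y → ∫ x in (0 : ℝ)..y, F x ≤ ∫ x in Ioi 0, F x := fun y hy => by
    rw [intervalIntegral.integral_of_le hy]
    exact setIntegral_mono_set hFi (ae_of_all _ hF0) Ioc_subset_Ioi_self.eventuallyLE
  rw [h1, h2]
  linarith [h3 (a + 1) (by linarith [ha.1]), h3 (1 - a) (by linarith [ha.2])]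

/-- The mass of the exponential kernel is `O(μ ^ (-2 / (2 i + 1)))`. -/
lemma exists_kernel_bound (hM : Continuous M) {i : ℕ} (hi : 1 ≤ i) {κ : ℝ} (hκ : 0 < κ)
    (hlow : ∀ u ∈ Icc (-1 : ℝ) 1, κ * ((1 - u ^ 2) ^ (i - 1) * √(1 - u ^ 2)) ≤ M u) :
    ∃ C : ℝ, 0 ≤ C ∧ ∀ μ : ℝ, 0 < μ → ∀ a ∈ Icc (-1 : ℝ) 1,
      ∫ r in (-1 : ℝ)..1, Real.exp (-(μ * |arcVar M r - arcVar M a|)) ≤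
        C * μ ^ (-(2 / (2 * (i : ℝ) + 1))) := by
  set p : ℝ := (i : ℝ) + 1 / 2 with hp
  have hp0 : 0 < p := by positivity
  set k : ℝ := 2 * κ / 4 ^ p with hk
  have hk0 : 0 < k := by positivity
  have hdist : ∀ r ∈ Icc (-1 : ℝ) 1, ∀ a ∈ Icc (-1 : ℝ) 1,
      k * |r - a| ^ p ≤ |arcVar M r - arcVar M a| := by
    have main : ∀ x ∈ Icc (-1 : ℝ) 1, ∀ y ∈ Icc (-1 : ℝ) 1, x ≤ y →
        k * |y - x| ^ p ≤ |arcVar M y - arcVar M x| := fun x hx y hy hxy => by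
      refine le_trans ?_ (le_abs_self _)
      refine le_trans (le_of_eq ?_) (arcVar_sub_ge hM hi hκ hlow hx.1 hxy hy.2)
      rw [abs_of_nonneg (sub_nonneg.2 hxy), Real.div_rpow (sub_nonneg.2 hxy) (by norm_num), hk]
      ring
    intro r hr a ha
    rcases le_total a r with h | h
    · exact main a ha r hr h
    · rw [abs_sub_comm, abs_sub_comm (arcVar M r)]
      exact main r hr a ha h
  refine ⟨2 * (k ^ (-1 / p) * Real.Gamma (1 / p + 1)), ?_, fun μ hμ a ha => ?_⟩
  · have : 0 < Real.Gamma (1 / p + 1) := Real.Gamma_pos_of_pos (by positivity)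
    positivity
  set F : ℝ → ℝ := fun x => Real.exp (-(μ * k) * x ^ p) with hF
  have hFc : Continuous F := by
    have : Continuous fun x : ℝ => x ^ p := Real.continuous_rpow_const hp0.le
    fun_prop
  have hFi : IntegrableOn F (Ioi 0) := by
    have := integrableOn_rpow_mul_exp_neg_mul_rpow (s := 0) (by norm_num) hp0 (mul_pos hμ hk0)
    simpa only [Real.rpow_zero, one_mul] using this
  have hsc := continuous_arcVar hM
  calc ∫ r in (-1 : ℝ)..1, Real.exp (-(μ * |arcVar M r - arcVar M a|))
      ≤ ∫ r in (-1 : ℝ)..1, F |r - a| := by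
        refine intervalIntegral.integral_mono_on (by norm_num)
          (Continuous.intervalIntegrable (by fun_prop) _ _)
          (Continuous.intervalIntegrable (by fun_prop) _ _) fun r hr => ?_
        refine Real.exp_le_exp.2 ?_
        have := mul_le_mul_of_nonneg_left (hdist r hr a ha) hμ.le
        linarith
    _ ≤ 2 * ∫ x in Ioi 0, F x :=
        integral_comp_abs_sub_le hFc (fun x => (Real.exp_pos _).le) hFi ha
    _ = 2 * ((μ * k) ^ (-1 / p) * Real.Gamma (1 / p + 1)) := by
        rw [hF, integral_exp_neg_mul_rpow hp0 (mul_pos hμ hk0)]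
    _ = 2 * (k ^ (-1 / p) * Real.Gamma (1 / p + 1)) * μ ^ (-(2 / (2 * (i : ℝ) + 1))) := by
        have : -1 / p = -(2 / (2 * (i : ℝ) + 1)) := by rw [hp]; field_simp
        rw [Real.mul_rpow hμ.le hk0.le, this]
        ring

end Kernel

/-! ### The symbol of the propagation operator -/

section Symbol

variable {M g c : ℝ → ℝ} {w z : ℝ → ℝ → ℝ}

/-- High frequency expansion of the reciprocal of the constraint value. -/
lemma exists_remainder_bound (hM : Continuous M) {i : ℕ} (hi : 1 ≤ i) {κ : ℝ} (hκ : 0 < κ)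
    (hlow : ∀ u ∈ Icc (-1 : ℝ) 1, κ * ((1 - u ^ 2) ^ (i - 1) * √(1 - u ^ 2)) ≤ M u)
    (hM0 : ∀ u ∈ Icc (-1 : ℝ) 1, 0 ≤ M u) (hg : Continuous g)
    (hc : ∀ u, HasDerivAt c (1 - g u) u) (hS : 0 < arcVar M 1)
    (hd : 0 < c 1 ^ 2 + c (-1) ^ 2)
    (hprof : ∀ μ, 0 < μ → IsProfile M g c μ (w μ) (z μ)) {G : ℝ}
    (hG : ∀ r ∈ Icc (-1 : ℝ) 1, |g r| ≤ G) :
    ∃ A μ₀ : ℝ, 0 ≤ A ∧ 1 ≤ μ₀ ∧ ∀ μ, μ₀ ≤ μ →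
      |(profileConstraint M c (w μ) (z μ))⁻¹ - (c 1 ^ 2 + c (-1) ^ 2)⁻¹ * μ| ≤
        A * μ * (Real.exp (-(μ * arcVar M 1)) + G * μ ^ (-(2 / (2 * (i : ℝ) + 1)))) := by
  obtain ⟨C, hC0, hC⟩ := exists_kernel_bound hM hi hκ hlow
  set θ : ℝ := 2 / (2 * (i : ℝ) + 1) with hθ
  have hθ0 : 0 < θ := by positivity
  set d := c 1 ^ 2 + c (-1) ^ 2 with hddef
  set K := |c 1| + |c (-1)| with hK
  have hG0 : 0 ≤ G := (abs_nonneg _).trans (hG 1 (by norm_num))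
  set K' := K * (4 * K + 8 * G) + K + (4 * K + 8 * G) / 2 + 2 * G with hK'
  have hK0 : 0 ≤ K := by positivity
  have hK'0 : 0 ≤ K' := by positivity
  have tq : Tendsto (fun μ => Real.exp (-(μ * arcVar M 1))) atTop (𝓝 0) :=
    Real.tendsto_exp_neg_atTop_nhds_zero.comp (tendsto_id.atTop_mul_const hS)
  have tε : Tendsto (fun μ : ℝ => C * μ ^ (-θ)) atTop (𝓝 0) := by
    simpa using (tendsto_rpow_neg_atTop hθ0).const_mul C
  have tE : Tendsto (fun μ : ℝ => K' * (Real.exp (-(μ * arcVar M 1)) + G * (C * μ ^ (-θ))))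
      atTop (𝓝 0) := by
    simpa using (tq.add (tε.const_mul G)).const_mul K'
  obtain ⟨μ₁, hμ₁⟩ := eventually_atTop.1 (((tq.eventually_le_const (by norm_num : (0 : ℝ) < 1 / 2)).and
    (tε.eventually_le_const (by norm_num : (0 : ℝ) < 2))).and
    (tE.eventually_le_const (half_pos hd)))
  refine ⟨2 / d ^ 2 * K' * (1 + C), max μ₁ 1, by positivity, le_max_right _ _, fun μ hμ => ?_⟩
  have hμ1 : 1 ≤ μ := (le_max_right _ _).trans hμ
  have hμ0 : 0 < μ := by linarith
  obtain ⟨⟨hq, hε2⟩, hE⟩ := hμ₁ μ ((le_max_left _ _).trans hμ)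
  have h := (hprof μ hμ0).abs_constraint_sub_le hM hM0 hg hc hG (hC μ hμ0) hε2 hq hK
  set ℓ := profileConstraint M c (w μ) (z μ)
  set E := K' * (Real.exp (-(μ * arcVar M 1)) + G * (C * μ ^ (-θ))) with hEdef
  have hD : d / 2 ≤ μ * ℓ := by
    have := (abs_le.1 (h.trans hE)).1
    linarith
  have hℓ : 0 < ℓ := by
    by_contra hneg
    have := mul_nonpos_of_nonneg_of_nonpos hμ0.le (not_lt.1 hneg)
    linarith
  have hform : ℓ⁻¹ - d⁻¹ * μ = μ * (d - μ * ℓ) / ((μ * ℓ) * d) := by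
    field_simp
  rw [hform, abs_div, abs_mul, abs_of_pos hμ0, abs_sub_comm d,
    abs_of_pos (show 0 < μ * ℓ * d by positivity)]
  have hden : d / 2 * d ≤ μ * ℓ * d := mul_le_mul_of_nonneg_right hD hd.le
  calc μ * |μ * ℓ - d| / (μ * ℓ * d) ≤ μ * E / (d / 2 * d) :=
        div_le_div₀ (mul_nonneg hμ0.le ((abs_nonneg _).trans h))
          (mul_le_mul_of_nonneg_left h hμ0.le) (by positivity) hden
    _ = 2 / d ^ 2 * K' * (μ * (Real.exp (-(μ * arcVar M 1)) + C * (G * μ ^ (-θ)))) := by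
        rw [hEdef]; field_simp
    _ ≤ 2 / d ^ 2 * K' * (μ * ((1 + C) * (Real.exp (-(μ * arcVar M 1)) + G * μ ^ (-θ)))) := by
        have h1 : 0 ≤ C * Real.exp (-(μ * arcVar M 1)) := by positivity
        have h2 : 0 ≤ G * μ ^ (-θ) := by positivity
        have h3 : Real.exp (-(μ * arcVar M 1)) + C * (G * μ ^ (-θ)) ≤
          (1 + C) * (Real.exp (-(μ * arcVar M 1)) + G * μ ^ (-θ)) := by nlinarith
        gcongr
    _ = _ := by ring

lemma inv_constraint_bounds (hM : Continuous M) (hM0 : ∀ u ∈ Icc (-1 : ℝ) 1, 0 ≤ M u)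
    (hc : ∀ u, HasDerivAt c (1 - g u) u) (hS : 0 < arcVar M 1)
    {μ : ℝ} {w z : ℝ → ℝ} (hμ : 0 < μ) (h : IsProfile M g c μ w z) :
    0 < profileConstraint M c w z ∧
      (profileConstraint M c w z)⁻¹ ≤ μ ^ 2 * arcVar M 1 / 4 := by
  have h4 := h.four_le hM hM0 hc hμ hS
  have hp : 0 < μ ^ 2 * arcVar M 1 := by positivity
  have hℓ : 0 < profileConstraint M c w z := by
    by_contra hneg
    have := mul_nonpos_of_nonneg_of_nonpos hp.le (not_lt.1 hneg)
    linarith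
  refine ⟨hℓ, ?_⟩
  rw [inv_le_iff_one_le_mul₀ hℓ]
  linarith

/-- The symbol `1 / ℓ_μ` is `η μ + R(μ)`: bounds for `R` in general, and its boundedness and rapid
decay if `c' = 1`, where only the reflection coefficient is left. -/
theorem exists_transversal_symbol (hM : Continuous M) {i : ℕ} (hi : 1 ≤ i) {κ : ℝ} (hκ : 0 < κ)
    (hlow : ∀ u ∈ Icc (-1 : ℝ) 1, κ * ((1 - u ^ 2) ^ (i - 1) * √(1 - u ^ 2)) ≤ M u)
    (hg : Continuous g) (hc : ∀ u, HasDerivAt c (1 - g u) u) (hd : 0 < c 1 ^ 2 + c (-1) ^ 2) :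
    ∃ (w z : ℝ → ℝ → ℝ) (R : ℝ → ℝ),
      (∀ μ, 0 < μ → IsProfile M g c μ (w μ) (z μ)) ∧
      (∀ μ, 0 < μ → 0 < profileConstraint M c (w μ) (z μ)) ∧
      (∀ μ, 0 < μ → (profileConstraint M c (w μ) (z μ))⁻¹ = (c 1 ^ 2 + c (-1) ^ 2)⁻¹ * μ + R μ) ∧
      R 0 = 0 ∧
      (∃ C : ℝ, ∀ l : ℝ, 0 < l → |R (√l)| ≤ C * l ^ ((1 : ℝ) / 2 - 1 / (2 * i + 1))) ∧
      ((∀ u ∈ Icc (-1 : ℝ) 1, g u = 0) → (∃ B, ∀ μ, 0 ≤ μ → |R μ| ≤ B) ∧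
        ∀ N : ℕ, Tendsto (fun l => l ^ N * R (√l)) atTop (𝓝 0)) := by
  have hM0 : ∀ u ∈ Icc (-1 : ℝ) 1, 0 ≤ M u := fun u hu => by
    refine le_trans ?_ (hlow u hu)
    have : 0 ≤ 1 - u ^ 2 := by nlinarith [hu.1, hu.2]
    positivity
  have hS : 0 < arcVar M 1 := by
    have := arcVar_sub_ge hM hi hκ hlow (a := -1) (b := 1) le_rfl (by norm_num) le_rfl
    rw [arcVar_left, sub_zero] at this
    refine lt_of_lt_of_le ?_ this
    have : (0 : ℝ) < (1 - -1) / 4 := by norm_num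
    positivity
  have hex : ∀ μ : ℝ, ∃ p : (ℝ → ℝ) × (ℝ → ℝ), 0 < μ → IsProfile M g c μ p.1 p.2 := fun μ => by
    by_cases hμ : 0 < μ
    · obtain ⟨w, z, h⟩ := exists_isProfile hM hg c hμ hS
      exact ⟨(w, z), fun _ => h⟩
    · exact ⟨(0, 0), fun h => absurd h hμ⟩
  choose p hp using hex
  set d := c 1 ^ 2 + c (-1) ^ 2 with hddef
  set ℓ : ℝ → ℝ := fun μ => profileConstraint M c (p μ).1 (p μ).2 with hℓ
  set R : ℝ → ℝ := fun μ => if 0 < μ then (ℓ μ)⁻¹ - d⁻¹ * μ else 0 with hR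
  have hRpos : ∀ μ, 0 < μ → R μ = (ℓ μ)⁻¹ - d⁻¹ * μ := fun μ hμ => if_pos hμ
  have hbd := fun μ hμ => inv_constraint_bounds hM hM0 hc hS hμ (hp μ hμ)
  set S := arcVar M 1 with hSdef
  -- the crude bound, used at low frequencies
  have hlowfreq : ∀ μ, 0 < μ → |R μ| ≤ μ * (μ * S / 4 + d⁻¹) := fun μ hμ => by
    obtain ⟨h1, h2⟩ := hbd μ hμ
    have h3 : 0 < (ℓ μ)⁻¹ := inv_pos.2 h1
    have h4 : (ℓ μ)⁻¹ ≤ μ ^ 2 * S / 4 := h2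
    have h5 : 0 < d⁻¹ * μ := by positivity
    rw [hRpos μ hμ, abs_le]
    have h6 : 0 ≤ μ * (μ * S / 4) := by positivity
    constructor <;> nlinarith
  refine ⟨fun μ => (p μ).1, fun μ => (p μ).2, R, hp, fun μ hμ => (hbd μ hμ).1,
    fun μ hμ => by rw [hRpos μ hμ]; ring, if_neg (lt_irrefl _), ?_, fun hg0 => ?_⟩
  · obtain ⟨G, hG⟩ := isCompact_Icc.exists_bound_of_continuousOn
      (hg.continuousOn (s := Icc (-1 : ℝ) 1))
    obtain ⟨A, μ₀, hA, hμ₀, hrem⟩ := exists_remainder_bound (w := fun μ => (p μ).1)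
      (z := fun μ => (p μ).2) hM hi hκ hlow hM0 hg hc hS hd hp
      (fun r hr => by simpa using hG r hr)
    have hG0 : 0 ≤ G := (norm_nonneg _).trans (hG 1 (by norm_num))
    set θ : ℝ := 2 / (2 * (i : ℝ) + 1) with hθ
    have hθ0 : 0 < θ := by positivity
    have hθ1 : θ ≤ 1 := by
      rw [hθ, div_le_one (by positivity)]
      have : (1 : ℝ) ≤ i := by exact_mod_cast hi
      linarith
    refine ⟨A * (1 / S + G) + (μ₀ * S / 4 + d⁻¹) * μ₀ ^ θ, fun l hl => ?_⟩
    set μ := √l with hμdef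
    have hμ : 0 < μ := Real.sqrt_pos.2 hl
    have hpow : l ^ ((1 : ℝ) / 2 - 1 / (2 * i + 1)) = μ * μ ^ (-θ) := by
      rw [hμdef, Real.sqrt_eq_rpow, ← Real.rpow_mul hl.le, ← Real.rpow_add hl, hθ]
      congr 1
      ring
    rw [hpow]
    have hX : 0 ≤ (μ₀ * S / 4 + d⁻¹) * μ₀ ^ θ := by positivity
    have hY : 0 ≤ A * (1 / S + G) := by positivity
    have hZ : 0 ≤ μ * μ ^ (-θ) := by positivity
    rcases le_or_gt μ₀ μ with hle | hlt
    · have h1 := hrem μ hle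
      rw [hRpos μ hμ]
      have h2 : Real.exp (-(μ * S)) ≤ 1 / S * μ ^ (-θ) := by
        have h3 : μ * S ≤ Real.exp (μ * S) := by linarith [Real.add_one_le_exp (μ * S)]
        have h4 : μ⁻¹ ≤ μ ^ (-θ) := by
          rw [← Real.rpow_neg_one]
          exact Real.rpow_le_rpow_of_exponent_le (hμ₀.trans hle) (by linarith)
        rw [Real.exp_neg]
        calc (Real.exp (μ * S))⁻¹ ≤ (μ * S)⁻¹ := inv_anti₀ (by positivity) h3
          _ = 1 / S * μ⁻¹ := by rw [mul_inv]; ring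
          _ ≤ _ := mul_le_mul_of_nonneg_left h4 (by positivity)
      calc _ ≤ A * μ * (Real.exp (-(μ * S)) + G * μ ^ (-θ)) := h1
        _ ≤ A * μ * (1 / S * μ ^ (-θ) + G * μ ^ (-θ)) := by gcongr
        _ = A * (1 / S + G) * (μ * μ ^ (-θ)) := by ring
        _ ≤ _ := mul_le_mul_of_nonneg_right (by linarith) hZ
    · have h1 : 1 ≤ μ₀ ^ θ * μ ^ (-θ) := by
        rw [Real.rpow_neg hμ.le, ← div_eq_mul_inv, one_le_div (by positivity)]
        exact Real.rpow_le_rpow hμ.le hlt.le hθ0.le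
      calc |R μ| ≤ μ * (μ * S / 4 + d⁻¹) := hlowfreq μ hμ
        _ ≤ μ * (μ₀ * S / 4 + d⁻¹) := by gcongr
        _ ≤ μ * (μ₀ * S / 4 + d⁻¹) * (μ₀ ^ θ * μ ^ (-θ)) :=
            le_mul_of_one_le_right (by positivity) h1
        _ = (μ₀ * S / 4 + d⁻¹) * μ₀ ^ θ * (μ * μ ^ (-θ)) := by ring
        _ ≤ _ := mul_le_mul_of_nonneg_right (by linarith) hZ
  · obtain ⟨A, μ₀, hA, hμ₀, hrem⟩ := exists_remainder_bound (w := fun μ => (p μ).1)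
      (z := fun μ => (p μ).2) hM hi hκ hlow hM0 hg hc hS hd hp (G := 0)
      (fun r hr => by rw [hg0 r hr, abs_zero])
    have hexp : ∀ μ, μ₀ ≤ μ → |R μ| ≤ A * μ * Real.exp (-(μ * S)) := fun μ hle => by
      have := hrem μ hle
      rw [zero_mul, add_zero] at this
      rwa [hRpos μ (by linarith)]
    constructor
    · refine ⟨max 0 (max (A / S) (μ₀ * (μ₀ * S / 4 + d⁻¹))), fun μ hμ => ?_⟩
      rcases hμ.eq_or_lt with h0 | hpos
      · rw [← h0, hR]
        simp
      refine le_trans ?_ (le_max_right _ _)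
      rcases le_or_gt μ₀ μ with hle | hlt
      · refine le_trans ((hexp μ hle).trans ?_) (le_max_left _ _)
        rw [Real.exp_neg, ← div_eq_mul_inv, div_le_div_iff₀ (Real.exp_pos _) hS]
        have h3 : μ * S ≤ Real.exp (μ * S) := by linarith [Real.add_one_le_exp (μ * S)]
        nlinarith
      · refine le_trans ((hlowfreq μ hpos).trans ?_) (le_max_right _ _)
        gcongr
    · intro N
      have h1 : Tendsto (fun μ : ℝ => A * (μ ^ (2 * N + 1) * Real.exp (-(μ * S)))) atTop (𝓝 0) := by
        have h2 := (Real.tendsto_pow_mul_exp_neg_atTop_nhds_zero (2 * N + 1)).comp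
          (tendsto_id.atTop_mul_const hS)
        have h3 := (h2.const_mul (A * (S ^ (2 * N + 1))⁻¹))
        rw [mul_zero] at h3
        refine h3.congr fun μ => ?_
        simp only [Function.comp, id, mul_pow]
        field_simp
      have h4 := h1.comp Real.tendsto_sqrt_atTop
      refine squeeze_zero_norm' ?_ h4
      filter_upwards [Real.tendsto_sqrt_atTop.eventually_ge_atTop μ₀, eventually_ge_atTop 0]
        with l hl hl0
      have h5 : l ^ N = √l ^ (2 * N) := by rw [pow_mul, Real.sq_sqrt hl0]
      simp only [Function.comp]
      rw [norm_mul, Real.norm_eq_abs, Real.norm_eq_abs, abs_of_nonneg (pow_nonneg hl0 N), h5]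
      calc √l ^ (2 * N) * |R (√l)| ≤ √l ^ (2 * N) * (A * √l * Real.exp (-(√l * S))) :=
            mul_le_mul_of_nonneg_left (hexp _ hl) (by positivity)
        _ = _ := by rw [pow_succ]; ring

end Symbol

/-! ### Separated functions in the energy space -/

section Tensor

variable {α β F : Type*} [MeasurableSpace α] [MeasurableSpace β] {μ : Measure α} {ν : Measure β}
  [NormedAddCommGroup F]

lemma L2_norm_sq_eq_integral [InnerProductSpace ℝ F] (f : Lp F 2 μ) : ‖f‖ ^ 2 = ∫ x, ‖f x‖ ^ 2 ∂μ := by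
  rw [← real_inner_self_eq_norm_sq, L2.inner_def]
  exact integral_congr_ae (ae_of_all _ fun x => real_inner_self_eq_norm_sq _)

lemma integrable_norm_sq_of_L2 (f : Lp F 2 μ) : Integrable (fun x => ‖f x‖ ^ 2) μ :=
  (memLp_two_iff_integrable_sq_norm (Lp.aestronglyMeasurable f)).1 (Lp.memLp f)

variable [InnerProductSpace ℝ F]

lemma memLp_tensor (p : Lp ℝ 2 ν) (h : Lp F 2 μ) :
    MemLp (fun q : α × β => p q.2 • h q.1) 2 (μ.prod ν) := by
  have hm : AEStronglyMeasurable (fun q : α × β => p q.2 • h q.1) (μ.prod ν) :=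
    (Lp.aestronglyMeasurable p).comp_snd.smul (Lp.aestronglyMeasurable h).comp_fst
  rw [memLp_two_iff_integrable_sq_norm hm]
  refine ((integrable_norm_sq_of_L2 h).mul_prod (integrable_norm_sq_of_L2 p)).congr
    (ae_of_all _ fun q => ?_)
  simp only [norm_smul]
  ring

lemma tensor_add_left (p p' : Lp ℝ 2 ν) (h : Lp F 2 μ) :
    (memLp_tensor (p + p') h).toLp _ = (memLp_tensor p h).toLp _ + (memLp_tensor p' h).toLp _ := by
  rw [← MemLp.toLp_add]
  refine MemLp.toLp_congr _ _ ?_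
  filter_upwards [Measure.quasiMeasurePreserving_snd.ae_eq_comp (Lp.coeFn_add p p')] with q hq
  simp only [Function.comp, Pi.add_apply] at hq ⊢
  rw [hq, add_smul]

lemma tensor_smul_left (c : ℝ) (p : Lp ℝ 2 ν) (h : Lp F 2 μ) :
    (memLp_tensor (c • p) h).toLp _ = c • (memLp_tensor p h).toLp _ := by
  rw [← MemLp.toLp_const_smul]
  refine MemLp.toLp_congr _ _ ?_
  filter_upwards [Measure.quasiMeasurePreserving_snd.ae_eq_comp (Lp.coeFn_smul c p)] with q hq
  simp only [Function.comp, Pi.smul_apply] at hq ⊢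
  rw [hq, smul_eq_mul, mul_smul]

lemma tensor_add_right (p : Lp ℝ 2 ν) (h h' : Lp F 2 μ) :
    (memLp_tensor p (h + h')).toLp _ = (memLp_tensor p h).toLp _ + (memLp_tensor p h').toLp _ := by
  rw [← MemLp.toLp_add]
  refine MemLp.toLp_congr _ _ ?_
  filter_upwards [Measure.quasiMeasurePreserving_fst.ae_eq_comp (Lp.coeFn_add h h')] with q hq
  simp only [Function.comp, Pi.add_apply] at hq ⊢
  rw [hq, smul_add]

lemma tensor_smul_right (c : ℝ) (p : Lp ℝ 2 ν) (h : Lp F 2 μ) :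
    (memLp_tensor p (c • h)).toLp _ = c • (memLp_tensor p h).toLp _ := by
  rw [← MemLp.toLp_const_smul]
  refine MemLp.toLp_congr _ _ ?_
  filter_upwards [Measure.quasiMeasurePreserving_fst.ae_eq_comp (Lp.coeFn_smul c h)] with q hq
  simp only [Function.comp, Pi.smul_apply] at hq ⊢
  rw [hq, smul_comm]

lemma norm_tensor_le [SFinite μ] [SFinite ν] (p : Lp ℝ 2 ν) (h : Lp F 2 μ) :
    ‖(memLp_tensor p h).toLp (fun q : α × β => p q.2 • h q.1)‖ ≤ 1 * ‖p‖ * ‖h‖ := by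
  rw [one_mul]
  refine le_of_sq_le_sq ?_ (by positivity)
  rw [L2_norm_sq_eq_integral, mul_pow, L2_norm_sq_eq_integral p, L2_norm_sq_eq_integral h,
    mul_comm, ← integral_prod_mul]
  refine le_of_eq (integral_congr_ae ?_)
  filter_upwards [(memLp_tensor p h).coeFn_toLp] with q hq
  rw [hq, norm_smul]
  ring

/-- The tensor product `p ⊗ h`, `(x, u) ↦ p(u) h(x)`, of square integrable functions, as a
bilinear map. -/
noncomputable def tensorBilin (F : Type*) [NormedAddCommGroup F] [InnerProductSpace ℝ F]
    (μ : Measure α) (ν : Measure β) [SFinite μ] [SFinite ν] :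
    Lp ℝ 2 ν →ₗ[ℝ] Lp F 2 μ →ₗ[ℝ] Lp F 2 (μ.prod ν) :=
  LinearMap.mk₂ ℝ (fun p h => (memLp_tensor p h).toLp (fun q : α × β => p q.2 • h q.1))
    tensor_add_left tensor_smul_left tensor_add_right tensor_smul_right

/-- The tensor product of square integrable functions, as a bounded bilinear map. -/
noncomputable def tensorL2 (F : Type*) [NormedAddCommGroup F] [InnerProductSpace ℝ F]
    (μ : Measure α) (ν : Measure β) [SFinite μ] [SFinite ν] :
    Lp ℝ 2 ν →L[ℝ] Lp F 2 μ →L[ℝ] Lp F 2 (μ.prod ν) :=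
  (tensorBilin F μ ν).mkContinuous₂ 1 fun p h => norm_tensor_le p h

lemma coeFn_tensorL2 [SFinite μ] [SFinite ν] (p : Lp ℝ 2 ν) (h : Lp F 2 μ) :
    tensorL2 F μ ν p h =ᵐ[μ.prod ν] fun q => p q.2 • h q.1 :=
  (memLp_tensor p h).coeFn_toLp

end Tensor

section Separated

variable {d : ℕ} {Γ : Set (Eucl d)} {m n A τ : ℝ → ℝ}

/-- The Lebesgue measure on the phase interval. -/
noncomputable abbrev phaseMeasure : Measure ℝ := volume.restrict phaseInterval

/-- The tensor product `p ⊗ h` of functions on the phase interval and on `Γ`. -/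
noncomputable def bulkTensor (F : Type*) [NormedAddCommGroup F] [InnerProductSpace ℝ F]
    (Γ : Set (Eucl d)) [SFinite (surfaceMeasure Γ)] :
    Lp ℝ 2 phaseMeasure →L[ℝ] Lp F 2 (surfaceMeasure Γ) →L[ℝ] Lp F 2 (bulkMeasure Γ) :=
  tensorL2 F (surfaceMeasure Γ) phaseMeasure

lemma coeFn_bulkTensor {F : Type*} [NormedAddCommGroup F] [InnerProductSpace ℝ F]
    [SFinite (surfaceMeasure Γ)] (p : Lp ℝ 2 phaseMeasure) (h : Lp F 2 (surfaceMeasure Γ)) :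
    bulkTensor F Γ p h =ᵐ[bulkMeasure Γ] fun q => p q.2 • h q.1 :=
  coeFn_tensorL2 p h

/-- The inclusion `H¹(Γ) → L²(Γ)` as a bounded operator. -/
noncomputable def toL2L (Γ : Set (Eucl d)) : H1Surf Γ →L[ℝ] L2Surf Γ :=
  (WithLp.fstL 2 ℝ (L2Surf Γ) (L2SurfVec Γ)).comp (sobolevSubmodule Γ).subtypeL

/-- The gradient on `H¹(Γ)` as a bounded operator. -/
noncomputable def gradL (Γ : Set (Eucl d)) : H1Surf Γ →L[ℝ] L2SurfVec Γ :=
  (WithLp.sndL 2 ℝ (L2Surf Γ) (L2SurfVec Γ)).comp (sobolevSubmodule Γ).subtypeL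

/-- The pair of two operators, as an operator into the Hilbert sum. -/
noncomputable def prodL2 {E X Y : Type*} [NormedAddCommGroup E] [NormedSpace ℝ E]
    [NormedAddCommGroup X] [NormedSpace ℝ X] [NormedAddCommGroup Y] [NormedSpace ℝ Y]
    (f : E →L[ℝ] X) (g : E →L[ℝ] Y) : E →L[ℝ] WithLp 2 (X × Y) :=
  ((WithLp.prodContinuousLinearEquiv 2 ℝ X Y).symm : X × Y →L[ℝ] WithLp 2 (X × Y)).comp (f.prod g)

/-- The element `(p ⊗ h, q ⊗ ∇h, c h)` of the ambient Hilbert space, for `h ∈ H¹(Γ)`. If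
`p = √𝖺 W'`, `q = √𝗆 W` and `c = 𝒞W` it represents the function `(x, u) ↦ W(u) h(x)`. -/
noncomputable def separated [SFinite (surfaceMeasure Γ)] (p q : Lp ℝ 2 phaseMeasure) (c : ℝ) :
    H1Surf Γ →L[ℝ] EnergyAmbient Γ :=
  prodL2 ((bulkTensor ℝ Γ p).comp (toL2L Γ))
    (prodL2 ((bulkTensor (Eucl d) Γ q).comp (gradL Γ))
      (c • ContinuousLinearMap.id ℝ (H1Surf Γ)))

section Components
variable [SFinite (surfaceMeasure Γ)] (p q : Lp ℝ 2 phaseMeasure) (c : ℝ) (h : H1Surf Γ)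

lemma separated_fst : (separated p q c h).fst =
    bulkTensor ℝ Γ p h.toL2 := rfl

lemma separated_snd_fst : (separated p q c h).snd.fst =
    bulkTensor (Eucl d) Γ q h.grad := rfl

lemma separated_snd_snd : (separated p q c h).snd.snd = c • h := rfl

lemma separated_eq : separated p q c h = WithLp.toLp 2
    (bulkTensor ℝ Γ p h.toL2, WithLp.toLp 2
      (bulkTensor (Eucl d) Γ q h.grad, c • h)) := rfl

end Components

lemma continuous_separated [SFinite (surfaceMeasure Γ)] (h : H1Surf Γ) :
    Continuous fun t : Lp ℝ 2 phaseMeasure × Lp ℝ 2 phaseMeasure × ℝ =>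
      separated t.1 t.2.1 t.2.2 h := by
  have h1 : Continuous fun t : Lp ℝ 2 phaseMeasure × Lp ℝ 2 phaseMeasure × ℝ =>
      bulkTensor ℝ Γ t.1 h.toL2 := by fun_prop
  have h2 : Continuous fun t : Lp ℝ 2 phaseMeasure × Lp ℝ 2 phaseMeasure × ℝ =>
      bulkTensor (Eucl d) Γ t.2.1 h.grad := by fun_prop
  simp only [separated_eq]
  refine (WithLp.prod_continuous_toLp 2 _ _).comp (h1.prodMk ?_)
  refine (WithLp.prod_continuous_toLp 2 _ _).comp (h2.prodMk ?_)
  fun_prop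

lemma surfaceGradient_const_mul (a : ℝ) {h : Eucl d → ℝ} (hh : Differentiable ℝ h) (x : Eucl d) :
    surfaceGradient Γ (fun x => a * h x) x = a • surfaceGradient Γ h x := by
  have h1 : gradient (fun x => a * h x) x = a • gradient h x := by
    rw [gradient, gradient, fderiv_const_mul (hh x)]
    simp
  rw [surfaceGradient, h1, map_smul]
  rfl

/-- Smooth functions of `u` times `H¹(Γ)` functions of `x` belong to the energy space. -/
lemma separated_mem_of_smooth [SFinite (surfaceMeasure Γ)] {W ρ : ℝ → ℝ} (hW : ContDiff ℝ ∞ W)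
    (hρ : ∀ u, HasDerivAt W (ρ u) u) {p q : Lp ℝ 2 phaseMeasure} {c : ℝ}
    (hp : p =ᵐ[phaseMeasure] fun u => √(weightA n A τ u) * ρ u)
    (hq : q =ᵐ[phaseMeasure] fun u => √(weightM m u) * W u)
    (hc : c = ∫ u in (-1 : ℝ)..1, (W u + quotC n u * ρ u)) (h : H1Surf Γ) :
    separated p q c h ∈ energySubmodule Γ m n A τ := by
  set S : Set (WithLp 2 (L2Surf Γ × L2SurfVec Γ)) := {w | ∃ h : Eucl d → ℝ, ContDiff ℝ ∞ h ∧
    w.fst =ᵐ[surfaceMeasure Γ] h ∧ w.snd =ᵐ[surfaceMeasure Γ] surfaceGradient Γ h} with hS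
  have hmem : ∀ x ∈ Submodule.span ℝ S, ∃ hx : x ∈ sobolevSubmodule Γ,
      separated p q c ⟨x, hx⟩ ∈ energySubmodule Γ m n A τ := by
    intro x hx
    induction hx using Submodule.span_induction with
    | mem x hx =>
      refine ⟨Submodule.le_topologicalClosure _ (Submodule.subset_span hx), ?_⟩
      obtain ⟨f, hf, hf1, hf2⟩ := hx
      have hfd : Differentiable ℝ f := hf.differentiable (by simp)
      refine Submodule.le_topologicalClosure _ (Submodule.subset_span ?_)
      refine ⟨fun y => W y.2 * f y.1, by fun_prop, ?_, ?_, ?_⟩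
      · rw [separated_fst]
        refine (coeFn_bulkTensor _ _).trans ?_
        filter_upwards [Measure.quasiMeasurePreserving_snd.ae_eq_comp hp,
          Measure.quasiMeasurePreserving_fst.ae_eq_comp hf1] with y h1 h2
        simp only [Function.comp] at h1 h2
        have h3 : partialU (fun y : Eucl d × ℝ => W y.2 * f y.1) y = ρ y.2 * f y.1 :=
          ((hρ y.2).mul_const (f y.1)).deriv
        rw [h3, h1, smul_eq_mul, mul_assoc]
        congr 2
      · rw [separated_snd_fst]
        refine (coeFn_bulkTensor _ _).trans ?_
        filter_upwards [Measure.quasiMeasurePreserving_snd.ae_eq_comp hq,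
          Measure.quasiMeasurePreserving_fst.ae_eq_comp hf2] with y h1 h2
        simp only [Function.comp] at h1 h2
        rw [h1, surfaceGradient_const_mul _ hfd, ← h2, mul_smul]
        rfl
      · rw [separated_snd_snd]
        have h1 : H1Surf.toL2 (c • (⟨x, Submodule.le_topologicalClosure _
            (Submodule.subset_span ⟨f, hf, hf1, hf2⟩)⟩ : H1Surf Γ)) = c • x.fst := rfl
        rw [h1]
        refine (Lp.coeFn_smul _ _).trans ?_
        filter_upwards [hf1] with y h2
        rw [Pi.smul_apply, h2, constraintMap, hc, smul_eq_mul, ← intervalIntegral.integral_mul_const]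
        refine intervalIntegral.integral_congr fun u _ => ?_
        have h3 : partialU (fun y : Eucl d × ℝ => W y.2 * f y.1) (y, u) = ρ u * f y :=
          ((hρ u).mul_const (f y)).deriv
        simp only [h3]
        ring
    | zero => exact ⟨Submodule.zero_mem _, by
        have : separated p q c (0 : H1Surf Γ) ∈ energySubmodule Γ m n A τ := by
          rw [ContinuousLinearMap.map_zero]; exact Submodule.zero_mem _
        exact this⟩
    | add x y _ _ hx hy =>
      obtain ⟨hx, hx'⟩ := hx
      obtain ⟨hy, hy'⟩ := hy
      refine ⟨Submodule.add_mem _ hx hy, ?_⟩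
      have := Submodule.add_mem _ hx' hy'
      rw [← ContinuousLinearMap.map_add] at this
      exact this
    | smul a x _ hx =>
      obtain ⟨hx, hx'⟩ := hx
      refine ⟨Submodule.smul_mem _ a hx, ?_⟩
      have := Submodule.smul_mem _ a hx'
      rw [← ContinuousLinearMap.map_smul] at this
      exact this
  have hcl : IsClosed {h : H1Surf Γ | separated p q c h ∈ energySubmodule Γ m n A τ} :=
    (Submodule.isClosed_topologicalClosure _).preimage (separated p q c).continuous
  have hdense : Dense {h : H1Surf Γ | h.1 ∈ Submodule.span ℝ S} := by
    rw [Subtype.dense_iff]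
    intro x hx
    have himg : (Subtype.val '' {h : H1Surf Γ | h.1 ∈ Submodule.span ℝ S}) =
        (Submodule.span ℝ S : Set _) := by
      ext y
      constructor
      · rintro ⟨z, hz, rfl⟩
        exact hz
      · intro hy
        exact ⟨⟨y, Submodule.le_topologicalClosure _ hy⟩, hy, rfl⟩
    have hx' : x ∈ closure (Submodule.span ℝ S : Set _) := hx
    rwa [← himg] at hx'
  have hsub : {h : H1Surf Γ | h.1 ∈ Submodule.span ℝ S} ⊆
      {h : H1Surf Γ | separated p q c h ∈ energySubmodule Γ m n A τ} := by
    intro h hh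
    exact (hmem h.1 hh).2
  exact hcl.closure_subset_iff.2 hsub (hdense h)

end Separated

/-! ### Separated solutions of the elliptic problem -/

/-- Continuous functions `M`, `c`, `g` on the line that represent the weight `𝗆` (whose reciprocal
is `𝖺`), the quotient `n / n'` and its derivative, `c' = 1 - g`, on the phase interval. -/
structure IsTransversalData (m n A τ M g c : ℝ → ℝ) : Prop where
  continuous_M : Continuous M
  continuous_g : Continuous g
  contDiffOn_M : ContDiffOn ℝ ∞ M (Ioo (-1) 1)
  weightM_eq : ∀ u ∈ Icc (-1 : ℝ) 1, weightM m u = M u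
  pos : ∀ u ∈ Ioo (-1 : ℝ) 1, 0 < M u
  weightA_eq : ∀ u ∈ Ioo (-1 : ℝ) 1, weightA n A τ u = (M u)⁻¹
  quotC_eq : ∀ u ∈ Icc (-1 : ℝ) 1, quotC n u = c u
  hasDerivAt_c : ∀ u, HasDerivAt c (1 - g u) u

lemma IsTransversalData.continuous_c {m n A τ M g c : ℝ → ℝ}
    (hD : IsTransversalData m n A τ M g c) : Continuous c :=
  continuous_iff_continuousAt.2 fun u => (hD.hasDerivAt_c u).continuousAt

section WeakForm

variable {d : ℕ} {Γ : Set (Eucl d)} {m n A τ : ℝ → ℝ}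

lemma ae_phaseMeasure_Ioo : ∀ᵐ u ∂phaseMeasure, u ∈ Ioo (-1 : ℝ) 1 := by
  have : phaseMeasure = volume.restrict (Ioo (-1 : ℝ) 1) :=
    Measure.restrict_congr_set Ioo_ae_eq_Icc.symm
  rw [this]
  exact ae_restrict_mem measurableSet_Ioo

lemma integral_phaseMeasure (f : ℝ → ℝ) : ∫ u, f u ∂phaseMeasure = ∫ u in (-1 : ℝ)..1, f u := by
  rw [intervalIntegral.integral_of_le (by norm_num)]
  exact integral_Icc_eq_integral_Ioc

lemma ae_bulk_of_ae_phase {P : ℝ → Prop} (h : ∀ᵐ u ∂phaseMeasure, P u) :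
    ∀ᵐ y ∂bulkMeasure Γ, P y.2 :=
  Measure.quasiMeasurePreserving_snd.ae h

/-- Almost everywhere statements on the bulk hold on almost every slice `u = const`. -/
lemma ae_slice_of_ae_bulk [SFinite (surfaceMeasure Γ)] {P : Eucl d × ℝ → Prop}
    (h : ∀ᵐ y ∂bulkMeasure Γ, P y) : ∀ᵐ u ∂phaseMeasure, ∀ᵐ x ∂surfaceMeasure Γ, P (x, u) := by
  have h1 : ∀ᵐ q ∂(phaseMeasure.prod (surfaceMeasure Γ)), P q.swap :=
    (Measure.measurePreserving_swap (μ := phaseMeasure)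
      (ν := surfaceMeasure Γ)).quasiMeasurePreserving.ae h
  exact Measure.ae_ae_of_ae_prod h1

lemma hasDerivAt_partialU {f : Eucl d × ℝ → ℝ} (hf : ContDiff ℝ ∞ f) (x : Eucl d) (u : ℝ) :
    HasDerivAt (fun v => f (x, v)) (partialU f (x, u)) u := by
  have hd : Differentiable ℝ fun v => f (x, v) :=
    (hf.comp (contDiff_const.prodMk contDiff_id)).differentiable (by simp)
  exact (hd u).hasDerivAt

lemma continuous_partialU {f : Eucl d × ℝ → ℝ} (hf : ContDiff ℝ ∞ f) :
    Continuous (partialU f) := by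
  have h1 : partialU f = fun y => fderiv ℝ f y (0, 1) := by
    funext y
    have h2 : HasFDerivAt f (fderiv ℝ f y) (y.1, y.2) :=
      ((hf.differentiable (by simp)) y).hasFDerivAt
    have h3 : HasDerivAt (fun v : ℝ => (y.1, v)) ((0 : Eucl d), (1 : ℝ)) y.2 :=
      (hasDerivAt_const _ _).prodMk (hasDerivAt_id _)
    exact (h2.comp_hasDerivAt y.2 h3).deriv
  rw [h1]
  exact (hf.continuous_fderiv (by simp)).clm_apply continuous_const

lemma ae_surface_mem (hΓ : IsCompact Γ) : ∀ᵐ x ∂surfaceMeasure Γ, x ∈ Γ :=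
  ae_restrict_mem hΓ.measurableSet

variable [IsFiniteMeasure (surfaceMeasure Γ)]

lemma integrable_mul_continuous (hΓ : IsCompact Γ) (H : L2Surf Γ) {Ψ : Eucl d × ℝ → ℝ}
    (hΨ : Continuous Ψ) : Integrable (fun y => H y.1 * Ψ y) (bulkMeasure Γ) := by
  have h1 : Integrable (fun y : Eucl d × ℝ => H y.1) (bulkMeasure Γ) :=
    ((Lp.memLp H).integrable one_le_two).comp_fst _
  obtain ⟨B, hB⟩ := (hΓ.prod (isCompact_Icc (a := (-1 : ℝ)) (b := 1))).exists_bound_of_continuousOn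
    hΨ.continuousOn
  refine h1.mul_bdd (c := B) hΨ.aestronglyMeasurable ?_
  have h2 : ∀ᵐ y ∂bulkMeasure Γ, y.1 ∈ Γ :=
    Measure.quasiMeasurePreserving_fst.ae (ae_surface_mem hΓ)
  filter_upwards [h2, ae_bulk_of_ae_phase ae_phaseMeasure_Ioo] with y hy1 hy2
  exact hB y ⟨hy1, Ioo_subset_Icc_self hy2⟩

lemma memLp_of_continuous (hΓ : IsCompact Γ) {f : Eucl d → ℝ} (hf : Continuous f) :
    MemLp f 2 (surfaceMeasure Γ) := by
  obtain ⟨B, hB⟩ := hΓ.exists_bound_of_continuousOn hf.continuousOn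
  refine MemLp.of_bound hf.aestronglyMeasurable B ?_
  filter_upwards [ae_surface_mem hΓ] with x hx
  exact hB x hx

/-- The slices of `√𝗆 ∇_Γ f` for smooth `f`: the eigenfunction equation on almost every slice. -/
lemma ae_slice_eigen (hΓ : IsCompact Γ) {M : ℝ → ℝ}
    (hMm : ∀ u ∈ Icc (-1 : ℝ) 1, weightM m u = M u) (hMpos : ∀ u ∈ Ioo (-1 : ℝ) 1, 0 < M u)
    {h : H1Surf Γ} {lam : ℝ}
    (heig : ∀ ψ : H1Surf Γ, ⟪h.grad, ψ.grad⟫_ℝ = lam * ⟪h.toL2, ψ.toL2⟫_ℝ)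
    {f : Eucl d × ℝ → ℝ} (hf : ContDiff ℝ ∞ f) {Y : Lp (Eucl d) 2 (bulkMeasure Γ)}
    (hY : Y =ᵐ[bulkMeasure Γ]
      fun p => √(weightM m p.2) • surfaceGradient Γ (fun x => f (x, p.2)) p.1) :
    ∀ᵐ u ∂phaseMeasure, ∫ x, ⟪h.grad x, Y (x, u)⟫_ℝ ∂surfaceMeasure Γ =
      √(M u) * (lam * ∫ x, h.toL2 x * f (x, u) ∂surfaceMeasure Γ) := by
  have hYi : Integrable (fun y => ‖Y y‖ ^ 2) ((surfaceMeasure Γ).prod phaseMeasure) :=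
    integrable_norm_sq_of_L2 Y
  filter_upwards [ae_slice_of_ae_bulk hY, hYi.prod_left_ae, ae_phaseMeasure_Ioo] with u hYu hint hu
  have hM0 : 0 < √(M u) := Real.sqrt_pos.2 (hMpos u hu)
  have hYu' : ∀ᵐ x ∂surfaceMeasure Γ,
      Y (x, u) = √(M u) • surfaceGradient Γ (fun x => f (x, u)) x := by
    filter_upwards [hYu] with x hx
    rw [hx, hMm u (Ioo_subset_Icc_self hu)]
  have hmeas : AEStronglyMeasurable (fun x => Y (x, u)) (surfaceMeasure Γ) :=
    ((Lp.stronglyMeasurable Y).comp_measurable measurable_prodMk_right).aestronglyMeasurable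
  have hYmem : MemLp (fun x => Y (x, u)) 2 (surfaceMeasure Γ) :=
    (memLp_two_iff_integrable_sq_norm hmeas).2 hint
  have hSG : MemLp (surfaceGradient Γ (fun x => f (x, u))) 2 (surfaceMeasure Γ) := by
    refine (hYmem.const_smul (√(M u))⁻¹).ae_eq ?_
    filter_upwards [hYu'] with x hx
    rw [Pi.smul_apply, hx, smul_smul, inv_mul_cancel₀ hM0.ne', one_smul]
  have hfu : ContDiff ℝ ∞ fun x => f (x, u) := hf.comp (contDiff_id.prodMk contDiff_const)
  have hfm : MemLp (fun x => f (x, u)) 2 (surfaceMeasure Γ) := memLp_of_continuous hΓ hfu.continuous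
  let ψ : H1Surf Γ := ⟨WithLp.toLp 2 (hfm.toLp _, hSG.toLp _),
    Submodule.le_topologicalClosure _ (Submodule.subset_span
      ⟨_, hfu, hfm.coeFn_toLp, hSG.coeFn_toLp⟩)⟩
  have h1 := heig ψ
  have h2 : ⟪h.grad, ψ.grad⟫_ℝ =
      ∫ x, ⟪h.grad x, surfaceGradient Γ (fun x => f (x, u)) x⟫_ℝ ∂surfaceMeasure Γ := by
    rw [L2.inner_def]
    refine integral_congr_ae ?_
    filter_upwards [hSG.coeFn_toLp] with x hx
    have : ψ.grad x = surfaceGradient Γ (fun x => f (x, u)) x := hx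
    rw [this]
  have h3 : ⟪h.toL2, ψ.toL2⟫_ℝ = ∫ x, h.toL2 x * f (x, u) ∂surfaceMeasure Γ := by
    rw [L2.inner_def]
    refine integral_congr_ae ?_
    filter_upwards [hfm.coeFn_toLp] with x hx
    have : ψ.toL2 x = f (x, u) := hx
    rw [this, real_inner_eq_re_inner]
    simp [mul_comm]
  rw [h2, h3] at h1
  rw [← h1, ← integral_const_mul]
  refine integral_congr_ae ?_
  filter_upwards [hYu'] with x hx
  rw [hx, inner_smul_right]

/-- The separated function `W(u) h(x)`, with `h` an eigenfunction and `W` the transversal profile,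
satisfies the weak elliptic equation against smooth functions. -/
lemma energy_eq_of_smooth (hΓ : IsCompact Γ) {M g c : ℝ → ℝ}
    (hD : IsTransversalData m n A τ M g c) {μ : ℝ} {w z : ℝ → ℝ} (hprof : IsProfile M g c μ w z)
    {h : H1Surf Γ} (heig : ∀ ψ : H1Surf Γ, ⟪h.grad, ψ.grad⟫_ℝ = μ ^ 2 * ⟪h.toL2, ψ.toL2⟫_ℝ)
    {p q : Lp ℝ 2 phaseMeasure} (hp : p =ᵐ[phaseMeasure] fun u => √(M u) * z u)
    (hq : q =ᵐ[phaseMeasure] fun u => √(M u) * w u)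
    {f : Eucl d × ℝ → ℝ} (hf : ContDiff ℝ ∞ f) {X : Lp ℝ 2 (bulkMeasure Γ)}
    {Y : Lp (Eucl d) 2 (bulkMeasure Γ)} {k : L2Surf Γ}
    (hX : X =ᵐ[bulkMeasure Γ] fun p => √(weightA n A τ p.2) * partialU f p)
    (hY : Y =ᵐ[bulkMeasure Γ]
      fun p => √(weightM m p.2) • surfaceGradient Γ (fun x => f (x, p.2)) p.1)
    (hk : k =ᵐ[surfaceMeasure Γ] constraintMap n f) :
    ⟪bulkTensor ℝ Γ p h.toL2, X⟫_ℝ +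
      ⟪bulkTensor (Eucl d) Γ q h.grad, Y⟫_ℝ = ⟪h.toL2, k⟫_ℝ := by
  have hM := hD.continuous_M
  have cc := hD.continuous_c
  have cw := hprof.continuous_w
  have cz := hprof.continuous_z
  have cpf := continuous_partialU hf
  have cf := hf.continuous
  have hI1 := integrable_mul_continuous hΓ h.toL2 (Ψ := fun y => z y.2 * partialU f y) (by fun_prop)
  have hI2 := integrable_mul_continuous hΓ h.toL2
    (Ψ := fun y => μ ^ 2 * (M y.2 * w y.2 * f y)) (by fun_prop)
  have hIoo := ae_bulk_of_ae_phase (Γ := Γ) ae_phaseMeasure_Ioo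
  have t1 : ⟪bulkTensor ℝ Γ p h.toL2, X⟫_ℝ =
      ∫ y, h.toL2 y.1 * (z y.2 * partialU f y) ∂bulkMeasure Γ := by
    rw [L2.inner_def]
    refine integral_congr_ae ?_
    filter_upwards [coeFn_bulkTensor p h.toL2, hX, ae_bulk_of_ae_phase hp, hIoo] with y h1 h2 h3 h4
    have h5 : 0 < √(M y.2) := Real.sqrt_pos.2 (hD.pos _ h4)
    rw [h1, h2, h3, hD.weightA_eq _ h4, Real.sqrt_inv, real_inner_eq_re_inner]
    simp only [smul_eq_mul, RCLike.inner_apply, conj_trivial, RCLike.re_to_real]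
    field_simp
  have t2 : ⟪bulkTensor (Eucl d) Γ q h.grad, Y⟫_ℝ =
      ∫ y, h.toL2 y.1 * (μ ^ 2 * (M y.2 * w y.2 * f y)) ∂bulkMeasure Γ := by
    have hJ : (fun y => ⟪bulkTensor (Eucl d) Γ q h.grad y, Y y⟫_ℝ)
        =ᵐ[bulkMeasure Γ] fun y => √(M y.2) * w y.2 * ⟪h.grad y.1, Y y⟫_ℝ := by
      filter_upwards [coeFn_bulkTensor q h.grad, ae_bulk_of_ae_phase hq] with y h1 h2
      rw [h1, h2, real_inner_smul_left]
    have hJi := (L2.integrable_inner (𝕜 := ℝ)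
      (bulkTensor (Eucl d) Γ q h.grad) Y).congr hJ
    rw [L2.inner_def, integral_congr_ae hJ]
    change ∫ y, _ ∂((surfaceMeasure Γ).prod phaseMeasure) =
      ∫ y, _ ∂((surfaceMeasure Γ).prod phaseMeasure)
    rw [integral_prod_symm _ hJi, integral_prod_symm _ hI2]
    refine integral_congr_ae ?_
    filter_upwards [ae_slice_eigen hΓ hD.weightM_eq hD.pos heig hf hY, ae_phaseMeasure_Ioo] with u h1 h2
    have h3 : √(M u) * √(M u) = M u := Real.mul_self_sqrt (hD.pos u h2).le
    have h4 : ∫ x, h.toL2 x * (μ ^ 2 * (M u * w u * f (x, u))) ∂surfaceMeasure Γ =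
        (μ ^ 2 * (M u * w u)) * ∫ x, h.toL2 x * f (x, u) ∂surfaceMeasure Γ := by
      rw [← integral_const_mul]
      exact integral_congr_ae (ae_of_all _ fun x => by ring)
    rw [integral_const_mul, h1, h4]
    linear_combination (w u * μ ^ 2 * ∫ x, h.toL2 x * f (x, u) ∂surfaceMeasure Γ) * h3
  rw [t1, t2, ← integral_add hI1 hI2]
  have hI3 : Integrable (fun y => h.toL2 y.1 * (z y.2 * partialU f y) +
      h.toL2 y.1 * (μ ^ 2 * (M y.2 * w y.2 * f y))) ((surfaceMeasure Γ).prod phaseMeasure) :=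
    hI1.add hI2
  change ∫ y, _ ∂((surfaceMeasure Γ).prod phaseMeasure) = _
  rw [integral_prod _ hI3, L2.inner_def]
  refine integral_congr_ae ?_
  filter_upwards [hk] with x hx
  have hweak := hprof.weak_form hM hD.hasDerivAt_c (Φ := fun u => f (x, u))
      (Φ' := fun u => partialU f (x, u))
    (fun u => hasDerivAt_partialU hf x u) (by fun_prop)
  have hcm : constraintMap n f x = ∫ u in (-1 : ℝ)..1, (f (x, u) + c u * partialU f (x, u)) := by
    refine intervalIntegral.integral_congr fun u hu => ?_
    rw [uIcc_of_le (by norm_num)] at hu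
    simp only [hD.quotC_eq u hu]
  rw [hx, hcm, ← hweak, ← integral_phaseMeasure, real_inner_eq_re_inner]
  simp only [RCLike.inner_apply, conj_trivial, RCLike.re_to_real]
  rw [mul_comm, ← integral_const_mul]
  exact integral_congr_ae (ae_of_all _ fun u => by ring)

/-- The weak elliptic equation for separated functions, against the whole energy space. -/
lemma energy_eq_of_mem (hΓ : IsCompact Γ) {M g c : ℝ → ℝ}
    (hD : IsTransversalData m n A τ M g c) {μ : ℝ} {w z : ℝ → ℝ} (hprof : IsProfile M g c μ w z)
    {h : H1Surf Γ} (heig : ∀ ψ : H1Surf Γ, ⟪h.grad, ψ.grad⟫_ℝ = μ ^ 2 * ⟪h.toL2, ψ.toL2⟫_ℝ)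
    {p q : Lp ℝ 2 phaseMeasure} (hp : p =ᵐ[phaseMeasure] fun u => √(M u) * z u)
    (hq : q =ᵐ[phaseMeasure] fun u => √(M u) * w u)
    {φ : EnergyAmbient Γ} (hφ : φ ∈ energySubmodule Γ m n A τ) :
    ⟪bulkTensor ℝ Γ p h.toL2, φ.fst⟫_ℝ +
      ⟪bulkTensor (Eucl d) Γ q h.grad, φ.snd.fst⟫_ℝ =
      ⟪h.toL2, φ.snd.snd.toL2⟫_ℝ := by
  have c1 : Continuous fun φ : EnergyAmbient Γ => φ.fst := WithLp.continuous_fst ..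
  have c2 : Continuous fun φ : EnergyAmbient Γ => φ.snd := WithLp.continuous_snd ..
  have c3 : Continuous fun φ : WithLp 2 (Lp (Eucl d) 2 (bulkMeasure Γ) × H1Surf Γ) => φ.fst :=
    WithLp.continuous_fst ..
  have c4 : Continuous fun φ : WithLp 2 (Lp (Eucl d) 2 (bulkMeasure Γ) × H1Surf Γ) => φ.snd :=
    WithLp.continuous_snd ..
  have c5 : Continuous fun φ : EnergyAmbient Γ => φ.snd.fst := c3.comp c2
  have c6 : Continuous fun φ : EnergyAmbient Γ => φ.snd.snd.toL2 :=
    (toL2L Γ).continuous.comp (c4.comp c2)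
  have hcl : IsClosed {φ : EnergyAmbient Γ | ⟪bulkTensor ℝ Γ p h.toL2, φ.fst⟫_ℝ +
      ⟪bulkTensor (Eucl d) Γ q h.grad, φ.snd.fst⟫_ℝ = ⟪h.toL2, φ.snd.snd.toL2⟫_ℝ} :=
    isClosed_eq ((continuous_const.inner c1).add (continuous_const.inner c5))
      (continuous_const.inner c6)
  refine hcl.closure_subset_iff.2 ?_ hφ
  intro x hx
  induction hx using Submodule.span_induction with
  | mem x hx =>
    obtain ⟨f, hf, h1, h2, h3⟩ := hx
    exact energy_eq_of_smooth hΓ hD hprof heig hp hq hf h1 h2 h3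
  | zero =>
    have e : (H1Surf.toL2 (0 : H1Surf Γ)) = 0 := rfl
    simp only [mem_ofPred_eq, WithLp.zero_fst, WithLp.zero_snd, inner_zero_right, e, add_zero]
  | add x y _ _ hx hy =>
    have e : (H1Surf.toL2 (x.snd.snd + y.snd.snd)) = x.snd.snd.toL2 + y.snd.snd.toL2 := rfl
    simp only [mem_ofPred_eq, WithLp.add_fst, WithLp.add_snd, inner_add_right, e] at hx hy ⊢
    linarith
  | smul a x _ hx =>
    have e : (H1Surf.toL2 (a • x.snd.snd)) = a • x.snd.snd.toL2 := rfl
    simp only [mem_ofPred_eq, WithLp.smul_fst, WithLp.smul_snd, inner_smul_right, e] at hx ⊢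
    rw [← hx]
    ring

end WeakForm

/-! ### Approximation of profiles by smooth functions -/

section Approximation

/-- The class in `L²(-1, 1)` of a continuous function. -/
noncomputable def contL2 (f : ℝ → ℝ) (hf : Continuous f) : Lp ℝ 2 phaseMeasure :=
  MemLp.toLp (μ := phaseMeasure) f (by
    obtain ⟨B, hB⟩ := (isCompact_Icc (a := (-1 : ℝ)) (b := 1)).exists_bound_of_continuousOn
      hf.continuousOn
    exact MemLp.of_bound hf.aestronglyMeasurable B
      (ae_phaseMeasure_Ioo.mono fun u hu => hB u (Ioo_subset_Icc_self hu)))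

lemma coeFn_contL2 {f : ℝ → ℝ} (hf : Continuous f) : contL2 f hf =ᵐ[phaseMeasure] f :=
  MemLp.coeFn_toLp _

lemma tendsto_contL2 {F : ℕ → ℝ → ℝ} {f : ℝ → ℝ} (hF : ∀ j, Continuous (F j)) (hf : Continuous f)
    {C : ℝ} (hC : ∀ j, ∀ u ∈ Ioo (-1 : ℝ) 1, |F j u - f u| ≤ C)
    (ht : ∀ u ∈ Ioo (-1 : ℝ) 1, Tendsto (fun j => F j u) atTop (𝓝 (f u))) :
    Tendsto (fun j => contL2 (F j) (hF j)) atTop (𝓝 (contL2 f hf)) := by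
  rw [tendsto_iff_norm_sub_tendsto_zero]
  have h1 : ∀ j, ‖contL2 (F j) (hF j) - contL2 f hf‖ ^ 2 =
      ∫ u, (F j u - f u) ^ 2 ∂phaseMeasure := fun j => by
    rw [L2_norm_sq_eq_integral]
    refine integral_congr_ae ?_
    filter_upwards [Lp.coeFn_sub (contL2 (F j) (hF j)) (contL2 f hf), coeFn_contL2 (hF j),
      coeFn_contL2 hf] with u e1 e2 e3
    rw [e1, Pi.sub_apply, e2, e3, Real.norm_eq_abs, sq_abs]
  have h2 : Tendsto (fun j => ∫ u, (F j u - f u) ^ 2 ∂phaseMeasure) atTop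
      (𝓝 (∫ _, (0 : ℝ) ∂phaseMeasure)) := by
    refine tendsto_integral_of_dominated_convergence (fun _ => C ^ 2)
      (fun j => (((hF j).sub hf).pow 2).aestronglyMeasurable) (integrable_const _) (fun j => ?_) ?_
    · filter_upwards [ae_phaseMeasure_Ioo] with u hu
      rw [Real.norm_eq_abs, abs_pow]
      exact pow_le_pow_left₀ (abs_nonneg _) (hC j u hu) 2
    · filter_upwards [ae_phaseMeasure_Ioo] with u hu
      simpa using ((ht u hu).sub_const (f u)).pow 2
  rw [integral_zero] at h2
  have h3 : Tendsto (fun j => ‖contL2 (F j) (hF j) - contL2 f hf‖ ^ 2) atTop (𝓝 0) := by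
    simpa only [h1] using h2
  simpa using h3.sqrt

/-- A continuous function is the pointwise limit on `(-1, 1)` of bounded functions whose product
with `M` is smooth, for a weight `M` that is smooth in the open interval: polynomial approximations,
cut off near the end points. -/
lemma exists_smooth_approx {M z : ℝ → ℝ} (hMs : ContDiffOn ℝ ∞ M (Ioo (-1) 1))
    (hz : Continuous z) :
    ∃ (ζ : ℕ → ℝ → ℝ) (C : ℝ), (∀ j, Continuous (ζ j)) ∧
      (∀ j, ContDiff ℝ ∞ fun u => M u * ζ j u) ∧
      (∀ j, ∀ u ∈ Icc (-1 : ℝ) 1, |ζ j u| ≤ C) ∧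
      ∀ u ∈ Ioo (-1 : ℝ) 1, Tendsto (fun j => ζ j u) atTop (𝓝 (z u)) := by
  obtain ⟨Z, hZ⟩ := (isCompact_Icc (a := (-1 : ℝ)) (b := 1)).exists_bound_of_continuousOn
    hz.continuousOn
  have hpoly : ∀ j : ℕ, ∃ P : Polynomial ℝ, ∀ u ∈ Icc (-1 : ℝ) 1,
      |P.eval u - z u| < 1 / ((j : ℝ) + 1) := fun j =>
    exists_polynomial_near_of_continuousOn (-1) 1 z hz.continuousOn _ (by positivity)
  choose P hP using hpoly
  have hfrac : ∀ j : ℕ, (0 : ℝ) < 1 / ((j : ℝ) + 3) ∧ 1 / ((j : ℝ) + 3) ≤ 1 / 3 := fun j =>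
    ⟨by positivity, one_div_le_one_div_of_le (by norm_num) (by linarith [Nat.cast_nonneg (α := ℝ) j])⟩
  let χ : ∀ j : ℕ, ContDiffBump (0 : ℝ) := fun j =>
    { rIn := 1 - 2 * (1 / ((j : ℝ) + 3))
      rOut := 1 - 1 / ((j : ℝ) + 3)
      rIn_pos := by linarith [hfrac j]
      rIn_lt_rOut := by linarith [hfrac j] }
  have hPs : ∀ j, ContDiff ℝ ∞ fun u => (P j).eval u := fun j => by
    simpa using (P j).contDiff_aeval (𝕜 := ℝ) ∞
  refine ⟨fun j u => χ j u * (P j).eval u, Z + 1, fun j => ?_, fun j => ?_, fun j u hu => ?_,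
    fun u hu => ?_⟩
  · exact (χ j).continuous.mul (hPs j).continuous
  · rw [contDiff_iff_contDiffAt]
    intro u
    by_cases hu : u ∈ Ioo (-1 : ℝ) 1
    · exact (hMs.contDiffAt (Ioo_mem_nhds hu.1 hu.2)).mul
        ((χ j).contDiff.contDiffAt.mul (hPs j).contDiffAt)
    · have hts : u ∉ tsupport (χ j) := by
        rw [(χ j).tsupport_eq]
        intro hball
        apply hu
        rw [Metric.mem_closedBall, dist_zero_right, Real.norm_eq_abs, abs_le] at hball
        have : (χ j).rOut < 1 := by
          change 1 - 1 / ((j : ℝ) + 3) < 1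
          linarith [hfrac j]
        exact ⟨by linarith [hball.1], by linarith [hball.2]⟩
      have hev : (fun u => M u * (χ j u * (P j).eval u)) =ᶠ[𝓝 u] fun _ => 0 := by
        filter_upwards [notMem_tsupport_iff_eventuallyEq.1 hts] with v hv
        rw [hv]
        simp
      exact contDiffAt_const.congr_of_eventuallyEq hev
  · have h1 : |(P j).eval u| ≤ Z + 1 := by
      have e1 := hP j u hu
      have e2 : |z u| ≤ Z := hZ u hu
      have e3 : 1 / ((j : ℝ) + 1) ≤ 1 := by
        rw [div_le_one (by positivity)]
        linarith [Nat.cast_nonneg (α := ℝ) j]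
      have e4 : |(P j).eval u| ≤ |(P j).eval u - z u| + |z u| := by
        simpa using abs_add_le ((P j).eval u - z u) (z u)
      linarith
    rw [abs_mul, abs_of_nonneg (χ j).nonneg]
    calc χ j u * |(P j).eval u| ≤ 1 * |(P j).eval u| :=
          mul_le_mul_of_nonneg_right (χ j).le_one (abs_nonneg _)
      _ ≤ Z + 1 := by rw [one_mul]; exact h1
  · have h1 : Tendsto (fun j : ℕ => (P j).eval u) atTop (𝓝 (z u)) := by
      rw [tendsto_iff_dist_tendsto_zero]
      refine squeeze_zero (fun _ => dist_nonneg) (fun j => ?_)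
        (tendsto_one_div_add_atTop_nhds_zero_nat (𝕜 := ℝ))
      exact (hP j u (Ioo_subset_Icc_self hu)).le
    have h2 : ∀ᶠ j : ℕ in atTop, χ j u = 1 := by
      have h3 : Tendsto (fun j : ℕ => 1 - 2 * (1 / ((j : ℝ) + 3))) atTop (𝓝 1) := by
        have h4 : Tendsto (fun j : ℕ => 1 / ((j : ℝ) + 3)) atTop (𝓝 0) :=
          (tendsto_const_nhds.div_atTop
            (tendsto_natCast_atTop_atTop.atTop_add tendsto_const_nhds))
        simpa using (h4.const_mul 2).const_sub 1
      have hu' : |u| < 1 := abs_lt.2 hu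
      filter_upwards [h3.eventually (eventually_ge_nhds hu')] with j hj
      refine (χ j).one_of_mem_closedBall ?_
      rw [Metric.mem_closedBall, dist_zero_right, Real.norm_eq_abs]
      exact hj
    refine h1.congr' ?_
    filter_upwards [h2] with j hj
    rw [hj, one_mul]

variable {d : ℕ} {Γ : Set (Eucl d)} {m n A τ : ℝ → ℝ} [SFinite (surfaceMeasure Γ)]

/-- Products of `H¹(Γ)` functions with functions `w(u)` such that `w' / M` is continuous belong to
the energy space. -/
lemma separated_mem_of_hasDerivAt {M g c w z : ℝ → ℝ} (hD : IsTransversalData m n A τ M g c)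
    (hz : Continuous z)
    (hw : ∀ u, HasDerivAt w (M u * z u) u) (hcw : Continuous w) (h : H1Surf Γ) :
    separated (contL2 (fun u => √(M u) * z u) (hD.continuous_M.sqrt.mul hz))
      (contL2 (fun u => √(M u) * w u) (hD.continuous_M.sqrt.mul hcw)) (profileConstraint M c w z) h ∈
      energySubmodule Γ m n A τ := by
  have hM := hD.continuous_M
  have hc := hD.continuous_c
  obtain ⟨ζ, C, hζc, hζs, hζC, hζt⟩ := exists_smooth_approx hD.contDiffOn_M hz
  have hbound : ∀ f : ℝ → ℝ, Continuous f → ∃ B, ∀ u ∈ Icc (-1 : ℝ) 1, |f u| ≤ B := fun f hf =>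
    isCompact_Icc.exists_bound_of_continuousOn hf.continuousOn
  obtain ⟨B, hB⟩ := hbound M hM
  obtain ⟨B', hB'⟩ := hbound (fun u => √(M u)) (by fun_prop)
  obtain ⟨Z, hZ⟩ := hbound z hz
  obtain ⟨Wb, hWb⟩ := hbound w hcw
  obtain ⟨Cb, hCb⟩ := hbound c hc
  have m0 : (0 : ℝ) ∈ Icc (-1 : ℝ) 1 := by norm_num
  have hB0 : 0 ≤ B := (abs_nonneg _).trans (hB 0 m0)
  have hB'0 : 0 ≤ B' := (abs_nonneg _).trans (hB' 0 m0)
  have hC0 : 0 ≤ C := (abs_nonneg _).trans (hζC 0 0 m0)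
  have hCb0 : 0 ≤ Cb := (abs_nonneg _).trans (hCb 0 m0)
  set W : ℕ → ℝ → ℝ := fun j u => w 0 + ∫ t in (0 : ℝ)..u, M t * ζ j t with hW
  have hWd : ∀ j u, HasDerivAt (W j) (M u * ζ j u) u := fun j u => by
    have hcont := hM.mul (hζc j)
    exact (intervalIntegral.integral_hasDerivAt_right (hcont.intervalIntegrable _ _)
      (hcont.stronglyMeasurableAtFilter _ _) hcont.continuousAt).const_add (w 0)
  have hWc : ∀ j, Continuous (W j) := fun j =>
    continuous_iff_continuousAt.2 fun u => (hWd j u).continuousAt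
  have hWs : ∀ j, ContDiff ℝ ∞ (W j) := fun j => by
    rw [contDiff_infty_iff_deriv]
    refine ⟨fun u => (hWd j u).differentiableAt, ?_⟩
    have : deriv (W j) = fun u => M u * ζ j u := funext fun u => (hWd j u).deriv
    rw [this]
    exact hζs j
  have hMζ : ∀ j, ∀ u ∈ Icc (-1 : ℝ) 1, |M u * ζ j u| ≤ B * C := fun j u hu => by
    rw [abs_mul]
    exact mul_le_mul (hB u hu) (hζC j u hu) (abs_nonneg _) hB0
  have hsub : ∀ u ∈ Icc (-1 : ℝ) 1, uIoc 0 u ⊆ Icc (-1 : ℝ) 1 := fun u hu t ht => by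
    rw [uIoc, mem_Ioc] at ht
    refine ⟨?_, ht.2.trans (max_le (by norm_num) hu.2)⟩
    exact (le_min (by norm_num) hu.1).trans ht.1.le
  have hWbd : ∀ j, ∀ u ∈ Icc (-1 : ℝ) 1, |W j u| ≤ Wb + B * C := fun j u hu => by
    refine (abs_add_le _ _).trans (add_le_add (hWb 0 m0) ?_)
    have h1 := intervalIntegral.norm_integral_le_of_norm_le_const (a := 0) (b := u)
      (f := fun t => M t * ζ j t) (C := B * C) fun t ht => hMζ j t (hsub u hu ht)
    rw [Real.norm_eq_abs] at h1
    refine h1.trans (mul_le_of_le_one_right (by positivity) ?_)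
    rw [sub_zero, abs_le]
    exact hu
  have hWt : ∀ u ∈ Ioo (-1 : ℝ) 1, Tendsto (fun j => W j u) atTop (𝓝 (w u)) := fun u hu => by
    have hcMz := hM.mul hz
    have h1 : w u = w 0 + ∫ t in (0 : ℝ)..u, M t * z t := by
      rw [intervalIntegral.integral_eq_sub_of_hasDerivAt (fun t _ => hw t)
        (hcMz.intervalIntegrable _ _)]
      ring
    rw [h1]
    refine tendsto_const_nhds.add ?_
    refine intervalIntegral.tendsto_integral_filter_of_dominated_convergence (fun _ => B * C)
      (Eventually.of_forall fun j => (hM.mul (hζc j)).aestronglyMeasurable)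
      (Eventually.of_forall fun j => ae_of_all _ fun t ht =>
        hMζ j t (hsub u (Ioo_subset_Icc_self hu) ht))
      (by simp) (ae_of_all _ fun t ht => ?_)
    refine (hζt t ?_).const_mul _
    rw [uIoc, mem_Ioc] at ht
    exact ⟨(lt_min (by norm_num) hu.1).trans ht.1, ht.2.trans_lt (max_lt (by norm_num) hu.2)⟩
  have hcp : Continuous fun u => √(M u) * z u := by fun_prop
  have hcq : Continuous fun u => √(M u) * w u := by fun_prop
  have hcpj : ∀ j, Continuous fun u => √(M u) * ζ j u := fun j => by
    have := hζc j; fun_prop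
  have hcqj : ∀ j, Continuous fun u => √(M u) * W j u := fun j => by
    have := hWc j; fun_prop
  have hpt : Tendsto (fun j => contL2 _ (hcpj j)) atTop (𝓝 (contL2 _ hcp)) := by
    refine tendsto_contL2 hcpj hcp (C := B' * (C + Z)) (fun j u hu => ?_) fun u hu =>
      (hζt u hu).const_mul _
    have hu' := Ioo_subset_Icc_self hu
    rw [← mul_sub, abs_mul]
    exact mul_le_mul (hB' u hu') ((abs_sub _ _).trans (add_le_add (hζC j u hu') (hZ u hu')))
      (abs_nonneg _) hB'0
  have hqt : Tendsto (fun j => contL2 _ (hcqj j)) atTop (𝓝 (contL2 _ hcq)) := by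
    refine tendsto_contL2 hcqj hcq (C := B' * (Wb + B * C + Wb)) (fun j u hu => ?_) fun u hu =>
      (hWt u hu).const_mul _
    have hu' := Ioo_subset_Icc_self hu
    rw [← mul_sub, abs_mul]
    exact mul_le_mul (hB' u hu') ((abs_sub _ _).trans (add_le_add (hWbd j u hu') (hWb u hu')))
      (abs_nonneg _) hB'0
  have hct : Tendsto (fun j => profileConstraint M c (W j) (ζ j)) atTop
      (𝓝 (profileConstraint M c w z)) := by
    refine intervalIntegral.tendsto_integral_filter_of_dominated_convergence
      (fun _ => Wb + B * C + Cb * (B * C)) (Eventually.of_forall fun j => ?_)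
      (Eventually.of_forall fun j => ae_of_all _ fun u hu => ?_) (by simp) ?_
    · exact ((hWc j).add (hc.mul (hM.mul (hζc j)))).aestronglyMeasurable
    · rw [uIoc_of_le (by norm_num)] at hu
      have hu' := Ioc_subset_Icc_self hu
      refine (abs_add_le _ _).trans (add_le_add (hWbd j u hu') ?_)
      rw [abs_mul]
      exact mul_le_mul (hCb u hu') (hMζ j u hu') (abs_nonneg _) hCb0
    · have hne : ∀ᵐ u ∂(volume : Measure ℝ), u ≠ 1 := Measure.ae_ne volume 1
      filter_upwards [hne] with u hu1 hu
      rw [uIoc_of_le (by norm_num)] at hu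
      have hu' : u ∈ Ioo (-1 : ℝ) 1 := ⟨hu.1, lt_of_le_of_ne hu.2 hu1⟩
      exact (hWt u hu').add (((hζt u hu').const_mul _).const_mul _)
  have hlim := ((continuous_separated h).tendsto
    (contL2 _ hcp, contL2 _ hcq, profileConstraint M c w z)).comp
    (hpt.prodMk_nhds (hqt.prodMk_nhds hct))
  refine (Submodule.isClosed_topologicalClosure _).mem_of_tendsto hlim
    (Eventually.of_forall fun j => ?_)
  refine separated_mem_of_smooth (hWs j) (hWd j) ?_ ?_ ?_ h
  · filter_upwards [coeFn_contL2 (hcpj j), ae_phaseMeasure_Ioo] with u h1 h2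
    have h3 : 0 < √(M u) := Real.sqrt_pos.2 (hD.pos u h2)
    have h4 : √(M u) * √(M u) = M u := Real.mul_self_sqrt (hD.pos u h2).le
    rw [h1, hD.weightA_eq u h2, Real.sqrt_inv]
    nth_rewrite 3 [← h4]
    field_simp
  · filter_upwards [coeFn_contL2 (hcqj j), ae_phaseMeasure_Ioo] with u h1 h2
    rw [h1, hD.weightM_eq u (Ioo_subset_Icc_self h2)]
  · refine intervalIntegral.integral_congr fun u hu => ?_
    rw [uIcc_of_le (by norm_num)] at hu
    simp only [hD.quotC_eq u hu]

/-- Functions that do not depend on `u` belong to the energy space; the factor `1 / 2` normalizes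
the constraint. -/
lemma separated_const_mem {M g c : ℝ → ℝ} (hD : IsTransversalData m n A τ M g c) (h : H1Surf Γ) :
    separated 0 (contL2 (fun u => √(M u) * (1 / 2)) (hD.continuous_M.sqrt.mul continuous_const)) 1 h ∈
      energySubmodule Γ m n A τ := by
  refine separated_mem_of_smooth (W := fun _ => 1 / 2) (ρ := fun _ => 0) contDiff_const
    (fun u => hasDerivAt_const u _) ?_ ?_ ?_ h
  · filter_upwards [Lp.coeFn_zero ℝ 2 phaseMeasure] with u hu
    rw [hu, mul_zero, Pi.zero_apply]
  · filter_upwards [coeFn_contL2 (f := fun u => √(M u) * (1 / 2))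
      (hD.continuous_M.sqrt.mul continuous_const),
      ae_phaseMeasure_Ioo] with u h1 h2
    rw [h1, hD.weightM_eq u (Ioo_subset_Icc_self h2)]
  · norm_num

end Approximation

/-! ### Well-posedness and the propagation operator -/

/-- Constrained minimization in a Hilbert space `E`, for the form `⟪f, g⟫ - ⟪C f, C g⟫` and a
constraint `C` with bounded right inverse `L`: the solution is the component of `L κ` orthogonal to
`ker C`. -/
lemma existsUnique_constrained {E F : Type*} [NormedAddCommGroup E] [InnerProductSpace ℝ E]
    [CompleteSpace E] [NormedAddCommGroup F] [InnerProductSpace ℝ F] (C : E →L[ℝ] F)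
    (L : F →L[ℝ] E) (hL : ∀ x, C (L x) = x) (κ : F) :
    ∃! p : E × (F →L[ℝ] ℝ), (∀ φ, ⟪p.1, φ⟫_ℝ - ⟪C p.1, C φ⟫_ℝ = p.2 (C φ)) ∧ C p.1 = κ := by
  set K := LinearMap.ker (C : E →ₗ[ℝ] F) with hK
  have hKc : IsClosed (K : Set E) := C.isClosed_ker
  have : CompleteSpace K := hKc.completeSpace_coe
  have hmemK : ∀ x, x ∈ K ↔ C x = 0 := fun x => LinearMap.mem_ker
  set f := L κ - K.starProjection (L κ) with hf
  have hfo : f ∈ Kᗮ := K.sub_starProjection_mem_orthogonal (L κ)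
  have hCf : C f = κ := by
    have : C (K.starProjection (L κ)) = 0 := (hmemK _).1 (K.starProjection_apply_mem (L κ))
    rw [hf, C.map_sub, this, hL, sub_zero]
  let V : F →L[ℝ] ℝ := (innerSL ℝ f).comp L - innerSL ℝ (C f)
  have hV : ∀ ψ, V ψ = ⟪f, L ψ⟫_ℝ - ⟪C f, ψ⟫_ℝ := fun ψ => rfl
  refine ⟨(f, V), ⟨fun φ => ?_, hCf⟩, ?_⟩
  · have h1 : φ - L (C φ) ∈ K := (hmemK _).2 (by rw [C.map_sub, hL, sub_self])
    have h2 : ⟪f, φ - L (C φ)⟫_ℝ = 0 := K.inner_left_of_mem_orthogonal h1 hfo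
    rw [inner_sub_right] at h2
    simp only [hV]
    linarith
  · rintro ⟨f', V'⟩ ⟨h1, h2⟩
    simp only at h1 h2
    have hd : ∀ φ, C φ = 0 → ⟪f', φ⟫_ℝ = 0 := fun φ hφ => by
      have := h1 φ
      rw [hφ, inner_zero_right, sub_zero, V'.map_zero] at this
      exact this
    have hCg : C (f' - f) = 0 := by rw [C.map_sub, h2, hCf, sub_self]
    have hg : ⟪f' - f, f' - f⟫_ℝ = 0 := by
      rw [inner_sub_left, hd _ hCg, K.inner_left_of_mem_orthogonal ((hmemK _).2 hCg) hfo, sub_zero]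
    have hff : f' = f := sub_eq_zero.1 (inner_self_eq_zero.1 hg)
    have hVV : V' = V := by
      ext ψ
      have := h1 (L ψ)
      rw [hL, hff] at this
      rw [← this, hV]
    rw [hff, hVV]

/-- The constrained problem in the closure of a subspace of a Hilbert sum `X ⊕ Y ⊕ Z`, where the form
is the inner product of the first two components and the constraint is the last component. -/
lemma existsUnique_constrained_closure {X Y Z : Type*}
    [NormedAddCommGroup X] [InnerProductSpace ℝ X] [CompleteSpace X]
    [NormedAddCommGroup Y] [InnerProductSpace ℝ Y] [CompleteSpace Y]
    [NormedAddCommGroup Z] [InnerProductSpace ℝ Z] [CompleteSpace Z]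
    (S : Submodule ℝ (WithLp 2 (X × WithLp 2 (Y × Z))))
    (L : Z →L[ℝ] WithLp 2 (X × WithLp 2 (Y × Z))) (hLS : ∀ x, L x ∈ S.topologicalClosure)
    (hL : ∀ x, (L x).snd.snd = x) (κ : Z) :
    ∃! p : S.topologicalClosure × (Z →L[ℝ] ℝ),
      (∀ φ : S.topologicalClosure, ⟪p.1.1.fst, φ.1.fst⟫_ℝ + ⟪p.1.1.snd.fst, φ.1.snd.fst⟫_ℝ =
        p.2 φ.1.snd.snd) ∧ p.1.1.snd.snd = κ := by
  let C : S.topologicalClosure →L[ℝ] Z :=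
    ((WithLp.sndL 2 ℝ Y Z).comp (WithLp.sndL 2 ℝ X (WithLp 2 (Y × Z)))).comp
      S.topologicalClosure.subtypeL
  have : CompleteSpace S.topologicalClosure := S.isClosed_topologicalClosure.completeSpace_coe
  let Lc : Z →L[ℝ] S.topologicalClosure := L.codRestrict S.topologicalClosure hLS
  have hLc : ∀ x, C (Lc x) = x := hL
  have h₀ := existsUnique_constrained (E := S.topologicalClosure) (F := Z) C
  have h₁ := h₀ Lc
  have h := h₁ hLc κ
  have e : ∀ f g : S.topologicalClosure, ⟪f, g⟫_ℝ - ⟪C f, C g⟫_ℝ =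
      ⟪f.1.fst, g.1.fst⟫_ℝ + ⟪f.1.snd.fst, g.1.snd.fst⟫_ℝ := fun f g => by
    have h1 : ⟪f, g⟫_ℝ = ⟪f.1.fst, g.1.fst⟫_ℝ + (⟪f.1.snd.fst, g.1.snd.fst⟫_ℝ +
      ⟪f.1.snd.snd, g.1.snd.snd⟫_ℝ) := rfl
    have h2 : ⟪C f, C g⟫_ℝ = ⟪f.1.snd.snd, g.1.snd.snd⟫_ℝ := rfl
    rw [h1, h2]
    ring
  simp only [e] at h
  exact h

section Propagation

variable {d : ℕ} {Γ : Set (Eucl d)} {m n A τ : ℝ → ℝ}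

lemma sigmaConst_pos : 0 < sigmaConst := by
  rw [sigmaConst, integral_sqrt_one_sub_sq]
  positivity

/-- The constraint map on the energy space as a bounded operator. -/
noncomputable def energyConstraintL (Γ : Set (Eucl d)) (m n A τ : ℝ → ℝ) :
    EnergySpace Γ m n A τ →L[ℝ] H1Surf Γ :=
  ((WithLp.sndL 2 ℝ (Lp (Eucl d) 2 (bulkMeasure Γ)) (H1Surf Γ)).comp
    (WithLp.sndL 2 ℝ (Lp ℝ 2 (bulkMeasure Γ))
      (WithLp 2 (Lp (Eucl d) 2 (bulkMeasure Γ) × H1Surf Γ)))).comp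
    (energySubmodule Γ m n A τ).subtypeL

lemma energyConstraintL_apply (f : EnergySpace Γ m n A τ) :
    energyConstraintL Γ m n A τ f = energyConstraint f := rfl

lemma energyForm_comm (f g : EnergySpace Γ m n A τ) : energyForm f g = energyForm g f := by
  rw [energyForm, energyForm, real_inner_comm, real_inner_comm g.1.snd.fst]

lemma energyForm_smul_left (a : ℝ) (f g : EnergySpace Γ m n A τ) :
    energyForm (a • f) g = a * energyForm f g := by
  have h1 : (a • f).1.fst = a • f.1.fst := rfl
  have h2 : (a • f).1.snd.fst = a • f.1.snd.fst := rfl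
  rw [energyForm, energyForm, h1, h2, real_inner_smul_left, real_inner_smul_left]
  ring

variable [IsFiniteMeasure (surfaceMeasure Γ)] {M g c : ℝ → ℝ}

lemma completeSpace_H1Surf (Γ : Set (Eucl d)) : CompleteSpace (H1Surf Γ) := by
  unfold H1Surf sobolevSubmodule
  infer_instance

theorem existsUnique_isConstrainedSolution (hD : IsTransversalData m n A τ M g c)
    (κ : H1Surf Γ) :
    ∃! p : EnergySpace Γ m n A τ × H1SurfDual Γ, IsConstrainedSolution Γ m n A τ κ p := by
  have := completeSpace_H1Surf Γ
  exact existsUnique_constrained_closure _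
    (separated 0 (contL2 (fun u => √(M u) * (1 / 2)) (hD.continuous_M.sqrt.mul continuous_const)) 1)
    (fun h => separated_const_mem hD h) (fun h : H1Surf Γ => one_smul ℝ h) (sigmaConst • κ)

lemma propagationOperator_spec (hD : IsTransversalData m n A τ M g c) (κ : H1Surf Γ) :
    ∃ f, IsConstrainedSolution Γ m n A τ κ (f, propagationOperator Γ m n A τ κ) := by
  obtain ⟨p, hp, -⟩ := existsUnique_isConstrainedSolution (Γ := Γ) hD κ
  have hex : ∃ p, IsConstrainedSolution Γ m n A τ κ p := ⟨p, hp⟩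
  refine ⟨hex.choose.1, ?_⟩
  rw [propagationOperator, dif_pos hex]
  exact hex.choose_spec

lemma propagationOperator_eq (hD : IsTransversalData m n A τ M g c) {κ : H1Surf Γ}
    {f : EnergySpace Γ m n A τ} {V : H1SurfDual Γ}
    (h : IsConstrainedSolution Γ m n A τ κ (f, V)) : propagationOperator Γ m n A τ κ = V := by
  obtain ⟨f', hf'⟩ := propagationOperator_spec (Γ := Γ) hD κ
  have := (existsUnique_isConstrainedSolution (Γ := Γ) hD κ).unique hf' h
  exact congrArg Prod.snd this

lemma propagationOperator_symm (hD : IsTransversalData m n A τ M g c) (κ κ' : H1Surf Γ) :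
    propagationOperator Γ m n A τ κ κ' = propagationOperator Γ m n A τ κ' κ := by
  obtain ⟨f, h1, h2⟩ := propagationOperator_spec (Γ := Γ) hD κ
  obtain ⟨f', h1', h2'⟩ := propagationOperator_spec (Γ := Γ) hD κ'
  have e1 := h1 f'
  have e2 := h1' f
  rw [energyForm_comm, e2, h2, h2', ContinuousLinearMap.map_smul, ContinuousLinearMap.map_smul]
    at e1
  exact (mul_left_cancel₀ sigmaConst_pos.ne' e1).symm

/-- The propagation operator acts on eigenfunctions as multiplication by the symbol. -/
lemma propagationOperator_eigen (hΓ : IsCompact Γ) (hD : IsTransversalData m n A τ M g c)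
    {μ : ℝ} {w z : ℝ → ℝ} (hprof : IsProfile M g c μ w z)
    (hℓ : 0 < profileConstraint M c w z) {h : H1Surf Γ}
    (heig : ∀ ψ : H1Surf Γ, ⟪h.grad, ψ.grad⟫_ℝ = μ ^ 2 * ⟪h.toL2, ψ.toL2⟫_ℝ) (ψ : H1Surf Γ) :
    propagationOperator Γ m n A τ h ψ =
      sigmaConst * (profileConstraint M c w z)⁻¹ * ⟪h.toL2, ψ.toL2⟫_ℝ := by
  have hp : Continuous fun u => √(M u) * z u := hD.continuous_M.sqrt.mul hprof.continuous_z
  have hq : Continuous fun u => √(M u) * w u := hD.continuous_M.sqrt.mul hprof.continuous_w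
  set ℓ := profileConstraint M c w z with hℓdef
  have hmem : separated (contL2 _ hp) (contL2 _ hq) ℓ h ∈ energySubmodule Γ m n A τ :=
    separated_mem_of_hasDerivAt hD hprof.continuous_z hprof.deriv_w hprof.continuous_w h
  let F : EnergySpace Γ m n A τ := ⟨_, hmem⟩
  let V : H1SurfDual Γ := (sigmaConst * ℓ⁻¹) • (innerSL ℝ h.toL2).comp (toL2L Γ)
  have hF : ∀ φ : EnergySpace Γ m n A τ,
      energyForm F φ = ⟪h.toL2, (energyConstraint φ).toL2⟫_ℝ := fun φ =>
    energy_eq_of_mem hΓ hD hprof heig (coeFn_contL2 hp) (coeFn_contL2 hq) φ.2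
  have hCF : energyConstraint F = ℓ • h := rfl
  have hsol : IsConstrainedSolution Γ m n A τ h ((sigmaConst * ℓ⁻¹) • F, V) := by
    refine ⟨fun φ => ?_, ?_⟩
    · simp only [energyForm_smul_left, hF]
      rfl
    · simp only
      rw [← energyConstraintL_apply, ContinuousLinearMap.map_smul, energyConstraintL_apply, hCF,
        smul_smul, mul_assoc, inv_mul_cancel₀ hℓ.ne', mul_one]
  rw [propagationOperator_eq hD hsol]
  rfl

lemma propagationOperator_of_grad_eq_zero (hD : IsTransversalData m n A τ M g c) {h : H1Surf Γ}
    (hh : h.grad = 0) : propagationOperator Γ m n A τ h = 0 := by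
  let F : EnergySpace Γ m n A τ := ⟨_, separated_const_mem hD h⟩
  have hF : ∀ φ : EnergySpace Γ m n A τ, energyForm F φ = 0 := fun φ => by
    rw [energyForm]
    change ⟪bulkTensor ℝ Γ 0 h.toL2, _⟫_ℝ + ⟪bulkTensor (Eucl d) Γ _ h.grad, _⟫_ℝ = 0
    rw [hh, ContinuousLinearMap.map_zero, ContinuousLinearMap.map_zero,
      zero_apply, inner_zero_left, inner_zero_left, add_zero]
  have hsol : IsConstrainedSolution Γ m n A τ h (sigmaConst • F, 0) := by
    refine ⟨fun φ => ?_, ?_⟩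
    · simp only [energyForm_smul_left, hF]
      simp
    · simp only
      rw [← energyConstraintL_apply, ContinuousLinearMap.map_smul, energyConstraintL_apply]
      congr 1
      exact one_smul ℝ h
  exact propagationOperator_eq hD hsol

/-- The propagation operator only sees the `L²(Γ)` part of its argument. The reason is that the
normalized profiles concentrate at the end points of the phase interval as the frequency tends to
infinity, so that the constraint can be met at vanishing tangential energy; no closability of the
tangential gradient is needed. -/
lemma propagationOperator_of_toL2_eq_zero (hD : IsTransversalData m n A τ M g c)
    {w z : ℝ → ℝ → ℝ} (hprof : ∀ μ, 0 < μ → IsProfile M g c μ (w μ) (z μ))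
    (hℓ : ∀ μ, 0 < μ → 0 < profileConstraint M c (w μ) (z μ))
    (hlim : Tendsto (fun μ => (profileConstraint M c (w μ) (z μ))⁻¹ / μ ^ 2) atTop (𝓝 0))
    {h : H1Surf Γ} (hh : h.toL2 = 0) : propagationOperator Γ m n A τ h = 0 := by
  have hM0 : ∀ u ∈ Icc (-1 : ℝ) 1, 0 ≤ M u := by
    have hcl : IsClosed {u | 0 ≤ M u} := isClosed_le continuous_const hD.continuous_M
    intro u hu
    rw [← closure_Ioo (by norm_num : (-1 : ℝ) ≠ 1)] at hu
    exact hcl.closure_subset_iff.2 (fun v hv => (hD.pos v hv).le) hu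
  set ℓ : ℕ → ℝ := fun j => profileConstraint M c (w (j + 1)) (z (j + 1)) with hℓdef
  have hpos : ∀ j : ℕ, (0 : ℝ) < (j : ℝ) + 1 := fun j => by positivity
  have hq : ∀ j : ℕ, Continuous fun u => √(M u) * w (j + 1) u := fun j =>
    hD.continuous_M.sqrt.mul (hprof _ (hpos j)).continuous_w
  have hp : ∀ j : ℕ, Continuous fun u => √(M u) * z (j + 1) u := fun j =>
    hD.continuous_M.sqrt.mul (hprof _ (hpos j)).continuous_z
  have hmem : ∀ j : ℕ, (ℓ j)⁻¹ • separated (contL2 _ (hp j)) (contL2 _ (hq j)) (ℓ j) h ∈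
      energySubmodule Γ m n A τ := fun j =>
    Submodule.smul_mem _ _ (separated_mem_of_hasDerivAt hD (hprof _ (hpos j)).continuous_z
      (hprof _ (hpos j)).deriv_w (hprof _ (hpos j)).continuous_w h)
  have heq : ∀ j : ℕ, (ℓ j)⁻¹ • separated (contL2 _ (hp j)) (contL2 _ (hq j)) (ℓ j) h =
      separated 0 ((ℓ j)⁻¹ • contL2 _ (hq j)) 1 h := fun j => by
    rw [separated_eq, separated_eq, hh, ContinuousLinearMap.map_zero, ContinuousLinearMap.map_zero,
      ContinuousLinearMap.map_smul, smul_apply, ← WithLp.toLp_smul,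
      Prod.smul_mk, ← WithLp.toLp_smul, Prod.smul_mk, smul_zero, smul_smul,
      inv_mul_cancel₀ (hℓ _ (hpos j)).ne']
  have hnorm : ∀ j : ℕ, ‖(ℓ j)⁻¹ • contL2 _ (hq j)‖ ^ 2 ≤ (ℓ j)⁻¹ / ((j : ℝ) + 1) ^ 2 := fun j => by
    have hP := hprof _ (hpos j)
    have hcw := hP.continuous_w
    have hcz := hP.continuous_z
    have hcM := hD.continuous_M
    have e1 : ‖contL2 _ (hq j)‖ ^ 2 = ∫ u in (-1 : ℝ)..1, M u * w (j + 1) u ^ 2 := by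
      rw [L2_norm_sq_eq_integral, ← integral_phaseMeasure]
      refine integral_congr_ae ?_
      filter_upwards [coeFn_contL2 (hq j), ae_phaseMeasure_Ioo] with u h1 h2
      rw [h1, Real.norm_eq_abs, sq_abs, mul_pow, Real.sq_sqrt (hD.pos u h2).le]
    have e2 : ((j : ℝ) + 1) ^ 2 * ∫ u in (-1 : ℝ)..1, M u * w (j + 1) u ^ 2 ≤ ℓ j := by
      change _ ≤ profileConstraint M c (w (j + 1)) (z (j + 1))
      rw [← hP.energy_eq hcM hD.hasDerivAt_c, ← intervalIntegral.integral_const_mul]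
      refine intervalIntegral.integral_mono_on (by norm_num)
        (Continuous.intervalIntegrable (by fun_prop) _ _)
        (Continuous.intervalIntegrable (by fun_prop) _ _) fun u hu => ?_
      have := hM0 u hu
      have : 0 ≤ M u * z (j + 1) u ^ 2 := by positivity
      linarith
    have hj : 0 < ((j : ℝ) + 1) ^ 2 := by positivity
    have hℓj : 0 < ℓ j := hℓ _ (hpos j)
    rw [norm_smul, mul_pow, e1, Real.norm_eq_abs, abs_of_pos (inv_pos.2 hℓj), le_div_iff₀ hj]
    have e3 := mul_le_mul_of_nonneg_left e2 (sq_nonneg (ℓ j)⁻¹)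
    calc _ = (ℓ j)⁻¹ ^ 2 * (((j : ℝ) + 1) ^ 2 * ∫ u in (-1 : ℝ)..1, M u * w (j + 1) u ^ 2) := by
          ring
      _ ≤ (ℓ j)⁻¹ ^ 2 * ℓ j := e3
      _ = (ℓ j)⁻¹ := by field_simp
  have hqt : Tendsto (fun j : ℕ => (ℓ j)⁻¹ • contL2 _ (hq j)) atTop (𝓝 0) := by
    rw [tendsto_zero_iff_norm_tendsto_zero]
    have h1 : Tendsto (fun j : ℕ => (ℓ j)⁻¹ / ((j : ℝ) + 1) ^ 2) atTop (𝓝 0) :=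
      hlim.comp (tendsto_natCast_atTop_atTop.atTop_add tendsto_const_nhds)
    have h2 := (squeeze_zero (fun j => sq_nonneg _) hnorm h1).sqrt
    simpa using h2
  have hmem0 : separated 0 0 1 h ∈ energySubmodule Γ m n A τ := by
    have hlim2 := ((continuous_separated h).tendsto (0, 0, 1)).comp
      ((tendsto_const_nhds (x := (0 : Lp ℝ 2 phaseMeasure))).prodMk_nhds
        (hqt.prodMk_nhds (tendsto_const_nhds (x := (1 : ℝ)))))
    refine (Submodule.isClosed_topologicalClosure _).mem_of_tendsto hlim2
      (Eventually.of_forall fun j => ?_)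
    have := hmem j
    rw [heq j] at this
    exact this
  let F : EnergySpace Γ m n A τ := ⟨_, hmem0⟩
  have hF : ∀ φ : EnergySpace Γ m n A τ, energyForm F φ = 0 := fun φ => by
    rw [energyForm]
    change ⟪bulkTensor ℝ Γ 0 h.toL2, _⟫_ℝ + ⟪bulkTensor (Eucl d) Γ 0 h.grad, _⟫_ℝ = 0
    rw [ContinuousLinearMap.map_zero, ContinuousLinearMap.map_zero,
      zero_apply, zero_apply, inner_zero_left,
      inner_zero_left, add_zero]
  have hsol : IsConstrainedSolution Γ m n A τ h (sigmaConst • F, 0) := by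
    refine ⟨fun φ => ?_, ?_⟩
    · simp only [energyForm_smul_left, hF]
      simp
    · simp only
      rw [← energyConstraintL_apply, ContinuousLinearMap.map_smul, energyConstraintL_apply]
      congr 1
      exact one_smul ℝ h
  exact propagationOperator_eq hD hsol

end Propagation

/-! ### The coefficient functions -/

section Coefficients

variable {i : ℕ} {m n A τ : ℝ → ℝ}

/-- The nearest point of `[-1, 1]`; composing with it extends a function continuously from
`[-1, 1]` to the line. -/
noncomputable def phaseClamp (u : ℝ) : ℝ := projIcc (-1 : ℝ) 1 (by norm_num) u

lemma phaseClamp_mem (u : ℝ) : phaseClamp u ∈ Icc (-1 : ℝ) 1 := (projIcc _ _ _ u).2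

lemma phaseClamp_of_mem {u : ℝ} (hu : u ∈ Icc (-1 : ℝ) 1) : phaseClamp u = u := by
  rw [phaseClamp, projIcc_of_mem _ hu]

lemma continuous_phaseClamp : Continuous phaseClamp := continuous_subtype_val.comp continuous_projIcc

lemma one_sub_sq_pos_of_mem_Ioo {u : ℝ} (hu : u ∈ Ioo (-1 : ℝ) 1) : 0 < 1 - u ^ 2 := by
  nlinarith [hu.1, hu.2]

lemma dPhase_eq_deriv {u : ℝ} (hu : u ∈ Ioo (-1 : ℝ) 1) : dPhase n u = deriv n u :=
  derivWithin_of_mem_nhds (Icc_mem_nhds hu.1 hu.2)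

lemma CoefficientHypotheses.contDiffOn_quotC (h : CoefficientHypotheses i m n A τ) :
    ContDiffOn ℝ ∞ (quotC n) phaseInterval := by
  have hU : UniqueDiffOn ℝ phaseInterval := uniqueDiffOn_Icc (by norm_num)
  exact h.smooth_n.div (h.smooth_n.derivWithin hU (by simp)) h.deriv_ne_zero

/-- `n` cannot vanish at both end points, by Rolle's theorem. -/
lemma CoefficientHypotheses.quotC_sq_pos (h : CoefficientHypotheses i m n A τ) :
    0 < quotC n 1 ^ 2 + quotC n (-1) ^ 2 := by
  have h1 : (1 : ℝ) ∈ phaseInterval := by norm_num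
  have h2 : (-1 : ℝ) ∈ phaseInterval := by norm_num
  by_contra hcon
  have e1 : quotC n 1 = 0 := by nlinarith [sq_nonneg (quotC n 1), sq_nonneg (quotC n (-1))]
  have e2 : quotC n (-1) = 0 := by nlinarith [sq_nonneg (quotC n 1), sq_nonneg (quotC n (-1))]
  have n1 : n 1 = 0 := (div_eq_zero_iff.1 e1).resolve_right (h.deriv_ne_zero 1 h1)
  have n2 : n (-1) = 0 := (div_eq_zero_iff.1 e2).resolve_right (h.deriv_ne_zero (-1) h2)
  obtain ⟨x, hx, hx0⟩ := exists_deriv_eq_zero (by norm_num : (-1 : ℝ) < 1)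
    h.smooth_n.continuousOn (n2.trans n1.symm)
  exact h.deriv_ne_zero x (Ioo_subset_Icc_self hx) ((dPhase_eq_deriv hx).trans hx0)

lemma IsAffineCoupling.derivWithin_quotC (ha : IsAffineCoupling n)
    (hn : ∀ u ∈ phaseInterval, dPhase n u ≠ 0) {u : ℝ} (hu : u ∈ phaseInterval) :
    derivWithin (quotC n) phaseInterval u = 1 := by
  obtain ⟨b, a, hab⟩ := ha
  have hU : UniqueDiffOn ℝ phaseInterval := uniqueDiffOn_Icc (by norm_num)
  have hd : ∀ v ∈ phaseInterval, dPhase n v = a := fun v hv => by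
    have h1 : HasDerivAt (fun u => b + a * (u + 1)) a v := by
      simpa using (((hasDerivAt_id v).add_const 1).const_mul a).const_add b
    exact (h1.hasDerivWithinAt.congr hab (hab v hv)).derivWithin (hU v hv)
  have ha0 : a ≠ 0 := hd u hu ▸ hn u hu
  have hq : ∀ v ∈ phaseInterval, quotC n v = b / a + (v + 1) := fun v hv => by
    rw [quotC, hd v hv, hab v hv]
    field_simp
  have h1 : HasDerivAt (fun v => b / a + (v + 1)) 1 u := by
    simpa using ((hasDerivAt_id u).add_const 1).const_add (b / a)
  exact (h1.hasDerivWithinAt.congr hq (hq u hu)).derivWithin (hU u hu)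

/-- The hypotheses on the coefficients, together with `a m = 1`, provide the data of the transversal
equation: `𝗆` is continuous and vanishes at most like `(1 - u²)^{i - 1/2}` at `±1`, and
`1 - (n / n')'` is continuous, and zero if `n` is affine. -/
lemma CoefficientHypotheses.exists_transversalData (h : CoefficientHypotheses i m n A τ)
    (ham : ∀ u ∈ Ioo (-1 : ℝ) 1, coeffA n A τ u * m u = 1) :
    ∃ M g c : ℝ → ℝ, IsTransversalData m n A τ M g c ∧
      (∃ κ : ℝ, 0 < κ ∧
        ∀ u ∈ Icc (-1 : ℝ) 1, κ * ((1 - u ^ 2) ^ (i - 1) * √(1 - u ^ 2)) ≤ M u) ∧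
      (IsAffineCoupling n → ∀ u ∈ Icc (-1 : ℝ) 1, g u = 0) := by
  obtain ⟨mt, hmt, hmt0, hm⟩ := h.mobility
  have hU : UniqueDiffOn ℝ phaseInterval := uniqueDiffOn_Icc (by norm_num)
  set M₀ : ℝ → ℝ := fun u => (1 - u ^ 2) ^ (i - 1) * √(1 - u ^ 2) * mt u with hM₀
  set g : ℝ → ℝ := fun u => 1 - derivWithin (quotC n) phaseInterval (phaseClamp u) with hg
  have hgc : Continuous g := by
    have h1 : ContinuousOn (derivWithin (quotC n) phaseInterval) phaseInterval :=
      h.contDiffOn_quotC.continuousOn_derivWithin hU (by simp)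
    exact continuous_const.sub (h1.comp_continuous continuous_phaseClamp phaseClamp_mem)
  set c : ℝ → ℝ := fun u => quotC n (-1) + ∫ v in (-1 : ℝ)..u, (1 - g v) with hc
  have hgc' : Continuous fun v => 1 - g v := continuous_const.sub hgc
  have hM₀pos : ∀ u ∈ Ioo (-1 : ℝ) 1, 0 < M₀ u := fun u hu => by
    have h1 := one_sub_sq_pos_of_mem_Ioo hu
    have h2 := hmt0 u (Ioo_subset_Icc_self hu)
    positivity
  have hw : ∀ u ∈ Icc (-1 : ℝ) 1, weightM m u = M₀ u := fun u hu => by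
    have h0 : 0 ≤ 1 - u ^ 2 := by nlinarith [hu.1, hu.2]
    rw [weightM, hm u hu, hM₀]
    rcases h0.eq_or_lt with h1 | h1
    · simp [← h1]
    · have h2 : 0 < √(1 - u ^ 2) := Real.sqrt_pos.2 h1
      rw [div_eq_iff h2.ne']
      obtain ⟨j, rfl⟩ : ∃ j, i = j + 1 := ⟨i - 1, (Nat.sub_add_cancel h.one_le).symm⟩
      rw [pow_succ, Nat.add_sub_cancel]
      linear_combination (-(1 - u ^ 2) ^ j * mt u) * Real.sq_sqrt h0
  have hext : ∀ u ∈ Icc (-1 : ℝ) 1, M₀ (phaseClamp u) = M₀ u := fun u hu => by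
    rw [phaseClamp_of_mem hu]
  refine ⟨fun u => M₀ (phaseClamp u), g, c, ⟨?_, hgc, ?_, ?_, ?_, ?_, ?_, ?_⟩, ?_, ?_⟩
  · have h1 : ContinuousOn M₀ (Icc (-1) 1) := by
      have h2 : ContinuousOn mt (Icc (-1) 1) := hmt.continuousOn
      fun_prop
    exact h1.comp_continuous continuous_phaseClamp phaseClamp_mem
  · have h1 : ContDiffOn ℝ ∞ M₀ (Ioo (-1) 1) := by
      have h2 : ContDiffOn ℝ ∞ mt (Ioo (-1) 1) := hmt.mono Ioo_subset_Icc_self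
      have h3 : ContDiffOn ℝ ∞ (fun u : ℝ => 1 - u ^ 2) (Ioo (-1) 1) := by fun_prop
      exact ((h3.pow _).mul (h3.sqrt fun u hu => (one_sub_sq_pos_of_mem_Ioo hu).ne')).mul h2
    exact h1.congr fun u hu => hext u (Ioo_subset_Icc_self hu)
  · intro u hu
    rw [hext u hu, hw u hu]
  · intro u hu
    rw [hext u (Ioo_subset_Icc_self hu)]
    exact hM₀pos u hu
  · intro u hu
    have h1 := one_sub_sq_pos_of_mem_Ioo hu
    have h2 : 0 < √(1 - u ^ 2) := Real.sqrt_pos.2 h1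
    have h3 := ham u hu
    rw [hext u (Ioo_subset_Icc_self hu), ← hw u (Ioo_subset_Icc_self hu)]
    refine eq_inv_of_mul_eq_one_left ?_
    rw [← h3, weightA, weightM, coeffA]
    have h4 : (1 : ℝ) / √(1 - u ^ 2) * (1 / √(1 - u ^ 2)) = 1 / (1 - u ^ 2) := by
      rw [div_mul_div_comm, Real.mul_self_sqrt h1.le, one_mul]
    rw [← h4]
    ring
  · intro u hu
    have h1 : ∫ v in (-1 : ℝ)..u, (1 - g v) = quotC n u - quotC n (-1) := by
      refine intervalIntegral.integral_eq_sub_of_hasDerivAt_of_le hu.1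
        (h.contDiffOn_quotC.continuousOn.mono (Icc_subset_Icc_right hu.2)) (fun v hv => ?_)
        (hgc'.intervalIntegrable _ _)
      have hv' : v ∈ Icc (-1 : ℝ) 1 := ⟨hv.1.le, hv.2.le.trans hu.2⟩
      have hnhds : phaseInterval ∈ 𝓝 v := Icc_mem_nhds hv.1 (hv.2.trans_le hu.2)
      have h2 : DifferentiableAt ℝ (quotC n) v :=
        (h.contDiffOn_quotC.differentiableOn (by simp) v hv').differentiableAt hnhds
      have h3 : 1 - g v = deriv (quotC n) v := by
        rw [hg]
        simp only
        rw [phaseClamp_of_mem hv', derivWithin_of_mem_nhds hnhds]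
        ring
      rw [h3]
      exact h2.hasDerivAt
    rw [hc]
    simp only
    rw [h1]
    ring
  · intro u
    exact (intervalIntegral.integral_hasDerivAt_right (hgc'.intervalIntegrable _ _)
      hgc'.stronglyMeasurable.stronglyMeasurableAtFilter hgc'.continuousAt).const_add _
  · obtain ⟨u₀, hu₀, hmin⟩ := isCompact_Icc.exists_isMinOn
      (nonempty_Icc.2 (by norm_num : (-1 : ℝ) ≤ 1)) hmt.continuousOn
    refine ⟨mt u₀, hmt0 u₀ hu₀, fun u hu => ?_⟩
    refine le_of_le_of_eq ?_ (hext u hu).symm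
    rw [hM₀, mul_comm]
    have h0 : 0 ≤ 1 - u ^ 2 := by nlinarith [hu.1, hu.2]
    exact mul_le_mul_of_nonneg_left (hmin hu) (by positivity)
  · intro ha u hu
    rw [hg]
    simp only
    rw [ha.derivWithin_quotC h.deriv_ne_zero (phaseClamp_mem u), sub_self]

end Coefficients

/-- A symbol `b μ + R μ` with `R μ = O(μ)` at infinity is `o(μ²)`. -/
lemma tendsto_symbol_div_sq {i : ℕ} {b C : ℝ} {R ℓ : ℝ → ℝ}
    (hR : ∀ l : ℝ, 0 < l → |R (√l)| ≤ C * l ^ ((1 : ℝ) / 2 - 1 / (2 * i + 1)))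
    (hℓ : ∀ μ, 0 < μ → ℓ μ = b * μ + R μ) :
    Tendsto (fun μ => ℓ μ / μ ^ 2) atTop (𝓝 0) := by
  have hb : ∀ μ : ℝ, 1 ≤ μ → |ℓ μ / μ ^ 2| ≤ (|b| + |C|) * μ⁻¹ := fun μ hμ => by
    have hμ0 : 0 < μ := by linarith
    have h1 := hR (μ ^ 2) (by positivity)
    rw [Real.sqrt_sq hμ0.le] at h1
    have h2 : (μ ^ 2) ^ ((1 : ℝ) / 2 - 1 / (2 * i + 1)) ≤ μ := by
      calc (μ ^ 2) ^ ((1 : ℝ) / 2 - 1 / (2 * i + 1)) ≤ (μ ^ 2) ^ ((1 : ℝ) / 2) := by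
            refine Real.rpow_le_rpow_of_exponent_le (one_le_pow₀ hμ) ?_
            have : (0 : ℝ) ≤ 1 / (2 * i + 1) := by positivity
            linarith
        _ = μ := by rw [← Real.sqrt_eq_rpow, Real.sqrt_sq hμ0.le]
    have h3 : |R μ| ≤ |C| * μ := by
      refine h1.trans ((mul_le_mul_of_nonneg_right (le_abs_self C) (by positivity)).trans ?_)
      exact mul_le_mul_of_nonneg_left h2 (abs_nonneg C)
    have h4 : |ℓ μ| ≤ (|b| + |C|) * μ := by
      rw [hℓ μ hμ0]
      refine (abs_add_le _ _).trans ?_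
      rw [abs_mul, abs_of_pos hμ0]
      linarith
    rw [abs_div, abs_of_pos (by positivity : 0 < μ ^ 2), div_le_iff₀ (by positivity)]
    refine h4.trans (le_of_eq ?_)
    field_simp
  have h0 : Tendsto (fun μ : ℝ => (|b| + |C|) * μ⁻¹) atTop (𝓝 0) := by
    simpa using tendsto_inv_atTop_zero.const_mul (|b| + |C|)
  refine squeeze_zero_norm' ?_ h0
  filter_upwards [eventually_ge_atTop 1] with μ hμ
  exact hb μ hμ

/-! ### Spectral calculus -/

lemma ContinuousLinearMap.exists_toDual {E : Type*} [NormedAddCommGroup E] [InnerProductSpace ℝ E]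
    (T : E →L[ℝ] E) : ∃ S : E →L[ℝ] E →L[ℝ] ℝ, ∀ h ψ, S h ψ = ⟪T h, ψ⟫_ℝ :=
  ⟨(innerSL ℝ).comp T, fun _ _ => rfl⟩

section Spectral

variable {d : ℕ} {Γ : Set (Eucl d)} {e : ℕ → H1Surf Γ} {lam : ℕ → ℝ}

lemma inner_H1Surf (h k : H1Surf Γ) : ⟪h, k⟫_ℝ = ⟪h.toL2, k.toL2⟫_ℝ + ⟪h.grad, k.grad⟫_ℝ := rfl

namespace IsLaplaceEigenbasis

lemma lam_nonneg (he : IsLaplaceEigenbasis Γ e lam) (k : ℕ) : 0 ≤ lam k := by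
  have h1 := he.eigen k (e k)
  have h2 : ⟪(e k).toL2, (e k).toL2⟫_ℝ = 1 := by
    rw [real_inner_self_eq_norm_sq, he.orthonormal.1 k, one_pow]
  rw [h2, mul_one] at h1
  rw [← h1]
  exact real_inner_self_nonneg

lemma grad_eq_zero (he : IsLaplaceEigenbasis Γ e lam) {k : ℕ} (hk : lam k = 0) :
    (e k).grad = 0 := by
  have h1 := he.eigen k (e k)
  rw [hk, zero_mul] at h1
  exact inner_self_eq_zero.1 h1

/-- The eigenfunctions are orthogonal in `H¹(Γ)` as well; these are their normalisations. -/
noncomputable def normalized (e : ℕ → H1Surf Γ) (lam : ℕ → ℝ) (k : ℕ) : H1Surf Γ :=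
  (√(1 + lam k))⁻¹ • e k

lemma inner_normalized (he : IsLaplaceEigenbasis Γ e lam) (k : ℕ) (h : H1Surf Γ) :
    ⟪normalized e lam k, h⟫_ℝ = √(1 + lam k) * ⟪(e k).toL2, h.toL2⟫_ℝ := by
  have h0 : 0 < 1 + lam k := by linarith [he.lam_nonneg k]
  have h1 : 0 < √(1 + lam k) := Real.sqrt_pos.2 h0
  have h2 : ⟪normalized e lam k, h⟫_ℝ = (√(1 + lam k))⁻¹ * ⟪e k, h⟫_ℝ :=
    real_inner_smul_left (e k) h _
  rw [h2, inner_H1Surf, he.eigen, inv_mul_eq_iff_eq_mul₀ h1.ne']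
  linear_combination (-⟪(e k).toL2, h.toL2⟫_ℝ) * Real.sq_sqrt h0.le

lemma orthonormal_normalized (he : IsLaplaceEigenbasis Γ e lam) :
    Orthonormal ℝ (normalized e lam) := by
  rw [orthonormal_iff_ite]
  intro j k
  have h0 : 0 < √(1 + lam k) := Real.sqrt_pos.2 (by linarith [he.lam_nonneg k])
  have h1 := orthonormal_iff_ite.1 he.orthonormal j k
  have h2 : (normalized e lam k).toL2 = (√(1 + lam k))⁻¹ • (e k).toL2 := rfl
  rw [he.inner_normalized, h2, real_inner_smul_right, h1]
  split_ifs with hjk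
  · rw [hjk, mul_one, mul_inv_cancel₀ h0.ne']
  · simp

/-- Functions of `√(-Δ_Γ)` whose symbol grows at most linearly in the eigenvalue are bounded from
`H¹(Γ)` to its dual. -/
lemma exists_isFunction (he : IsLaplaceEigenbasis Γ e lam) {φ : ℝ → ℝ} {B : ℝ}
    (hφ : ∀ k, |φ (√(lam k))| ≤ B * (1 + lam k)) :
    ∃ S : H1Surf Γ →L[ℝ] H1SurfDual Γ, IsFunctionOfSqrtLaplacian e lam φ S := by
  have := completeSpace_H1Surf Γ
  have hpos : ∀ k, 0 < 1 + lam k := fun k => by linarith [he.lam_nonneg k]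
  obtain ⟨T, hT⟩ := he.orthonormal_normalized.exists_diagonal
    (b := fun k => φ (√(lam k)) / (1 + lam k)) (B := B) fun k => by
      rw [abs_div, abs_of_pos (hpos k), div_le_iff₀ (hpos k)]
      exact hφ k
  obtain ⟨S, hS⟩ := T.exists_toDual
  refine ⟨S, fun h ψ => ?_⟩
  rw [hS]
  convert hT h ψ using 2 with k
  rw [he.inner_normalized, he.inner_normalized]
  have h1 := (hpos k).ne'
  have h2 := Real.sq_sqrt (hpos k).le
  field_simp
  linear_combination (-φ (√(lam k)) * ⟪(e k).toL2, h.toL2⟫_ℝ * ⟪(e k).toL2, ψ.toL2⟫_ℝ) * h2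

lemma isFunction_apply_eigen (he : IsLaplaceEigenbasis Γ e lam) {φ : ℝ → ℝ}
    {S : H1Surf Γ →L[ℝ] H1SurfDual Γ} (hS : IsFunctionOfSqrtLaplacian e lam φ S) (h : H1Surf Γ)
    (k : ℕ) : S h (e k) = φ (√(lam k)) * ⟪(e k).toL2, h.toL2⟫_ℝ := by
  refine (hS h (e k)).unique ?_
  have h1 := orthonormal_iff_ite.1 he.orthonormal
  convert hasSum_single k (f := fun j => φ (√(lam j)) * ⟪(e j).toL2, h.toL2⟫_ℝ *
    ⟪(e j).toL2, (e k).toL2⟫_ℝ) fun j hj => by rw [h1, if_neg hj, mul_zero] using 1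
  rw [h1, if_pos rfl, mul_one]

/-- A symbol of size `O(λ^{r/2})` vanishing at `0` defines an operator of order `r`. -/
lemma hasOrderAtMost (he : IsLaplaceEigenbasis Γ e lam) {R : ℝ → ℝ} {C p r : ℝ} (hr : 2 * p = r)
    (hR0 : R 0 = 0) (hR : ∀ l : ℝ, 0 < l → |R (√l)| ≤ C * l ^ p)
    {Q : H1Surf Γ →L[ℝ] H1SurfDual Γ} (hQ : IsFunctionOfSqrtLaplacian e lam R Q) :
    HasOrderAtMost e lam r Q := by
  intro s
  refine ⟨(C ^ 2).toNNReal, fun h => ?_⟩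
  rw [← ENNReal.tsum_mul_left]
  refine ENNReal.tsum_le_tsum fun k => ?_
  rw [he.isFunction_apply_eigen hQ]
  rcases (he.lam_nonneg k).eq_or_lt with h0 | h0
  · rw [← h0, Real.sqrt_zero, hR0]
    simp
  · rw [← ENNReal.ofReal, ← ENNReal.ofReal_mul (sq_nonneg C)]
    refine ENNReal.ofReal_le_ofReal ?_
    have h1 : R (√(lam k)) ^ 2 ≤ C ^ 2 * lam k ^ r := by
      have h2 := pow_le_pow_left₀ (abs_nonneg _) (hR _ h0) 2
      rw [sq_abs, mul_pow, ← Real.rpow_natCast (lam k ^ p), ← Real.rpow_mul h0.le] at h2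
      rwa [← hr, mul_comm 2 p]
    have h3 : lam k ^ s = lam k ^ (s - r) * lam k ^ r := by
      rw [← Real.rpow_add h0, sub_add_cancel]
    rw [h3, mul_pow]
    calc lam k ^ (s - r) * (R (√(lam k)) ^ 2 * ⟪(e k).toL2, h.toL2⟫_ℝ ^ 2)
        ≤ lam k ^ (s - r) * ((C ^ 2 * lam k ^ r) * ⟪(e k).toL2, h.toL2⟫_ℝ ^ 2) := by gcongr
      _ = _ := by ring

/-- A bounded symbol defines a bounded operator on `L²(Γ)`. -/
lemma exists_bounded (he : IsLaplaceEigenbasis Γ e lam) {R : ℝ → ℝ} {B : ℝ}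
    (hR : ∀ μ, 0 ≤ μ → |R μ| ≤ B) {Q : H1Surf Γ →L[ℝ] H1SurfDual Γ}
    (hQ : IsFunctionOfSqrtLaplacian e lam R Q) :
    ∃ T : L2Surf Γ →L[ℝ] L2Surf Γ, ∀ h ψ : H1Surf Γ, Q h ψ = ⟪T h.toL2, ψ.toL2⟫_ℝ := by
  obtain ⟨T, hT⟩ := he.orthonormal.exists_diagonal (b := fun k => R (√(lam k))) (B := B)
    fun k => hR _ (Real.sqrt_nonneg _)
  exact ⟨T, fun h ψ => (hQ h ψ).unique (hT h.toL2 ψ.toL2)⟩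

end IsLaplaceEigenbasis

section Diagonalization

variable [IsFiniteMeasure (surfaceMeasure Γ)]

lemma exists_const_H1Surf (Γ : Set (Eucl d)) [IsFiniteMeasure (surfaceMeasure Γ)] :
    ∃ o : H1Surf Γ, o.toL2 =ᵐ[surfaceMeasure Γ] (fun _ => (1 : ℝ)) ∧ o.grad = 0 := by
  have h1 : MemLp (fun _ : Eucl d => (1 : ℝ)) 2 (surfaceMeasure Γ) := memLp_const 1
  have hmem : WithLp.toLp 2 (h1.toLp _, (0 : L2SurfVec Γ)) ∈ sobolevSubmodule Γ := by
    refine Submodule.le_topologicalClosure _ (Submodule.subset_span ?_)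
    refine ⟨fun _ => 1, contDiff_const, h1.coeFn_toLp, ?_⟩
    refine (Lp.coeFn_zero _ _ _).trans (Eventually.of_forall fun x => ?_)
    have h2 : gradient (fun _ : Eucl d => (1 : ℝ)) x = 0 := by simp [gradient]
    rw [surfaceGradient, h2, map_zero]
    rfl
  exact ⟨⟨_, hmem⟩, h1.coeFn_toLp, rfl⟩

/-- A function in `H¹(Γ)` orthogonal to the eigenfunctions is constant, up to the component of zero
in `L²(Γ)`. -/
lemma IsLaplaceEigenbasis.exists_add_of_orthogonal (he : IsLaplaceEigenbasis Γ e lam)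
    {x : H1Surf Γ} (hx : ∀ k, ⟪(e k).toL2, x.toL2⟫_ℝ = 0) :
    ∃ y o : H1Surf Γ, x = y + o ∧ y.toL2 = 0 ∧ o.grad = 0 := by
  obtain ⟨o, ho, hog⟩ := exists_const_H1Surf Γ
  set a : ℝ := (∫ t, x.toL2 t ∂(surfaceMeasure Γ)) / (surfaceMeasure Γ).real univ with ha
  have hmean : a * (surfaceMeasure Γ).real univ = ∫ t, x.toL2 t ∂(surfaceMeasure Γ) := by
    by_cases h0 : (surfaceMeasure Γ).real univ = 0
    · have : surfaceMeasure Γ = 0 := by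
        rw [← Measure.measure_univ_eq_zero]
        exact (measureReal_eq_zero_iff (measure_ne_top _ _)).1 h0
      rw [h0, mul_zero]
      refine (integral_eq_zero_of_ae ?_).symm
      rw [EventuallyEq, ae_eq_bot.2 this]
      exact eventually_bot
    · rw [ha, div_mul_cancel₀ _ h0]
  have hyL : (x - a • o).toL2 = x.toL2 - a • o.toL2 := rfl
  refine ⟨x - a • o, a • o, (sub_add_cancel _ _).symm, ?_, ?_⟩
  · have hae : ⇑(x - a • o).toL2 =ᵐ[surfaceMeasure Γ] fun t => x.toL2 t - a := by
      rw [hyL]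
      filter_upwards [Lp.coeFn_sub x.toL2 (a • o.toL2), Lp.coeFn_smul a o.toL2, ho] with t h1 h2 h3
      rw [h1, Pi.sub_apply, h2, Pi.smul_apply, h3, smul_eq_mul, mul_one]
    refine he.complete _ ?_ fun k => ?_
    · rw [integral_congr_ae hae, integral_sub ((Lp.memLp x.toL2).integrable (by norm_num))
        (integrable_const a), integral_const, ← hmean, smul_eq_mul]
      ring
    · have h1 : ⟪(e k).toL2, o.toL2⟫_ℝ = 0 := by
        rw [L2.inner_def, ← he.mean_zero k]
        refine integral_congr_ae ?_
        filter_upwards [ho] with t ht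
        rw [ht]
        simp
      rw [hyL, inner_sub_right, real_inner_smul_right, hx, h1]
      ring
  · change a • o.grad = 0
    rw [hog, smul_zero]

variable {m n A τ M g c : ℝ → ℝ}

/-- The propagation operator is diagonal in the eigenbasis: it is symmetric, it is given by the
symbol on the eigenfunctions, and it vanishes on what is orthogonal to all of them. -/
lemma propagationOperator_hasSum (he : IsLaplaceEigenbasis Γ e lam) (hΓ : IsCompact Γ)
    (hD : IsTransversalData m n A τ M g c) {w z : ℝ → ℝ → ℝ}
    (hprof : ∀ μ, 0 < μ → IsProfile M g c μ (w μ) (z μ))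
    (hℓ : ∀ μ, 0 < μ → 0 < profileConstraint M c (w μ) (z μ))
    (hlim : Tendsto (fun μ => (profileConstraint M c (w μ) (z μ))⁻¹ / μ ^ 2) atTop (𝓝 0))
    {φ : ℝ → ℝ} (hφ0 : φ 0 = 0)
    (hφ : ∀ μ, 0 < μ → (profileConstraint M c (w μ) (z μ))⁻¹ = φ μ) (κ ψ : H1Surf Γ) :
    HasSum (fun k => sigmaConst *
      (φ (√(lam k)) * ⟪(e k).toL2, κ.toL2⟫_ℝ * ⟪(e k).toL2, ψ.toL2⟫_ℝ))
      (propagationOperator Γ m n A τ κ ψ) := by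
  have := completeSpace_H1Surf Γ
  have heig : ∀ k (ψ : H1Surf Γ), propagationOperator Γ m n A τ (e k) ψ =
      sigmaConst * φ (√(lam k)) * ⟪(e k).toL2, ψ.toL2⟫_ℝ := fun k ψ => by
    rcases (he.lam_nonneg k).eq_or_lt with h0 | h0
    · rw [propagationOperator_of_grad_eq_zero hD (he.grad_eq_zero h0.symm), ← h0, Real.sqrt_zero,
        hφ0, zero_apply]
      ring
    · have hμ : 0 < √(lam k) := Real.sqrt_pos.2 h0
      rw [propagationOperator_eigen hΓ hD (hprof _ hμ) (hℓ _ hμ) (fun ψ => ?_), hφ _ hμ]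
      rw [he.eigen, Real.sq_sqrt h0.le]
  have hker : ∀ x : H1Surf Γ, (∀ k, ⟪IsLaplaceEigenbasis.normalized e lam k, x⟫_ℝ = 0) →
      propagationOperator Γ m n A τ κ x = 0 := fun x hx => by
    have hx' : ∀ k, ⟪(e k).toL2, x.toL2⟫_ℝ = 0 := fun k => by
      have h1 := hx k
      rw [he.inner_normalized] at h1
      exact (mul_eq_zero.1 h1).resolve_left
        (Real.sqrt_pos.2 (by linarith [he.lam_nonneg k])).ne'
    obtain ⟨y, o, rfl, hy, ho⟩ := he.exists_add_of_orthogonal hx'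
    rw [ContinuousLinearMap.map_add, propagationOperator_symm hD κ y,
      propagationOperator_symm hD κ o,
      propagationOperator_of_toL2_eq_zero hD hprof hℓ hlim hy,
      propagationOperator_of_grad_eq_zero hD ho, zero_apply, add_zero]
  convert he.orthonormal_normalized.hasSum_functional (propagationOperator Γ m n A τ κ) hker ψ
    using 2 with k
  have h0 : 0 < √(1 + lam k) := Real.sqrt_pos.2 (by linarith [he.lam_nonneg k])
  rw [he.inner_normalized, IsLaplaceEigenbasis.normalized, ContinuousLinearMap.map_smul,
    propagationOperator_symm hD, heig, smul_eq_mul]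
  field_simp

end Diagonalization

end Spectral

/-! ### The propagation operator as a function of the Laplacian -/

theorem proposition5p5 {d : ℕ} (hd : 2 ≤ d) (Γ : Set (Eucl d)) (hΓ : IsClosedHypersurface Γ)
    (i : ℕ) (m n A τ : ℝ → ℝ) (hcoeff : CoefficientHypotheses i m n A τ)
    (ham : ∀ u ∈ Ioo (-1 : ℝ) 1, coeffA n A τ u * m u = 1) :
    -- the constrained elliptic problem determines the operator
    (∀ κ : H1Surf Γ, ∃! p : EnergySpace Γ m n A τ × H1SurfDual Γ,
      IsConstrainedSolution Γ m n A τ κ p) ∧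
    ∃ R : ℝ → ℝ,
      -- symbol bound for the remainder
      (∃ C : ℝ, ∀ l : ℝ, 0 < l → |R (√l)| ≤ C * l ^ ((1 : ℝ) / 2 - 1 / (2 * i + 1))) ∧
      ∀ (e : ℕ → H1Surf Γ) (lam : ℕ → ℝ), IsLaplaceEigenbasis Γ e lam →
        ∃ S Q : H1Surf Γ →L[ℝ] H1SurfDual Γ,
          IsFunctionOfSqrtLaplacian e lam (fun x => x) S ∧
          IsFunctionOfSqrtLaplacian e lam R Q ∧
          (∀ κ : H1Surf Γ, propagationOperator Γ m n A τ κ =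
            (sigmaConst * etaConst n) • S κ + sigmaConst • Q κ) ∧
          HasOrderAtMost e lam ((2 * (i : ℝ) - 1) / (2 * i + 1)) Q ∧
          (IsAffineCoupling n →
            (∃ T : L2Surf Γ →L[ℝ] L2Surf Γ, ∀ h ψ : H1Surf Γ,
              Q h ψ = ⟪T h.toL2, ψ.toL2⟫_ℝ) ∧
            ∀ N : ℕ, Tendsto (fun k => lam k ^ N * Q (e k) (e k))
              (comap lam atTop) (𝓝 0)) := by
  have hfin : IsFiniteMeasure (surfaceMeasure Γ) := hΓ.isFiniteMeasure hd
  obtain ⟨M, g, c, hD, ⟨κ₀, hκ₀, hlow⟩, haff⟩ := hcoeff.exists_transversalData ham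
  have hc1 : c 1 = quotC n 1 := (hD.quotC_eq 1 (by norm_num)).symm
  have hc2 : c (-1) = quotC n (-1) := (hD.quotC_eq (-1) (by norm_num)).symm
  obtain ⟨w, z, R, hprof, hℓ, hsymb, hR0, ⟨C, hC⟩, hR⟩ := exists_transversal_symbol
    hD.continuous_M hcoeff.one_le hκ₀ hlow hD.continuous_g hD.hasDerivAt_c
    (by rw [hc1, hc2]; exact hcoeff.quotC_sq_pos)
  have hη : (c 1 ^ 2 + c (-1) ^ 2)⁻¹ = etaConst n := by rw [hc1, hc2, etaConst]
  rw [hη] at hsymb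
  refine ⟨fun κ => existsUnique_isConstrainedSolution hD κ, R, ⟨C, hC⟩, fun e lam he => ?_⟩
  have hsqrt : ∀ k, √(lam k) ≤ 1 + lam k := fun k => by
    nlinarith [Real.sq_sqrt (he.lam_nonneg k), sq_nonneg (√(lam k) - 1), Real.sqrt_nonneg (lam k)]
  have hexp : (1 : ℝ) / (2 * i + 1) ≤ 1 / 2 := by
    have : (1 : ℝ) ≤ i := by exact_mod_cast hcoeff.one_le
    exact one_div_le_one_div_of_le (by norm_num) (by linarith)
  have hexp' : (0 : ℝ) ≤ 1 / (2 * i + 1) := by positivity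
  obtain ⟨S, hS⟩ := he.exists_isFunction (φ := fun x => x) (B := 1) fun k => by
    rw [abs_of_nonneg (Real.sqrt_nonneg _), one_mul]
    exact hsqrt k
  obtain ⟨Q, hQ⟩ := he.exists_isFunction (φ := R) (B := |C|) fun k => by
    have h0 := he.lam_nonneg k
    rcases h0.eq_or_lt with h1 | h1
    · rw [← h1, Real.sqrt_zero, hR0, abs_zero]
      positivity
    · have h2 : lam k ^ ((1 : ℝ) / 2 - 1 / (2 * i + 1)) ≤ 1 + lam k := by
        calc lam k ^ ((1 : ℝ) / 2 - 1 / (2 * i + 1))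
            ≤ (1 + lam k) ^ ((1 : ℝ) / 2 - 1 / (2 * i + 1)) :=
              Real.rpow_le_rpow h0 (by linarith) (by linarith)
          _ ≤ (1 + lam k) ^ (1 : ℝ) :=
              Real.rpow_le_rpow_of_exponent_le (by linarith) (by linarith)
          _ = 1 + lam k := Real.rpow_one _
      exact (hC _ h1).trans ((mul_le_mul_of_nonneg_right (le_abs_self C) (by positivity)).trans
        (mul_le_mul_of_nonneg_left h2 (abs_nonneg C)))
  refine ⟨S, Q, hS, hQ, fun κ => ?_, ?_, fun ha => ?_⟩
  · ext ψ
    have h1 := propagationOperator_hasSum he hΓ.compact hD hprof hℓ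
      (tendsto_symbol_div_sq hC hsymb) (φ := fun μ => etaConst n * μ + R μ)
      (by rw [hR0, mul_zero, add_zero]) hsymb κ ψ
    refine h1.unique ?_
    change HasSum _ (sigmaConst * etaConst n * S κ ψ + sigmaConst * Q κ ψ)
    have h2 := ((hS κ ψ).mul_left (sigmaConst * etaConst n)).add ((hQ κ ψ).mul_left sigmaConst)
    refine h2.congr_fun fun k => ?_
    ring
  · refine he.hasOrderAtMost ?_ hR0 hC hQ
    field_simp
    ring
  · obtain ⟨⟨B, hB⟩, hdecay⟩ := hR (haff ha)
    refine ⟨he.exists_bounded hB hQ, fun N => ?_⟩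
    have h1 : ∀ k, Q (e k) (e k) = R (√(lam k)) := fun k => by
      rw [he.isFunction_apply_eigen hQ, real_inner_self_eq_norm_sq, he.orthonormal.1 k]
      ring
    simp only [h1]
    exact (hdecay N).comp tendsto_comap
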